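/- **Setting.** Let $d\ge 1$, let $\Omega\subset\mathbb{R}^d$ be open and bounded, $X=(0,1)\times\overline\Omega$, and let $\mathcal{M}=\mathcal{M}(X)\times\mathcal{M}(X;\mathbb{R}^d)$ be the space of pairs $\mu=(\rho,m)$ of bounded Borel measures. Define $\Psi(t,x)=|x|^2/(2t)$ if $t>0$, $\Psi(0,0)=0$ and $\Psi=+\infty$ otherwise, and $$B(\rho,m)=\int_X\Psi\Big(\frac{d\rho}{d\lambda},\frac{dm}{d\lambda}\Big)\,d\lambda ,$$ where $\lambda$ is any finite positive measure with $\rho,m\ll\lambda$. For $\alpha,\beta>0$ let $J_{\alpha,\beta}(\mu)=\beta B(\mu)+\alpha\|\rho\|_{\mathcal{M}(X)}$ if $\int_X\partial_t\psi\,d\rho+\int_X\nabla\psi\cdot dm=0$ for all $\psi\in C_c^\infty(X)$, and $J_{\alpha,\beta}(\mu)=+\infty$ otherwise. Let $C_{\rm w}$ be the set of narrowly continuous curves $[0,1]\ni t\mapsto\rho_t\in\mathcal{M}(\overline\Omega)$, and write $\rho=dt\otimes\rho_t$ if $\rho$ disintegrates in time into $(\rho_t)$. Let $D$ be a real Banach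 space, $H_t$ ($t\in[0,1]$) real Hilbert spaces and $i_t:D\to H_t$ linear continuous operators such that $\|i_t\|\le C$ and $i_t(D)$ is dense in $H_t$ for a.e. $t$, and $t\mapsto\langle i_t\varphi,i_t\psi\rangle_{H_t}$ is Lebesgue measurable for all $\varphi,\psi\in D$. A map $t\mapsto f_t\in H_t$ is strongly measurable if it is an a.e. limit of step functions $\sum_j 1_{E_j}(t)\,i_t\varphi_j$ (finite sums, $E_j$ measurable, $\varphi_j\in D$), and $L^2_H$ is the space of strongly measurable $f$ with $\int_0^1\|f_t\|_{H_t}^2dt<\infty$. Let $K_t^*:\mathcal{M}(\overline\Omega)\to H_t$ be linear operators which for a.e. $t$ are weak*-to-weak continuous, with pre-adjoint $K_t:H_t\to C(\overline\Omega)$, and satisfy $\|K_t^*\|\le C$, and such that $t\mapsto K_t^*\rho$ is strongly measurable for every $\rho\in\mathcal{M}(\overline\Omega)$. Let $f\in L^2_H$. Define $T_{\alpha,\beta}=\mathcal{F}+J_{\alpha,\beta}$ on $\mathcal{M}$, where $\mathcal{F}(\mu)=\frac12\int_0^1\|K_t^*\rho_t-f_t\|_{H_t}^2dt$ if $\rho=dt\otimes\rho_t$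 with $(t\mapsto\rho_t)\in C_{\rm w}$, and $\mathcal{F}(\mu)=+\infty$ otherwise. Put $M_0=T_{\alpha,\beta}(0)$, and let $\varphi(t)=t$ for $0\le t\le M_0$, $\varphi(t)=\frac{t^2+M_0^2}{2M_0}$ for $t>M_0$ (read as $+\infty$ if $M_0=0$), $\varphi(+\infty)=+\infty$. For $\mu=(\rho,m)$ with $J_{\alpha,\beta}(\mu)<\infty$ one has $\rho=dt\otimes\rho_t$ with $(t\mapsto\rho_t)\in C_{\rm w}$; put $w_t=-K_t(K_t^*\rho_t-f_t)\in C(\overline\Omega)$. For $\rho'\in\mathcal{M}(X)$ let $\langle\rho',w\rangle=\int_0^1\int_{\overline\Omega}w_t\,d\rho'_t\,dt$ if $\rho'=dt\otimes\rho'_t$ with $(t\mapsto\rho'_t)\in C_{\rm w}$, and $\langle\rho',w\rangle=-\infty$ otherwise. Let $\hat\mu=(\hat\rho,\hat m)$ be a solution of the linearized problem $$\min_{(\rho',m')\in\mathcal{M}}\; -\langle\rho',w\rangle+\varphi\big(J_{\alpha,\beta}(\rho',m')\big).$$ The primal-dual gap is $G(\mu)=J_{\alpha,\beta}(\mu)-\varphi(J_{\alpha,\beta}(\hat\mu))-\langle\rho-\hat\rho,w\rangle$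 if $J_{\alpha,\beta}(\mu)<\infty$, and $G(\mu)=+\infty$ otherwise. The functional residual is $r(\mu)=T_{\alpha,\beta}(\mu)-\min_{\mathcal{M}}T_{\alpha,\beta}$. **Statement.** The minimum of $T_{\alpha,\beta}$ over $\mathcal{M}$ is attained, and for every $\mu$ with $J_{\alpha,\beta}(\mu)<\infty$ the linearized problem has a solution, so that $r$ and $G$ are defined. For any choice of the solutions $\hat\mu$: 1. $r(\mu)\le G(\mu)$ for every $\mu\in\mathcal{M}$ with $J_{\alpha,\beta}(\mu)<\infty$; 2. $\mu^*\in\mathcal{M}$ minimizes $T_{\alpha,\beta}$ over $\mathcal{M}$ if and only if $G(\mu^*)=0$. -/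

import Mathlib

open MeasureTheory Set Filter Topology
open scoped ENNReal ContDiff unitInterval RealInnerProductSpace

noncomputable section

namespace DynInv

/-! ### The time-space cylinder and the measures on it -/

/-- `ℝ^d` with its Euclidean norm. -/
abbrev Euc (d : ℕ) : Type := EuclideanSpace ℝ (Fin d)

/-- The cylinder `X = (0,1) × Ω̄`. -/
abbrev Cyl {d : ℕ} (Ω : Set (Euc d)) : Type := ↥(Ioo (0 : ℝ) 1) × ↥(closure Ω)

/-- The space of pairs `μ = (ρ, m)` of a bounded signed Borel measure and a bounded `ℝ^d`-valued
Borel measure on `X`. -/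
abbrev Pairs {d : ℕ} (Ω : Set (Euc d)) : Type :=
  SignedMeasure (Cyl Ω) × VectorMeasure (Cyl Ω) (Euc d)

/-- The total variation norm `‖ρ‖` of a signed measure, as an extended nonnegative number
(it is always finite). -/
def tv {Y : Type*} [MeasurableSpace Y] (ρ : SignedMeasure Y) : ℝ≥0∞ := ρ.variation univ

/-- The `i`-th component `m_i` of a vector measure. -/
def comp {Y : Type*} [MeasurableSpace Y] {d : ℕ} (m : VectorMeasure Y (Euc d)) (i : Fin d) :
    SignedMeasure Y :=
  m.mapRange (EuclideanSpace.proj i : Euc d →L[ℝ] ℝ).toLinearMap.toAddMonoidHom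
    (EuclideanSpace.proj i : Euc d →L[ℝ] ℝ).continuous

/-! ### Continuity equation, Benamou-Brenier energy, regularizer -/

/-- Smooth functions with compact support in `(0,1) × ℝ^d`; their restrictions to `X` are the
elements of `C_c^∞(X)`. They need not vanish on `(0,1) × ∂Ω`. -/
structure IsTest {d : ℕ} (ψ : ℝ × Euc d → ℝ) : Prop where
  smooth : ContDiff ℝ ∞ ψ
  compact : HasCompactSupport ψ
  supp : tsupport ψ ⊆ Ioo (0 : ℝ) 1 ×ˢ univ

/-- The inclusion of `X` in `ℝ × ℝ^d`. -/
def toAmbient {d : ℕ} {Ω : Set (Euc d)} (z : Cyl Ω) : ℝ × Euc d := ((z.1 : ℝ), (z.2 : Euc d))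

/-- `∂_t ρ + div m = 0` in `X`, in the sense of distributions:
`∫_X ∂_t ψ dρ + ∫_X ∇ψ · dm = 0` for all test functions `ψ`. -/
def ContinuityEq {d : ℕ} {Ω : Set (Euc d)} (μ : Pairs Ω) : Prop :=
  ∀ ψ : ℝ × Euc d → ℝ, IsTest ψ →
    (∫ᵛ z, fderiv ℝ ψ (toAmbient z) (1, 0) ∂•μ.1) +
      ∑ i : Fin d, (∫ᵛ z, fderiv ℝ ψ (toAmbient z) (0, EuclideanSpace.single i 1) ∂•(comp μ.2 i))
      = 0

open Classical in
/-- `Ψ(t,x) = |x|²/(2t)` for `t > 0`, `Ψ(0,0) = 0`, and `Ψ = +∞` otherwise. -/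
def Psi {d : ℕ} (t : ℝ) (x : Euc d) : ℝ≥0∞ :=
  if 0 < t then ENNReal.ofReal (‖x‖ ^ 2 / (2 * t))
  else if t = 0 ∧ x = 0 then 0
  else ⊤

/-- `∫_X Ψ(dρ/dλ, dm/dλ) dλ`, for a positive measure `λ`. -/
def energyWrt {d : ℕ} {Ω : Set (Euc d)} (l : Measure (Cyl Ω)) (μ : Pairs Ω) : ℝ≥0∞ :=
  ∫⁻ z, Psi (μ.1.rnDeriv l z) (WithLp.toLp 2 fun i => (comp μ.2 i).rnDeriv l z) ∂l

/-- The finite positive measure `|ρ| + ∑ i, |m_i|`, with respect to which `ρ` and `m` are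
absolutely continuous. -/
def refMeasure {d : ℕ} {Ω : Set (Euc d)} (μ : Pairs Ω) : Measure (Cyl Ω) :=
  μ.1.variation + ∑ i : Fin d, (comp μ.2 i).variation

/-- The Benamou-Brenier energy `B(ρ,m) = ∫_X Ψ(dρ/dλ, dm/dλ) dλ`. Its value does not depend on the
choice of `λ` with `ρ, m ≪ λ`, since `Ψ` is one-homogeneous. -/
def energy {d : ℕ} {Ω : Set (Euc d)} (μ : Pairs Ω) : ℝ≥0∞ := energyWrt (refMeasure μ) μ

open Classical in
/-- `J_{α,β}(ρ,m) = β B(ρ,m) + α ‖ρ‖` if the continuity equation holds, `+∞` otherwise. -/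
def J {d : ℕ} {Ω : Set (Euc d)} (α β : ℝ) (μ : Pairs Ω) : ℝ≥0∞ :=
  if ContinuityEq μ then ENNReal.ofReal β * energy μ + ENNReal.ofReal α * tv μ.1 else ⊤

/-! ### Curves of measures and disintegration in time -/

/-- `t ↦ ρ_t` belongs to `C_w`: it is narrowly continuous on `[0,1]`. -/
def NarrowlyContinuous {Y : Type*} [TopologicalSpace Y] [MeasurableSpace Y]
    (c : I → SignedMeasure Y) : Prop :=
  ∀ g : C(Y, ℝ), Continuous fun t => ∫ᵛ x, g x ∂•(c t)

/-- The section `{x | (t,x) ∈ E}` of a set `E ⊆ X` at time `t` (empty for `t = 0` and `t = 1`). -/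
def slice {d : ℕ} {Ω : Set (Euc d)} (E : Set (Cyl Ω)) (t : I) : Set ↥(closure Ω) :=
  {x | ∃ ht : (t : ℝ) ∈ Ioo (0 : ℝ) 1, ((⟨(t : ℝ), ht⟩, x) : Cyl Ω) ∈ E}

/-- `ρ = dt ⊗ ρ_t`, tested on Borel sets: `ρ(E) = ∫_0^1 ρ_t({x | (t,x) ∈ E}) dt`. Used for narrowly
continuous curves only, for which `t ↦ ρ_t({x | (t,x) ∈ E})` is bounded and measurable. -/
def Disintegrates {d : ℕ} {Ω : Set (Euc d)} (ρ : SignedMeasure (Cyl Ω))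
    (c : I → SignedMeasure ↥(closure Ω)) : Prop :=
  ∀ E : Set (Cyl Ω), MeasurableSet E →
    ρ E = ∫ t : I, c t (slice E t)

/-- `ρ = dt ⊗ ρ_t` for some `(t ↦ ρ_t)` in `C_w`. -/
def HasCurve {d : ℕ} {Ω : Set (Euc d)} (ρ : SignedMeasure (Cyl Ω)) : Prop :=
  ∃ c : I → SignedMeasure ↥(closure Ω), NarrowlyContinuous c ∧ Disintegrates ρ c

open Classical in
/-- The (unique) narrowly continuous curve `t ↦ ρ_t` with `ρ = dt ⊗ ρ_t`
(the zero curve if there is none). -/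
def curve {d : ℕ} {Ω : Set (Euc d)} (ρ : SignedMeasure (Cyl Ω)) :
    I → SignedMeasure ↥(closure Ω) :=
  if h : HasCurve ρ then h.choose else 0

/-! ### The sampling spaces `H_t` and the space `L²_H` -/

section Sampling

variable {D : Type*} [NormedAddCommGroup D] [NormedSpace ℝ D]
  {H : I → Type*} [∀ t, NormedAddCommGroup (H t)] [∀ t, InnerProductSpace ℝ (H t)]

/-- The assumptions on the operators `i_t : D → H_t`: uniform boundedness, density of the range,
and Lebesgue measurability of `t ↦ ⟪i_t φ, i_t ψ⟫`. -/
structure SamplingAssumption (i : ∀ t, D →L[ℝ] H t) : Prop where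
  bound : ∃ C : ℝ, ∀ᵐ t : I, ‖i t‖ ≤ C
  dense : ∀ᵐ t : I, DenseRange (i t)
  meas : ∀ φ ψ : D, AEMeasurable (fun t : I => ⟪i t φ, i t ψ⟫) volume

open Classical in
/-- Step functions `s_t = ∑ j, 1_{E_j}(t) i_t φ_j`. -/
def IsStep (i : ∀ t, D →L[ℝ] H t) (s : ∀ t, H t) : Prop :=
  ∃ (n : ℕ) (E : Fin n → Set I) (φ : Fin n → D), (∀ j, MeasurableSet (E j)) ∧
    ∀ t, s t = ∑ j, if t ∈ E j then i t (φ j) else 0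

/-- Strong measurability: `f` is an a.e. limit of step functions. -/
def StronglyMeas (i : ∀ t, D →L[ℝ] H t) (f : ∀ t, H t) : Prop :=
  ∃ s : ℕ → ∀ t, H t, (∀ n, IsStep i (s n)) ∧
    ∀ᵐ t : I, Tendsto (fun n => ‖s n t - f t‖) atTop (𝓝 0)

/-- `f ∈ L²_H`. -/
def MemL2H (i : ∀ t, D →L[ℝ] H t) (f : ∀ t, H t) : Prop :=
  StronglyMeas i f ∧ ∫⁻ t : I, ‖f t‖ₑ ^ 2 < ⊤

end Sampling

/-! ### The forward operators -/

section Forward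

variable {Y : Type*} [TopologicalSpace Y] [MeasurableSpace Y]

/-- The weak* topology of `M(Y)`, i.e. the coarsest one for which all maps `ρ ↦ ∫ g dρ`,
`g ∈ C(Y)`, are continuous. -/
abbrev weakStar (Y : Type*) [TopologicalSpace Y] [MeasurableSpace Y] :
    TopologicalSpace (SignedMeasure Y) :=
  TopologicalSpace.induced (fun ρ (g : C(Y, ℝ)) => ∫ᵛ x, g x ∂•ρ) Pi.topologicalSpace

variable {F : Type*} [NormedAddCommGroup F] [InnerProductSpace ℝ F]

/-- Weak*-to-weak continuity of a linear map `M(Y) → F`. -/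
def WeakStarToWeak (A : SignedMeasure Y →ₗ[ℝ] F) : Prop :=
  Continuous[weakStar Y, inferInstance] fun ρ => toWeakSpace ℝ F (A ρ)

open Classical in
/-- The pre-adjoint `F → C(Y)` of `A : M(Y) → F`: the image `g` of `h` is characterized by
`∫ g dρ = ⟪A ρ, h⟫` for all `ρ ∈ M(Y)`. -/
def preadjoint (A : SignedMeasure Y →ₗ[ℝ] F) (h : F) : C(Y, ℝ) :=
  if hg : ∃ g : C(Y, ℝ), ∀ ρ : SignedMeasure Y, ∫ᵛ x, g x ∂•ρ = ⟪A ρ, h⟫ then hg.choose else 0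

variable {D : Type*} [NormedAddCommGroup D] [NormedSpace ℝ D]
  {H : I → Type*} [∀ t, NormedAddCommGroup (H t)] [∀ t, InnerProductSpace ℝ (H t)]

/-- The assumptions on the operators `K_t^* : M(Y) → H_t`: weak*-to-weak continuity, uniform
boundedness for the total variation norm, strong measurability of `t ↦ K_t^* ρ`. -/
structure ForwardAssumption (i : ∀ t, D →L[ℝ] H t) (Kstar : ∀ t, SignedMeasure Y →ₗ[ℝ] H t) :
    Prop where
  weak : ∀ᵐ t : I, WeakStarToWeak (Kstar t)
  bound : ∃ C : ℝ, ∀ᵐ t : I, ∀ ρ : SignedMeasure Y, ‖Kstar t ρ‖ ≤ C * (tv ρ).toReal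
  meas : ∀ ρ : SignedMeasure Y, StronglyMeas i fun t => Kstar t ρ

end Forward

/-! ### Tikhonov functional, linearized problem, primal-dual gap -/

section Problem

variable {d : ℕ} {Ω : Set (Euc d)} {H : I → Type*} [∀ t, NormedAddCommGroup (H t)]
  [∀ t, InnerProductSpace ℝ (H t)]

open Classical in
/-- The fidelity term: `1/2 ∫_0^1 ‖K_t^* ρ_t - f_t‖² dt` if `ρ = dt ⊗ ρ_t` with `(t ↦ ρ_t) ∈ C_w`,
and `+∞` otherwise. -/
def fidelity (Kstar : ∀ t, SignedMeasure ↥(closure Ω) →ₗ[ℝ] H t) (f : ∀ t, H t)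
    (μ : Pairs Ω) : ℝ≥0∞ :=
  if HasCurve μ.1 then (∫⁻ t : I, ‖Kstar t (curve μ.1 t) - f t‖ₑ ^ 2) / 2 else ⊤

/-- The Tikhonov functional `T_{α,β} = 𝓕 + J_{α,β}`. -/
def T (Kstar : ∀ t, SignedMeasure ↥(closure Ω) →ₗ[ℝ] H t) (f : ∀ t, H t) (α β : ℝ)
    (μ : Pairs Ω) : ℝ≥0∞ :=
  fidelity Kstar f μ + J α β μ

/-- `μ` minimizes `T_{α,β}` over all pairs. -/
def SolvesP (Kstar : ∀ t, SignedMeasure ↥(closure Ω) →ₗ[ℝ] H t) (f : ∀ t, H t) (α β : ℝ)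
    (μ : Pairs Ω) : Prop :=
  ∀ ν : Pairs Ω, T Kstar f α β μ ≤ T Kstar f α β ν

open Classical in
/-- `φ(t) = t` for `t ≤ M₀`, `φ(t) = (t² + M₀²) / (2 M₀)` for `t > M₀`. In `[0,∞]`, the value for
`t > M₀ = 0` is `+∞`, and `φ(∞) = ∞`. -/
def phi (M₀ t : ℝ≥0∞) : ℝ≥0∞ := if t ≤ M₀ then t else (t ^ 2 + M₀ ^ 2) / (2 * M₀)

/-- The dual variable `w_t = -K_t (K_t^* c_t - f_t) ∈ C(Ω̄)` of a curve of measures `c`. -/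
def dualVar (Kstar : ∀ t, SignedMeasure ↥(closure Ω) →ₗ[ℝ] H t) (f : ∀ t, H t)
    (c : I → SignedMeasure ↥(closure Ω)) (t : I) : C(↥(closure Ω), ℝ) :=
  -preadjoint (Kstar t) (Kstar t (c t) - f t)

open Classical in
/-- `⟨ρ, w⟩ = ∫_0^1 ∫ w_t dρ_t dt` if `ρ = dt ⊗ ρ_t` with `(t ↦ ρ_t) ∈ C_w`, and `-∞` otherwise. -/
def pairing (ρ : SignedMeasure (Cyl Ω)) (w : I → C(↥(closure Ω), ℝ)) : EReal :=
  if HasCurve ρ then ((∫ t : I, ∫ᵛ x, w t x ∂•(curve ρ t) : ℝ) : EReal) else ⊥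

/-- The objective `ν = (ρ,m) ↦ -⟨ρ, w⟩ + φ(J_{α,β}(ν))` of the linearized problem,
with `M₀ = T_{α,β}(0)`. -/
def linObjective (Kstar : ∀ t, SignedMeasure ↥(closure Ω) →ₗ[ℝ] H t) (f : ∀ t, H t) (α β : ℝ)
    (w : I → C(↥(closure Ω), ℝ)) (ν : Pairs Ω) : EReal :=
  -pairing ν.1 w + (phi (T Kstar f α β (0 : Pairs Ω)) (J α β ν) : EReal)

/-- `ν` solves the linearized problem whose `w` is the dual variable of `μ`. -/
def SolvesLin (Kstar : ∀ t, SignedMeasure ↥(closure Ω) →ₗ[ℝ] H t) (f : ∀ t, H t) (α β : ℝ)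
    (μ ν : Pairs Ω) : Prop :=
  ∀ η : Pairs Ω, linObjective Kstar f α β (dualVar Kstar f (curve μ.1)) ν ≤
    linObjective Kstar f α β (dualVar Kstar f (curve μ.1)) η

open Classical in
/-- The primal-dual gap
`G(μ) = J_{α,β}(μ) - φ(J_{α,β}(μ̂)) - ⟨ρ - ρ̂, w⟩` if `J_{α,β}(μ) < ∞`, and `+∞` otherwise. Here
`w` is the dual variable of `μ` and `μ̂ = hat μ` is the chosen solution of the linearized
problem. -/
def gap (Kstar : ∀ t, SignedMeasure ↥(closure Ω) →ₗ[ℝ] H t) (f : ∀ t, H t) (α β : ℝ)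
    (hat : Pairs Ω → Pairs Ω) (μ : Pairs Ω) : EReal :=
  if J α β μ < ⊤ then
    (J α β μ : EReal) - (phi (T Kstar f α β (0 : Pairs Ω)) (J α β (hat μ)) : EReal)
      - pairing (μ.1 - (hat μ).1) (dualVar Kstar f (curve μ.1))
  else ⊤

/-- The functional residual `r(μ) = T_{α,β}(μ) - min T_{α,β}`. -/
def residual (Kstar : ∀ t, SignedMeasure ↥(closure Ω) →ₗ[ℝ] H t) (f : ∀ t, H t) (α β : ℝ)
    (μ : Pairs Ω) : EReal :=
  (T Kstar f α β μ : EReal) - ((⨅ ν : Pairs Ω, T Kstar f α β ν : ℝ≥0∞) : EReal)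

end Problem

end DynInv

end

/-!
The gap of `μ = (ρ, m)` equals `(J μ - ⟨ρ, w⟩) - min (φ ∘ J - ⟨·, w⟩)`, the minimum being taken
over all pairs (`gap_eq`). The fidelity term is a convex quadratic functional of the curve
`t ↦ ρ_t`, and `-w` is its gradient at `μ` (`misfit_convexCombination`), so it lies above its
tangent at `μ` (`misfit_ge`).

* `r ≤ G`: a minimizer `ν` of `T` has `J ν ≤ T ν ≤ T 0 = M₀`, hence `φ (J ν) = J ν`; inserting `ν`
  as a competitor in the linearized problem and using the tangent inequality gives
  `residual_le_gap`. In particular `G μ = 0` forces `r μ = 0`.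
* If `μ` minimizes `T`, comparison with `(1 - s) μ + s η` and `s → 0` shows that `μ` minimizes
  `J - ⟨·, w⟩` (`SolvesP.sub_dualPairing_le`). As `φ t ≥ t`, this gives `G μ ≤ 0`, while
  `0 = r μ ≤ G μ`.

Both existence statements come from the direct method (`exists_forall_le_of_coercive`), which rests
on the structure of pairs of finite cost.

* Finiteness of the energy means that `ρ = P` is a positive measure and `m = v P` with
  `v ∈ L²(P; ℝ^d)`; then `J = β/2 ∫ |v|² dP + α P(X)` (`exists_flow_of_J_lt_top`,
  `J_eq_of_isDensity`).
* Testing the continuity equation with `a(t)` and with `a(t) G(x)` shows that the time marginal of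
  `P` is a multiple of Lebesgue measure and that `t ↦ ∫ G dρ_t` has a version which is Hölder
  continuous of exponent `1/2`, with a constant controlled by the cost. This yields a narrowly
  continuous curve of constant mass (`IsFlow.exists_curve`). A narrowly continuous curve
  disintegrating `ρ` is unique (`Disintegrates.unique`), so it is the one in the definition of `T`.
* A velocity field is the same as a functional on continuous vector fields which is bounded in
  `L²(P)` and balances the time derivatives (`exists_isFlow_of_functional`, by Hahn–Banach and
  Riesz). Cauchy–Schwarz then gives convexity of `J` (`exists_convexCombination`), and passing to
  the limit in the functionals gives compactness of its sublevel sets, with narrow convergence of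
  the curves at every time, by equicontinuity (`exists_subseq_of_J_le`).

The pairing with a fixed `w` is continuous along such sequences (`tendsto_dualPairing`), because
`K_t^*` has a pre-adjoint (`WeakStarToWeak.integral_preadjoint`). For `T`, lower semicontinuity of
the fidelity term follows from its tangent inequality at the limit. For the linearized problem,
coercivity holds since `φ` grows quadratically and the pairing at most linearly in `J`; if `M₀ = 0`,
then `φ` is infinite away from `0` and the zero pair is a solution.
-/

noncomputable section

namespace DynInv

/-! ### Integrals against signed measures -/

section SignedIntegral

variable {X : Type*} [MeasurableSpace X]

instance isFiniteMeasure_variation (s : SignedMeasure X) : IsFiniteMeasure s.variation := by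
  rw [← SignedMeasure.totalVariation_eq_variation]
  infer_instance

theorem integral_lsmul_toSignedMeasure (P : Measure X) [IsFiniteMeasure P] (g : X → ℝ) :
    ∫ᵛ x, g x ∂•P.toSignedMeasure = ∫ x, g x ∂P := by
  rw [← VectorMeasure.integral_toSignedMeasure]
  congr 1
  ext
  simp

theorem integrable_variation_of_bounded (s : SignedMeasure X) {g : X → ℝ} (hg : Measurable g)
    {c : ℝ} (hc : ∀ x, ‖g x‖ ≤ c) : VectorMeasure.Integrable s g :=
  Integrable.of_bound hg.aestronglyMeasurable c (Eventually.of_forall hc)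

theorem signed_eq_sub (s : SignedMeasure X) :
    s = s.toJordanDecomposition.posPart.toSignedMeasure -
      s.toJordanDecomposition.negPart.toSignedMeasure :=
  s.toSignedMeasure_toJordanDecomposition.symm

theorem integral_lsmul_sub (P N : Measure X) [IsFiniteMeasure P] [IsFiniteMeasure N] {g : X → ℝ}
    (hg : Measurable g) {c : ℝ} (hc : ∀ x, ‖g x‖ ≤ c) :
    ∫ᵛ x, g x ∂•(P.toSignedMeasure - N.toSignedMeasure) = ∫ x, g x ∂P - ∫ x, g x ∂N := by
  rw [VectorMeasure.integral_sub_vectorMeasure (integrable_variation_of_bounded _ hg hc)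
    (integrable_variation_of_bounded _ hg hc), integral_lsmul_toSignedMeasure,
    integral_lsmul_toSignedMeasure]

theorem integral_lsmul_withDensityᵥ (l : Measure X) {f : X → ℝ} (hf : Integrable f l)
    {g : X → ℝ} (hg : Measurable g) {c : ℝ} (hc : ∀ x, ‖g x‖ ≤ c) :
    ∫ᵛ x, g x ∂•(l.withDensityᵥ f) = ∫ x, g x * f x ∂l := by
  have h1 := isFiniteMeasure_withDensity_ofReal hf.2
  have h2 := isFiniteMeasure_withDensity_ofReal hf.neg.2
  simp only [Pi.neg_apply] at h2
  rw [withDensityᵥ_eq_withDensity_pos_part_sub_withDensity_neg_part hf,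
    integral_lsmul_sub _ _ hg hc,
    integral_withDensity_eq_integral_toReal_smul₀ hf.1.aemeasurable.ennreal_ofReal (by simp)]
  have h3 := integral_withDensity_eq_integral_toReal_smul₀ (g := g)
    hf.1.aemeasurable.neg.ennreal_ofReal (by simp)
  simp only [Pi.neg_apply] at h3
  rw [h3, ← integral_sub]
  · refine integral_congr_ae (Eventually.of_forall fun x => ?_)
    simp only [ENNReal.toReal_ofReal', smul_eq_mul]
    rw [← sub_mul, max_zero_sub_max_neg_zero_eq_self, mul_comm]
  · simp only [ENNReal.toReal_ofReal']
    exact (hf.pos_part).mul_bdd hg.aestronglyMeasurable (Eventually.of_forall hc)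
  · simp only [ENNReal.toReal_ofReal']
    exact (hf.neg_part).mul_bdd hg.aestronglyMeasurable (Eventually.of_forall hc)

end SignedIntegral

/-! ### Pairs of finite energy as flows -/

section Flow

variable {d : ℕ} {Ω : Set (Euc d)}

/-- `v` is a square integrable velocity field for which `∂_t P + div (v P) = 0` holds weakly, tested
with the same functions as in `ContinuityEq`. -/
structure IsFlow (P : Measure (Cyl Ω)) (v : Cyl Ω → Euc d) : Prop where
  meas : Measurable v
  memLp : MemLp v 2 P
  eq : ∀ ψ : ℝ × Euc d → ℝ, IsTest ψ →
    ∫ z, fderiv ℝ ψ (toAmbient z) (1, 0) ∂P + ∫ z, fderiv ℝ ψ (toAmbient z) (0, v z) ∂P = 0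

/-- `μ = (P, v P)`, the second equality being stated for each component. -/
def IsDensity (μ : Pairs Ω) (P : Measure (Cyl Ω)) [IsFiniteMeasure P] (v : Cyl Ω → Euc d) : Prop :=
  μ.1 = P.toSignedMeasure ∧ ∀ i, comp μ.2 i = P.withDensityᵥ fun z => v z i

theorem measurable_Psi : Measurable fun p : ℝ × Euc d => Psi p.1 p.2 := by
  unfold Psi
  refine Measurable.ite (measurableSet_lt measurable_const measurable_fst) ?_
    (Measurable.ite ?_ measurable_const measurable_const)
  · fun_prop
  · exact (measurableSet_eq_fun measurable_fst measurable_const).inter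
      (measurableSet_eq_fun measurable_snd measurable_const)

/-- One-homogeneity: `Ψ(r, r x) = r |x|²/2`, also for `r = 0`. -/
theorem Psi_smul (r : ℝ≥0∞) (hr : r < ⊤) (x : Euc d) :
    Psi r.toReal (r.toReal • x) = r * (‖x‖ₑ ^ 2 / 2) := by
  lift r to NNReal using hr.ne
  rcases eq_or_ne r 0 with rfl | h
  · simp [Psi]
  have hr : (0 : ℝ) < r := by positivity
  have h2 : (‖x‖ₑ ^ 2 / 2 : ℝ≥0∞) = ENNReal.ofReal (‖x‖ ^ 2 / 2) := by
    rw [ENNReal.ofReal_div_of_pos (by norm_num), ← ofReal_norm, ENNReal.ofReal_pow (norm_nonneg x)]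
    norm_num
  rw [Psi, ENNReal.coe_toReal, if_pos hr, h2, ← ENNReal.ofReal_coe_nnreal,
    ← ENNReal.ofReal_mul hr.le]
  congr 1
  rw [norm_smul, Real.norm_of_nonneg hr.le]
  field_simp

/-- The Benamou–Brenier energy of `(P, v P)` is the kinetic energy `1/2 ∫ |v|² dP`. -/
theorem energy_eq_of_isDensity {μ : Pairs Ω} {P : Measure (Cyl Ω)} [IsFiniteMeasure P]
    {v : Cyl Ω → Euc d} (h : IsDensity μ P v) (hvm : Measurable v)
    (hv : ∀ i, Integrable (fun z => v z i) P) :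
    energy μ = (∫⁻ z, ‖v z‖ₑ ^ 2 ∂P) / 2 := by
  have hfin : IsFiniteMeasure (refMeasure μ) := by
    unfold refMeasure; infer_instance
  have hac : P ≪ refMeasure μ := by
    refine Measure.absolutelyContinuous_of_le (le_trans ?_ (Measure.le_add_right le_rfl))
    rw [h.1, Measure.variation_toSignedMeasure]
  unfold energy energyWrt
  set l := refMeasure μ
  have hr := Measure.rnDeriv_lt_top P l
  have hi1 : Integrable (fun z => (P.rnDeriv l z).toReal) l := Measure.integrable_toReal_rnDeriv
  have h1 : (fun z => (P.rnDeriv l z).toReal) =ᵐ[l] μ.1.rnDeriv l := by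
    refine SignedMeasure.eq_rnDeriv 0 _ hi1 VectorMeasure.MutuallySingular.zero_left ?_
    rw [zero_add, withDensityᵥ_toReal (Measure.measurable_rnDeriv P l).aemeasurable
      (Measure.lintegral_rnDeriv_lt_top P l).ne, h.1]
    congr 1
    exact (Measure.withDensity_rnDeriv_eq P l hac).symm
  have h2 : ∀ i, (fun z => (P.rnDeriv l z).toReal • v z i) =ᵐ[l] (comp μ.2 i).rnDeriv l := by
    intro i
    refine SignedMeasure.eq_rnDeriv 0 _ ((integrable_rnDeriv_smul_iff hac).mpr (hv i))
      VectorMeasure.MutuallySingular.zero_left ?_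
    rw [zero_add, withDensityᵥ_rnDeriv_smul hac (hv i), h.2 i]
  have h3 : ∀ᵐ z ∂l, Psi (μ.1.rnDeriv l z) (WithLp.toLp 2 fun i => (comp μ.2 i).rnDeriv l z) =
      P.rnDeriv l z * (‖v z‖ₑ ^ 2 / 2) := by
    filter_upwards [hr, h1, ae_all_iff.2 h2] with z hz1 hz2 hz3
    rw [← Psi_smul _ hz1, ← hz2]
    congr 1
    ext i
    simp [← hz3 i]
  rw [lintegral_congr_ae h3, lintegral_rnDeriv_mul hac, ENNReal.div_eq_inv_mul,
    ← lintegral_const_mul']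
  · simp only [ENNReal.div_eq_inv_mul]
  · simp
  · exact ((hvm.enorm.pow_const 2).div_const 2).aemeasurable

theorem fderiv_apply_eq_sum (A : ℝ × Euc d →L[ℝ] ℝ) (x : Euc d) :
    A (0, x) = ∑ i, A (0, EuclideanSpace.single i 1) * x i := by
  have hx : x = ∑ i, x i • EuclideanSpace.single i (1 : ℝ) := by
    have := (EuclideanSpace.basisFun (Fin d) ℝ).sum_repr x
    simpa using this.symm
  have : ((0 : ℝ), x) = ∑ i, x i • ((0 : ℝ), EuclideanSpace.single i (1 : ℝ)) := by
    conv_lhs => rw [hx]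
    ext1
    · simp [Prod.fst_sum]
    · simp [Prod.snd_sum]
  rw [this, map_sum]
  simp only [map_smul, smul_eq_mul, mul_comm]

theorem continuous_toAmbient : Continuous (toAmbient : Cyl Ω → ℝ × Euc d) := by
  unfold toAmbient; fun_prop

theorem IsTest.continuous_fderiv_apply {ψ : ℝ × Euc d → ℝ} (h : IsTest ψ) (w : ℝ × Euc d) :
    Continuous fun z => fderiv ℝ ψ z w :=
  (h.smooth.continuous_fderiv (by simp)).clm_apply continuous_const

theorem IsTest.exists_fderiv_bound {ψ : ℝ × Euc d → ℝ} (h : IsTest ψ) :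
    ∃ c : ℝ, 0 ≤ c ∧ ∀ z, ‖fderiv ℝ ψ z‖ ≤ c := by
  obtain ⟨c, hc⟩ := (h.compact.fderiv (𝕜 := ℝ)).exists_bound_of_continuous
    (h.smooth.continuous_fderiv (by simp))
  exact ⟨c, (norm_nonneg _).trans (hc 0), hc⟩

theorem IsTest.exists_bound {ψ : ℝ × Euc d → ℝ} (h : IsTest ψ) (w : ℝ × Euc d) :
    ∃ c : ℝ, ∀ z, ‖fderiv ℝ ψ z w‖ ≤ c := by
  obtain ⟨c, -, hc⟩ := h.exists_fderiv_bound
  exact ⟨c * ‖w‖, fun z => (ContinuousLinearMap.le_opNorm _ _).trans (by gcongr; exact hc z)⟩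

theorem integrable_coord {P : Measure (Cyl Ω)} {v : Cyl Ω → Euc d} (hv : Integrable v P)
    (i : Fin d) : Integrable (fun z => v z i) P :=
  (EuclideanSpace.proj i : Euc d →L[ℝ] ℝ).integrable_comp hv

theorem continuityEq_iff {μ : Pairs Ω} {P : Measure (Cyl Ω)} [IsFiniteMeasure P]
    {v : Cyl Ω → Euc d} (h : IsDensity μ P v) (hv : Integrable v P) :
    ContinuityEq μ ↔ ∀ ψ : ℝ × Euc d → ℝ, IsTest ψ →
      ∫ z, fderiv ℝ ψ (toAmbient z) (1, 0) ∂P +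
        ∫ z, fderiv ℝ ψ (toAmbient z) (0, v z) ∂P = 0 := by
  unfold ContinuityEq
  refine forall_congr' fun ψ => forall_congr' fun hψ => ?_
  have key : ∀ i, ∫ᵛ z, fderiv ℝ ψ (toAmbient z) (0, EuclideanSpace.single i 1) ∂•(comp μ.2 i) =
      ∫ z, fderiv ℝ ψ (toAmbient z) (0, EuclideanSpace.single i 1) * v z i ∂P := by
    intro i
    obtain ⟨c, hc⟩ := hψ.exists_bound (0, EuclideanSpace.single i 1)
    rw [h.2 i]
    exact integral_lsmul_withDensityᵥ _ (integrable_coord hv i)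
      ((hψ.continuous_fderiv_apply _).comp continuous_toAmbient).measurable fun z => hc _
  rw [h.1, integral_lsmul_toSignedMeasure, Finset.sum_congr rfl fun i _ => key i,
    ← integral_finsetSum]
  · simp_rw [← fderiv_apply_eq_sum]
  · intro i _
    obtain ⟨c, hc⟩ := hψ.exists_bound (0, EuclideanSpace.single i 1)
    exact (integrable_coord hv i).bdd_mul
      ((hψ.continuous_fderiv_apply _).comp continuous_toAmbient).aestronglyMeasurable
      (Eventually.of_forall fun z => hc _)

/-- The regularizer `β/2 ∫ |v|² dP + α P(X)` of `(P, v P)`. -/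
def flowCost (α β : ℝ) (P : Measure (Cyl Ω)) (v : Cyl Ω → Euc d) : ℝ≥0∞ :=
  ENNReal.ofReal β * ((∫⁻ z, ‖v z‖ₑ ^ 2 ∂P) / 2) + ENNReal.ofReal α * P univ

theorem J_eq_of_isDensity {α β : ℝ} {μ : Pairs Ω} {P : Measure (Cyl Ω)} [IsFiniteMeasure P]
    {v : Cyl Ω → Euc d} (h : IsDensity μ P v) (hv : IsFlow P v) :
    J α β μ = flowCost α β P v := by
  have hvi : Integrable v P := hv.memLp.integrable (by norm_num)
  rw [J, if_pos ((continuityEq_iff h hvi).2 hv.eq),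
    energy_eq_of_isDensity h hv.meas (integrable_coord hvi), flowCost, tv, h.1,
    Measure.variation_toSignedMeasure]

theorem exists_isDensity (P : Measure (Cyl Ω)) [IsFiniteMeasure P] {v : Cyl Ω → Euc d}
    (hv : IsFlow P v) : ∃ μ : Pairs Ω, IsDensity μ P v := by
  refine ⟨(P.toSignedMeasure, P.withDensityᵥ v), rfl, fun i => ?_⟩
  have hvi : Integrable v P := hv.memLp.integrable (by norm_num)
  ext s hs
  have h1 : comp (P.withDensityᵥ v) i s = (P.withDensityᵥ v s) i :=
    VectorMeasure.mapRange_apply _ _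
  rw [h1, withDensityᵥ_apply hvi hs, withDensityᵥ_apply (integrable_coord hvi i) hs]
  exact ((EuclideanSpace.proj i : Euc d →L[ℝ] ℝ).integral_comp_comm hvi.integrableOn).symm

/-- Finite cost forces `ρ ≥ 0` and `m ≪ ρ` with square integrable density: `Ψ` is infinite for
negative first argument, and at `(0, x)` with `x ≠ 0`. -/
theorem exists_flow_of_J_lt_top {α β : ℝ} (hβ : 0 < β) {μ : Pairs Ω} (hμ : J α β μ < ⊤) :
    ∃ (P : Measure (Cyl Ω)) (_ : IsFiniteMeasure P) (v : Cyl Ω → Euc d),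
      IsFlow P v ∧ IsDensity μ P v := by
  have hce : ContinuityEq μ := by
    by_contra h
    simp [J, h] at hμ
  have hen : energy μ < ⊤ := by
    rw [J, if_pos hce, ENNReal.add_lt_top] at hμ
    by_contra h
    rw [not_lt, top_le_iff] at h
    simp [h, hβ] at hμ
  have hfin : IsFiniteMeasure (refMeasure μ) := by
    unfold refMeasure; infer_instance
  have hen' := hen
  unfold energy energyWrt at hen
  set l := refMeasure μ with hl
  set r := μ.1.rnDeriv l
  set m : Fin d → Cyl Ω → ℝ := fun i => (comp μ.2 i).rnDeriv l
  have hrm : Measurable r := SignedMeasure.measurable_rnDeriv _ _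
  have hmm : ∀ i, Measurable (m i) := fun i => SignedMeasure.measurable_rnDeriv _ _
  have hmm' : Measurable fun z => (WithLp.toLp 2 fun i => m i z : Euc d) :=
    (MeasurableEquiv.toLp 2 (Fin d → ℝ)).measurable.comp (measurable_pi_lambda _ hmm)
  have hr1 : l.withDensityᵥ r = μ.1 := by
    refine SignedMeasure.withDensityᵥ_rnDeriv_eq _ _ (VectorMeasure.AbsolutelyContinuous.mk ?_)
    intro s hs hs0
    rw [Measure.toENNRealVectorMeasure_apply_measurable hs] at hs0
    have : μ.1.variation s = 0 := by
      refine le_antisymm (le_trans ?_ hs0.le) zero_le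
      exact Measure.le_iff'.1 (Measure.le_add_right le_rfl) s
    have h2 := VectorMeasure.enorm_measure_le_variation μ.1 s
    simpa [this] using h2
  have hm1 : ∀ i, l.withDensityᵥ (m i) = comp μ.2 i := by
    intro i
    refine SignedMeasure.withDensityᵥ_rnDeriv_eq _ _ (VectorMeasure.AbsolutelyContinuous.mk ?_)
    intro s hs hs0
    rw [Measure.toENNRealVectorMeasure_apply_measurable hs] at hs0
    have : (comp μ.2 i).variation s = 0 := by
      refine le_antisymm (le_trans ?_ hs0.le) zero_le
      refine Measure.le_iff'.1 (Measure.le_add_left ?_) s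
      exact Finset.single_le_sum (f := fun i => (comp μ.2 i).variation)
        (fun _ _ => Measure.zero_le _) (Finset.mem_univ i)
    have h2 := VectorMeasure.enorm_measure_le_variation (comp μ.2 i) s
    simpa [this] using h2
  have hfinPsi : ∀ᵐ z ∂l, Psi (r z) (WithLp.toLp 2 fun i => m i z) < ⊤ :=
    ae_lt_top (measurable_Psi.comp (hrm.prodMk hmm')) hen.ne
  -- where `r z = 0` the quotient is `0` by convention, and `m` vanishes there as well
  have hpos : ∀ᵐ z ∂l, 0 ≤ r z ∧ ∀ i, m i z = r z * (m i z / r z) := by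
    filter_upwards [hfinPsi] with z hz
    by_cases h0 : 0 < r z
    · exact ⟨h0.le, fun i => by field_simp⟩
    · rw [Psi, if_neg h0] at hz
      by_cases h1 : r z = 0 ∧ (WithLp.toLp 2 fun i => m i z : Euc d) = 0
      · refine ⟨h1.1.ge, fun i => ?_⟩
        have : m i z = 0 := by
          have := congrArg (fun x : Euc d => x i) h1.2
          simpa using this
        simp [this]
      · exact absurd hz (by rw [if_neg h1]; exact lt_irrefl _)
  have hri : Integrable r l := SignedMeasure.integrable_rnDeriv _ _
  set P := l.withDensity fun z => ENNReal.ofReal (r z) with hP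
  have hPfin : IsFiniteMeasure P := isFiniteMeasure_withDensity_ofReal hri.2
  set v : Cyl Ω → Euc d := fun z => WithLp.toLp 2 fun i => m i z / r z
  have hvm : Measurable v :=
    (MeasurableEquiv.toLp 2 (Fin d → ℝ)).measurable.comp
      (measurable_pi_lambda _ fun i => (hmm i).div hrm)
  have hmi : ∀ i, Integrable (m i) l := fun i => SignedMeasure.integrable_rnDeriv _ _
  have hmr : ∀ i, m i =ᵐ[l] fun z => (ENNReal.ofReal (r z)).toReal • v z i := by
    intro i
    filter_upwards [hpos] with z hz
    rw [ENNReal.toReal_ofReal hz.1, hz.2 i]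
    simp [v]
  have hvi : ∀ i, Integrable (fun z => v z i) P := by
    intro i
    rw [hP, integrable_withDensity_iff_integrable_smul₀' hrm.ennreal_ofReal.aemeasurable (by simp)]
    exact (hmi i).congr (hmr i)
  have hden : IsDensity μ P v := by
    constructor
    · rw [← hr1, ← withDensityᵥ_toReal hrm.ennreal_ofReal.aemeasurable]
      · refine WithDensityᵥEq.congr_ae ?_
        filter_upwards [hpos] with z hz
        rw [ENNReal.toReal_ofReal hz.1]
      · have := measure_lt_top P univ
        rw [hP, withDensity_apply _ MeasurableSet.univ, Measure.restrict_univ] at this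
        exact this.ne
    · intro i
      rw [← hm1, WithDensityᵥEq.congr_ae (hmr i), hP]
      refine withDensityᵥ_smul_eq_withDensityᵥ_withDensity'
        hrm.ennreal_ofReal.aemeasurable (by simp) ((hmi i).congr (hmr i))
  have hen2 := energy_eq_of_isDensity hden hvm hvi
  have hL2 : MemLp v 2 P := by
    refine ⟨hvm.aestronglyMeasurable, ?_⟩
    rw [eLpNorm_lt_top_iff_lintegral_rpow_enorm_lt_top (by simp) (by simp)]
    have : (∫⁻ z, ‖v z‖ₑ ^ 2 ∂P) / 2 < ⊤ := hen2 ▸ hen'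
    have h2 : ∫⁻ z, ‖v z‖ₑ ^ 2 ∂P < ⊤ := by
      by_contra h
      rw [not_lt, top_le_iff] at h
      simp [h, ENNReal.top_div] at this
    simpa using h2
  exact ⟨P, hPfin, v, ⟨hvm, hL2,
    (continuityEq_iff hden (hL2.integrable (by norm_num))).1 hce⟩, hden⟩

end Flow

/-! ### Weak derivatives on the time interval -/

section Time

/-- Smooth functions of time with compact support in `(0,1)`. -/
structure IsTimeTest (a : ℝ → ℝ) : Prop where
  smooth : ContDiff ℝ ∞ a
  compact : HasCompactSupport a
  supp : tsupport a ⊆ Ioo (0 : ℝ) 1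

theorem IsTimeTest.deriv {a : ℝ → ℝ} (h : IsTimeTest a) : IsTimeTest (deriv a) :=
  ⟨(contDiff_infty_iff_deriv.1 h.smooth).2, h.compact.deriv,
    (closure_mono (support_deriv_subset)).trans
      (by rw [(isClosed_tsupport a).closure_eq]; exact h.supp)⟩

theorem IsTimeTest.integrable {a : ℝ → ℝ} (h : IsTimeTest a) {ν : Measure ℝ}
    [IsFiniteMeasureOnCompacts ν] : Integrable a ν :=
  h.smooth.continuous.integrable_of_hasCompactSupport h.compact

theorem IsTimeTest.sub_const_mul {a b : ℝ → ℝ} (ha : IsTimeTest a) (hb : IsTimeTest b) (c : ℝ) :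
    IsTimeTest fun x => a x - c * b x := by
  have h2 : HasCompactSupport fun x => c * b x := hb.compact.mul_left
  refine ⟨ha.smooth.sub (contDiff_const.mul hb.smooth), ha.compact.sub h2, ?_⟩
  refine (tsupport_sub _ _).trans (union_subset ha.supp ?_)
  exact (tsupport_mul_subset_right (f := fun _ => c) (g := b)).trans hb.supp

/-- Test functions of mean zero are the derivatives of test functions. -/
theorem IsTimeTest.exists_antideriv {b : ℝ → ℝ} (h : IsTimeTest b) (h0 : ∫ x, b x = 0) :
    ∃ a, IsTimeTest a ∧ _root_.deriv a = b := by
  set a : ℝ → ℝ := fun t => ∫ x in (0 : ℝ)..t, b x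
  have hd : ∀ t, HasDerivAt a (b t) t := fun t =>
    intervalIntegral.integral_hasDerivAt_right (h.smooth.continuous.intervalIntegrable _ _)
      (h.smooth.continuous.stronglyMeasurableAtFilter _ _) h.smooth.continuous.continuousAt
  have hda : _root_.deriv a = b := funext fun t => (hd t).deriv
  have hsm : ContDiff ℝ ∞ a := contDiff_infty_iff_deriv.2
    ⟨fun t => (hd t).differentiableAt, hda ▸ h.smooth⟩
  have hz : ∀ t, b t ≠ 0 → t ∈ tsupport b := fun t ht => subset_tsupport b ht
  obtain ⟨l, u, hl, hu, hlu⟩ : ∃ l u, 0 < l ∧ u < 1 ∧ tsupport b ⊆ Icc l u := by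
    have hK : IsCompact (tsupport b) := h.compact
    rcases (tsupport b).eq_empty_or_nonempty with he | hne
    · exact ⟨1/2, 1/2, by norm_num, by norm_num, by simp [he]⟩
    · obtain ⟨l, hl, hl'⟩ := hK.exists_isLeast hne
      obtain ⟨u, hu, hu'⟩ := hK.exists_isGreatest hne
      exact ⟨l, u, (h.supp hl).1, (h.supp hu).2, fun x hx => ⟨hl' hx, hu' hx⟩⟩
  have h1 : ∀ t, t < l → a t = 0 := by
    intro t ht
    refine intervalIntegral.integral_zero_ae (Eventually.of_forall fun x hx => ?_)
    by_contra hb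
    have h3 := hlu (hz x hb)
    have h4 := hx.2
    have : max 0 t < l := max_lt hl ht
    linarith [h3.1]
  have h2 : ∀ t, u < t → a t = 0 := by
    intro t ht
    have h5 : ∀ x, x ∉ Ioc (min 0 t) t → b x = 0 := by
      intro x hx
      by_contra hb
      have h3 := hlu (hz x hb)
      have : min 0 t ≤ 0 := min_le_left _ _
      exact hx ⟨by linarith [h3.1], by linarith [h3.2]⟩
    by_cases h0t : 0 ≤ t
    · rw [min_eq_left h0t] at h5
      show ∫ x in (0 : ℝ)..t, b x = 0
      rw [intervalIntegral.integral_of_le h0t,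
        setIntegral_eq_integral_of_forall_compl_eq_zero h5, h0]
    · have hb : ∀ x, b x = 0 := by
        intro x
        by_contra hb
        have h3 := hlu (hz x hb)
        linarith [h3.1, h3.2]
      show ∫ x in (0 : ℝ)..t, b x = 0
      simp [hb]
  have hsupp : tsupport a ⊆ Icc l u := by
    refine closure_minimal (fun x hx => ?_) isClosed_Icc
    by_contra hn
    rw [mem_Icc, not_and_or, not_le, not_le] at hn
    exact hx (hn.elim (h1 x) (h2 x))
  exact ⟨a, ⟨hsm, isCompact_Icc.of_isClosed_subset (isClosed_tsupport _) hsupp,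
    hsupp.trans fun x hx => ⟨hl.trans_le hx.1, hx.2.trans_lt hu⟩⟩, hda⟩

theorem isTimeTest_bump {c : ℝ} (f : ContDiffBump c) (h0 : 0 < c - f.rOut) (h1 : c + f.rOut < 1) :
    IsTimeTest f := by
  refine ⟨f.contDiff, f.hasCompactSupport, ?_⟩
  rw [f.tsupport_eq, Real.closedBall_eq_Icc]
  exact fun x hx => ⟨h0.trans_le hx.1, hx.2.trans_lt h1⟩

theorem exists_isTimeTest_integral_eq_one : ∃ η : ℝ → ℝ, IsTimeTest η ∧ ∫ x, η x = 1 := by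
  let f : ContDiffBump (1 / 2 : ℝ) := ⟨1 / 8, 1 / 4, by norm_num, by norm_num⟩
  have hf : IsTimeTest f := isTimeTest_bump f (by norm_num [f]) (by norm_num [f])
  have hpos : (∫ x, f x) ≠ 0 := f.integral_pos.ne'
  refine ⟨f.normed volume, ⟨f.contDiff_normed, f.hasCompactSupport_normed, ?_⟩, f.integral_normed⟩
  rw [f.tsupport_normed_eq, ← f.tsupport_eq]
  exact hf.supp

/-- The lemma of du Bois-Reymond: a function with vanishing weak derivative is constant. Any test
function `b` differs from a derivative by the multiple `(∫ b) η` of a fixed test function `η` of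
integral one. -/
theorem ae_eq_const_of_integral_deriv_mul_eq_zero {u : ℝ → ℝ} (hu : IntegrableOn u (Ioo 0 1))
    (h : ∀ a, IsTimeTest a → ∫ t in Ioo (0 : ℝ) 1, deriv a t * u t = 0) :
    ∃ c, ∀ᵐ t, t ∈ Ioo (0 : ℝ) 1 → u t = c := by
  obtain ⟨η, hη, hη1⟩ := exists_isTimeTest_integral_eq_one
  have hint : ∀ b, IsTimeTest b → IntegrableOn (fun t => b t * u t) (Ioo 0 1) := by
    intro b hb
    obtain ⟨C, hC⟩ := hb.compact.exists_bound_of_continuous hb.smooth.continuous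
    exact hu.bdd_mul hb.smooth.continuous.aestronglyMeasurable (Eventually.of_forall hC)
  refine ⟨∫ t in Ioo (0 : ℝ) 1, η t * u t, ?_⟩
  set c := ∫ t in Ioo (0 : ℝ) 1, η t * u t
  have hloc : LocallyIntegrableOn (fun t => u t - c) (Ioo 0 1) :=
    IntegrableOn.locallyIntegrableOn (hu.sub (integrableOn_const (by simp)))
  have := IsOpen.ae_eq_zero_of_integral_contDiff_smul_eq_zero (μ := volume) isOpen_Ioo hloc ?_
  · filter_upwards [this] with t ht hmem
    linarith [ht hmem]
  intro b hb1 hb2 hb3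
  have hb : IsTimeTest b := ⟨hb1, hb2, hb3⟩
  have hzero : ∀ x, x ∉ Ioo (0 : ℝ) 1 → b x = 0 := fun x hx =>
    image_eq_zero_of_notMem_tsupport fun h' => hx (hb3 h')
  have hmean : ∫ x, (b x - (∫ y, b y) * η x) = 0 := by
    rw [integral_sub hb.integrable (hη.integrable.const_mul _), integral_const_mul, hη1]
    ring
  obtain ⟨a, ha, hda⟩ := (hb.sub_const_mul hη (∫ y, b y)).exists_antideriv hmean
  have h1 := h a ha
  rw [hda] at h1
  have h2 : ∫ t in Ioo (0 : ℝ) 1, b t * u t = (∫ y, b y) * c := by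
    have : ∫ t in Ioo (0 : ℝ) 1, (b t * u t - (∫ y, b y) * (η t * u t)) = 0 := by
      refine Eq.trans (integral_congr_ae (Eventually.of_forall fun t => ?_)) h1; simp only; ring
    rw [integral_sub (hint b hb) ((hint η hη).const_mul _), integral_const_mul] at this
    linarith
  rw [← setIntegral_eq_integral_of_forall_compl_eq_zero (s := Ioo (0 : ℝ) 1)
    (fun x hx => by simp [hzero x hx])]
  simp only [smul_eq_mul, mul_sub]
  rw [integral_sub (hint b hb) (hb.integrable.integrableOn.mul_const c), h2, integral_mul_const,
    setIntegral_eq_integral_of_forall_compl_eq_zero hzero, sub_self]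

/-- A finite measure on `(0,1)` with vanishing distributional derivative is a multiple of Lebesgue
measure. -/
theorem measure_eq_of_integral_deriv_eq_zero (ν : Measure ℝ) [IsFiniteMeasure ν]
    (hν : ν (Ioo 0 1)ᶜ = 0) (h : ∀ a, IsTimeTest a → ∫ t, deriv a t ∂ν = 0) :
    ν = ν univ • volume.restrict (Ioo 0 1) := by
  obtain ⟨η, hη, hη1⟩ := exists_isTimeTest_integral_eq_one
  set c := ∫ t, η t ∂ν
  have hb : ∀ b, IsTimeTest b → ∫ t, b t ∂ν = (∫ t, b t) * c := by
    intro b hb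
    have hmean : ∫ x, (b x - (∫ y, b y) * η x) = 0 := by
      rw [integral_sub hb.integrable (hη.integrable.const_mul _), integral_const_mul, hη1]
      ring
    obtain ⟨a, ha, hda⟩ := (hb.sub_const_mul hη (∫ y, b y)).exists_antideriv hmean
    have h1 := h a ha
    rw [hda, integral_sub hb.integrable (hη.integrable.const_mul _), integral_const_mul] at h1
    linarith
  -- bumps increasing to the indicator of an open subinterval
  have key : ∀ s t : ℝ, 0 ≤ s → s < t → t ≤ 1 → ν.real (Ioo s t) = (t - s) * c := by
    intro s t hs hst ht
    set L := (t - s) / 2 with hL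
    have hLpos : 0 < L := by rw [hL]; linarith
    set x0 := (s + t) / 2 with hx0
    have hdel : ∀ n : ℕ, 0 < L / (n + 3 : ℝ) ∧ 2 * (L / (n + 3 : ℝ)) < L := by
      intro n
      have h3 : (0 : ℝ) < n + 3 := by positivity
      refine ⟨by positivity, ?_⟩
      rw [← mul_div_assoc, div_lt_iff₀ h3]
      have : (0 : ℝ) ≤ n := by positivity
      nlinarith
    let f : ℕ → ContDiffBump x0 := fun n =>
      ⟨L - 2 * (L / (n + 3 : ℝ)), L - L / (n + 3 : ℝ), by linarith [(hdel n).2],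
        by linarith [(hdel n).1]⟩
    have hball : Metric.ball x0 L = Ioo s t := by
      rw [Real.ball_eq_Ioo]; congr 1 <;> rw [hx0, hL] <;> ring
    have hf : ∀ n, IsTimeTest (f n) := by
      intro n
      refine isTimeTest_bump _ ?_ ?_ <;> simp only [f, hx0] <;> linarith [(hdel n).1]
    have htend : Tendsto (fun n : ℕ => L - 2 * (L / (n + 3 : ℝ))) atTop (𝓝 L) := by
      have h1 : Tendsto (fun n : ℕ => (n : ℝ) + 3) atTop atTop :=
        tendsto_atTop_add_const_right _ _ tendsto_natCast_atTop_atTop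
      have h2 := ((tendsto_const_nhds (x := L)).div_atTop h1).const_mul 2
      simpa using h2.const_sub L
    have hlim : ∀ x, Tendsto (fun n => f n x) atTop
        (𝓝 ((Ioo s t).indicator (fun _ => (1 : ℝ)) x)) := by
      intro x
      rw [← hball]
      by_cases hx : x ∈ Metric.ball x0 L
      · rw [indicator_of_mem hx]
        refine tendsto_const_nhds.congr' ?_
        filter_upwards [htend.eventually (lt_mem_nhds (Metric.mem_ball.1 hx))] with n hn
        exact ((f n).one_of_mem_closedBall (Metric.mem_closedBall.2 hn.le)).symm
      · rw [indicator_of_notMem hx]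
        refine tendsto_const_nhds.congr fun n => ?_
        refine ((f n).zero_of_le_dist ?_).symm
        rw [Metric.mem_ball, not_lt] at hx
        exact le_trans (by simp only [f]; linarith [(hdel n).1]) hx
    have hdct : ∀ (m : Measure ℝ) (g : ℝ → ℝ), Integrable g m → (∀ n x, f n x ≤ g x) →
        Tendsto (fun n => ∫ x, f n x ∂m) atTop (𝓝 (m.real (Ioo s t))) := by
      intro m g hg hfg
      have := tendsto_integral_of_dominated_convergence (μ := m) g
        (fun n => (hf n).smooth.continuous.aestronglyMeasurable) hg
        (fun n => Eventually.of_forall fun x => by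
          rw [Real.norm_of_nonneg (f n).nonneg]; exact hfg n x)
        (Eventually.of_forall hlim)
      rwa [integral_indicator measurableSet_Ioo, setIntegral_const, smul_eq_mul, mul_one] at this
    have hA := hdct ν (fun _ => 1) (integrable_const _) fun n x => (f n).le_one
    have hB := hdct volume ((Icc (0 : ℝ) 1).indicator fun _ => 1)
      ((integrable_indicator_iff measurableSet_Icc).2 (integrableOn_const (by simp)))
      (fun n x => by
        by_cases hx : x ∈ Icc (0 : ℝ) 1
        · rw [indicator_of_mem hx]; exact (f n).le_one
        · rw [indicator_of_notMem hx]
          refine (image_eq_zero_of_notMem_tsupport fun h' => hx ?_).le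
          exact Ioo_subset_Icc_self ((hf n).supp h'))
    have hC := hB.mul_const c
    simp_rw [← fun n => hb (f n) (hf n)] at hC
    rw [tendsto_nhds_unique hA hC, Real.volume_real_Ioo_of_le hst.le]
  have hc : ν.real univ = c := by
    have h1 := key 0 1 le_rfl zero_lt_one le_rfl
    rw [← measureReal_inter_add_sdiff (s := univ) (measurableSet_Ioo (a := (0 : ℝ)) (b := 1)),
      univ_inter, h1, ← compl_eq_univ_sdiff, measureReal_def, hν]
    simp
  have hfin : IsLocallyFiniteMeasure ν := inferInstance
  refine Real.measure_ext_Ioo_rat fun a b => ?_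
  rw [Measure.smul_apply, smul_eq_mul, Measure.restrict_apply measurableSet_Ioo, Ioo_inter_Ioo]
  have h1 : ν (Ioo (a : ℝ) b) = ν (Ioo (max (a : ℝ) 0) (min (b : ℝ) 1)) := by
    rw [← Ioo_inter_Ioo]
    exact (measure_inter_conull (by rwa [compl_eq_univ_sdiff] at hν ⊢)).symm
  rw [h1]
  rcases lt_or_ge (max (a : ℝ) 0) (min (b : ℝ) 1) with hlt | hle
  · have h2 := key _ _ (le_max_right _ _) hlt (min_le_right _ _)
    rw [Real.volume_Ioo, ← ofReal_measureReal (measure_ne_top ν _), h2,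
      ← ofReal_measureReal (measure_ne_top ν univ), hc, ENNReal.ofReal_mul (by linarith), mul_comm]
  · simp [Ioo_eq_empty_of_le hle]

end Time

/-! ### Separated test functions and the time marginal -/

section Marginal

variable {d : ℕ} {Ω : Set (Euc d)}

/-- The inclusion of `X = (0,1) × Ω̄` in the compact space `[0,1] × Ω̄`. -/
def incl (z : Cyl Ω) : I × ↥(closure Ω) :=
  (⟨(z.1 : ℝ), Ioo_subset_Icc_self z.1.2⟩, z.2)

theorem continuous_incl : Continuous (incl : Cyl Ω → I × ↥(closure Ω)) := by
  unfold incl; fun_prop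

theorem incl_injective : Function.Injective (incl : Cyl Ω → I × ↥(closure Ω)) := by
  rintro ⟨⟨a, ha⟩, b⟩ ⟨⟨a', ha'⟩, b'⟩ h
  simpa [incl] using h

theorem range_incl : range (incl : Cyl Ω → I × ↥(closure Ω)) = {p | (p.1 : ℝ) ∈ Ioo (0 : ℝ) 1} := by
  ext ⟨t, y⟩
  constructor
  · rintro ⟨z, hz⟩; rw [← hz]; exact z.1.2
  · intro h; exact ⟨(⟨t, h⟩, y), rfl⟩

theorem measurableEmbedding_incl : MeasurableEmbedding (incl : Cyl Ω → I × ↥(closure Ω)) := by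
  have : IsOpenEmbedding (incl : Cyl Ω → I × ↥(closure Ω)) := by
    refine ⟨?_, ?_⟩
    · exact IsEmbedding.of_comp continuous_incl
        (continuous_subtype_val.prodMap continuous_id : Continuous
          (Prod.map Subtype.val id : I × ↥(closure Ω) → ℝ × ↥(closure Ω)))
        (IsEmbedding.subtypeVal.prodMap IsEmbedding.id)
    · rw [range_incl]
      exact isOpen_Ioo.preimage (continuous_subtype_val.comp continuous_fst)
  exact this.measurableEmbedding

/-- Smooth compactly supported functions on `ℝ^d`. They are restricted to `Ω̄` and need not vanish
on `∂Ω`. -/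
structure IsSpaceTest (G : Euc d → ℝ) : Prop where
  smooth : ContDiff ℝ ∞ G
  compact : HasCompactSupport G

theorem IsSpaceTest.continuous_fderiv {G : Euc d → ℝ} (hG : IsSpaceTest G) :
    Continuous (fderiv ℝ G) := hG.smooth.continuous_fderiv (by simp)

theorem IsSpaceTest.exists_bound_fderiv {G : Euc d → ℝ} (hG : IsSpaceTest G) :
    ∃ c : ℝ, ∀ x, ‖fderiv ℝ G x‖ ≤ c :=
  (hG.compact.fderiv (𝕜 := ℝ)).exists_bound_of_continuous hG.continuous_fderiv

theorem isTest_mul {a : ℝ → ℝ} {G : Euc d → ℝ} (ha : IsTimeTest a) (hG : IsSpaceTest G) :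
    IsTest fun p : ℝ × Euc d => a p.1 * G p.2 := by
  have hsub : tsupport (fun p : ℝ × Euc d => a p.1 * G p.2) ⊆ tsupport a ×ˢ tsupport G := by
    refine closure_minimal ?_ ((isClosed_tsupport _).prod (isClosed_tsupport _))
    intro p hp
    exact ⟨subset_tsupport _ (left_ne_zero_of_mul hp), subset_tsupport _ (right_ne_zero_of_mul hp)⟩
  exact ⟨(ha.smooth.comp contDiff_fst).mul (hG.smooth.comp contDiff_snd),
    (ha.compact.prod hG.compact).of_isClosed_subset (isClosed_tsupport _) hsub,
    hsub.trans (prod_mono ha.supp (subset_univ _))⟩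

theorem fderiv_mul_apply {a : ℝ → ℝ} {G : Euc d → ℝ} (ha : IsTimeTest a) (hG : IsSpaceTest G)
    (p : ℝ × Euc d) (s : ℝ) (x : Euc d) :
    fderiv ℝ (fun p : ℝ × Euc d => a p.1 * G p.2) p (s, x) =
      s * deriv a p.1 * G p.2 + a p.1 * fderiv ℝ G p.2 x := by
  have h1 : HasFDerivAt (fun p : ℝ × Euc d => a p.1)
      ((fderiv ℝ a p.1).comp (ContinuousLinearMap.fst ℝ ℝ (Euc d))) p :=
    ((ha.smooth.differentiable (by simp)) p.1).hasFDerivAt.comp p hasFDerivAt_fst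
  have h2 : HasFDerivAt (fun p : ℝ × Euc d => G p.2)
      ((fderiv ℝ G p.2).comp (ContinuousLinearMap.snd ℝ ℝ (Euc d))) p :=
    ((hG.smooth.differentiable (by simp)) p.2).hasFDerivAt.comp p hasFDerivAt_snd
  rw [show fderiv ℝ (fun p : ℝ × Euc d => a p.1 * G p.2) p = _ from (h1.mul h2).fderiv]
  have : fderiv ℝ a p.1 s = s * deriv a p.1 := by
    rw [← fderiv_apply_one_eq_deriv, ← smul_eq_mul, ← map_smul]; simp
  simp [this]
  ring

/-- Since `Ω̄` is compact, constants on it are restrictions of test functions. -/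
theorem exists_cutoff [CompactSpace ↥(closure Ω)] : ∃ G : Euc d → ℝ, IsSpaceTest G ∧
    ∀ y ∈ closure Ω, G y = 1 ∧ fderiv ℝ G y = 0 := by
  have hb : Bornology.IsBounded (closure Ω) := (isCompact_iff_compactSpace.2 ‹_›).isBounded
  obtain ⟨r, hr0, hr⟩ := hb.subset_ball_lt 0 0
  let f : ContDiffBump (0 : Euc d) := ⟨r, r + 1, hr0, by linarith⟩
  refine ⟨f, ⟨f.contDiff, f.hasCompactSupport⟩, fun y hy => ⟨?_, ?_⟩⟩
  · exact f.one_of_mem_closedBall (Metric.ball_subset_closedBall (hr hy))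
  · have : (f : Euc d → ℝ) =ᶠ[𝓝 y] fun _ => 1 := by
      filter_upwards [Metric.isOpen_ball.mem_nhds (hr hy)] with x hx
      exact f.one_of_mem_closedBall (Metric.ball_subset_closedBall hx)
    rw [this.fderiv_eq]
    simp

variable {P : Measure (Cyl Ω)} {v : Cyl Ω → Euc d}

theorem IsFlow.integral_separated (h : IsFlow P v) {a : ℝ → ℝ} {G : Euc d → ℝ} (ha : IsTimeTest a)
    (hG : IsSpaceTest G) :
    ∫ z, deriv a (z.1 : ℝ) * G (z.2 : Euc d) ∂P +
      ∫ z, a (z.1 : ℝ) * fderiv ℝ G (z.2 : Euc d) (v z) ∂P = 0 := by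
  have := h.eq _ (isTest_mul ha hG)
  simpa [fderiv_mul_apply ha hG, toAmbient] using this

variable [IsFiniteMeasure P]

/-- The time marginal of a flow is a multiple of Lebesgue measure, by testing with functions of time
only. -/
theorem IsFlow.map_time [CompactSpace ↥(closure Ω)] (h : IsFlow P v) :
    P.map (fun z => (z.1 : ℝ)) = P univ • volume.restrict (Ioo 0 1) := by
  have hm : Measurable fun z : Cyl Ω => (z.1 : ℝ) := by fun_prop
  obtain ⟨G, hG, hG1⟩ := exists_cutoff (Ω := Ω)
  rw [measure_eq_of_integral_deriv_eq_zero (P.map fun z => (z.1 : ℝ)), Measure.map_apply hm .univ,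
    preimage_univ]
  · rw [Measure.map_apply hm measurableSet_Ioo.compl]
    convert measure_empty (μ := P)
    ext z
    simp
  · intro a ha
    rw [integral_map hm.aemeasurable ha.deriv.smooth.continuous.aestronglyMeasurable]
    have := h.integral_separated ha hG
    simpa [hG1 _ (Subtype.coe_prop _)] using this

theorem IsFlow.fst_map_incl [CompactSpace ↥(closure Ω)] (h : IsFlow P v) :
    (P.map incl).fst = P univ • (volume : Measure I) := by
  have hme : MeasurableEmbedding ((↑) : I → ℝ) := unitInterval.measurableEmbedding_coe
  rw [← hme.comap_map (P.map incl).fst, ← hme.comap_map (P univ • (volume : Measure I)),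
    Measure.fst, Measure.map_map measurable_fst measurableEmbedding_incl.measurable,
    Measure.map_map measurable_subtype_coe
      (measurable_fst.comp measurableEmbedding_incl.measurable),
    Measure.map_smul, unitInterval.measurePreserving_coe.map_eq]
  congr 1
  refine h.map_time.trans ?_
  congr 1
  exact Measure.restrict_congr_set Ioo_ae_eq_Icc

theorem integral_norm_le_sqrt {X : Type*} [MeasurableSpace X] {P : Measure X} [IsFiniteMeasure P]
    {E : Type*} [NormedAddCommGroup E] {v : X → E} (hv : MemLp v 2 P) (S : Set X) :
    ∫ z in S, ‖v z‖ ∂P ≤ √(∫ z, ‖v z‖ ^ 2 ∂P) * √(P.real S) := by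
  have h1 := integral_mul_le_Lp_mul_Lq_of_nonneg (μ := P.restrict S) (p := 2) (q := 2)
    (f := fun z => ‖v z‖) (g := fun _ => (1 : ℝ)) Real.HolderConjugate.two_two
    (Eventually.of_forall fun _ => norm_nonneg _) (Eventually.of_forall fun _ => zero_le_one)
    (by simpa using hv.norm.restrict S) (memLp_const _)
  simp only [mul_one, Real.rpow_two, one_pow, integral_const, smul_eq_mul,
    ← Real.sqrt_eq_rpow, measureReal_restrict_apply_univ] at h1
  refine h1.trans ?_
  gcongr
  · exact Eventually.of_forall fun _ => by positivity
  · exact hv.integrable_norm_pow (by simp)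
  · exact Measure.restrict_le_self

theorem IsFlow.measureReal_time_Ioc_le [CompactSpace ↥(closure Ω)] (h : IsFlow P v)
    (s t : ℝ) (hst : s ≤ t) :
    P.real {z | s < (z.1 : ℝ) ∧ (z.1 : ℝ) ≤ t} ≤ P.real univ * (t - s) := by
  have hm : Measurable fun z : Cyl Ω => (z.1 : ℝ) := by fun_prop
  have h1 : P {z | s < (z.1 : ℝ) ∧ (z.1 : ℝ) ≤ t} = P.map (fun z => (z.1 : ℝ)) (Ioc s t) := by
    rw [Measure.map_apply hm measurableSet_Ioc]; rfl
  rw [measureReal_def, h1, h.map_time, Measure.smul_apply, smul_eq_mul, ENNReal.toReal_mul,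
    measureReal_def]
  gcongr
  refine ENNReal.toReal_le_of_le_ofReal (by linarith) ?_
  rw [← Real.volume_Ioc]
  exact Measure.restrict_apply_le _ _

/-- The flux `∫_{τ ≤ t} ∇G · v dP(τ, x)` up to time `t`: a primitive of the weak derivative of
`t ↦ ∫ G dp_t` for the curve `p` of the flow. -/
def flux (P : Measure (Cyl Ω)) (v : Cyl Ω → Euc d) (G : Euc d → ℝ) (t : ℝ) : ℝ :=
  ∫ z in {z | (z.1 : ℝ) ≤ t}, fderiv ℝ G (z.2 : Euc d) (v z) ∂P

theorem IsFlow.integrable_flux (h : IsFlow P v) {G : Euc d → ℝ} (hG : IsSpaceTest G) :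
    Integrable (fun z => fderiv ℝ G (z.2 : Euc d) (v z)) P := by
  obtain ⟨C, hC⟩ := hG.exists_bound_fderiv
  have hvi : Integrable v P := h.memLp.integrable (by norm_num)
  refine (hvi.norm.const_mul C).mono' ?_ (Eventually.of_forall fun z => ?_)
  · refine Measurable.aestronglyMeasurable ?_
    have h1 : Continuous fun q : (Euc d →L[ℝ] ℝ) × Euc d => q.1 q.2 := by fun_prop
    have h2 : Continuous fun z : Cyl Ω => fderiv ℝ G (z.2 : Euc d) :=
      hG.continuous_fderiv.comp (by fun_prop)
    exact h1.measurable.comp (h2.measurable.prodMk h.meas)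
  · exact (ContinuousLinearMap.le_opNorm _ _).trans (by gcongr; exact hC _)

/-- Hölder continuity with exponent `1/2`: Cauchy–Schwarz on the slab between two times, whose
measure is proportional to its length. -/
theorem IsFlow.abs_flux_sub_le [CompactSpace ↥(closure Ω)] (h : IsFlow P v)
    {G : Euc d → ℝ} (hG : IsSpaceTest G) {C : ℝ}
    (hC : ∀ x, ‖fderiv ℝ G x‖ ≤ C) (s t : ℝ) :
    |flux P v G t - flux P v G s| ≤
      C * (√(∫ z, ‖v z‖ ^ 2 ∂P) * √(P.real univ * |t - s|)) := by
  wlog hst : s ≤ t generalizing s t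
  · rw [abs_sub_comm, abs_sub_comm t s]
    exact this t s (le_of_not_ge hst)
  have hm : Measurable fun z : Cyl Ω => (z.1 : ℝ) := by fun_prop
  have hms : ∀ s : ℝ, MeasurableSet {z : Cyl Ω | (z.1 : ℝ) ≤ s} := fun s =>
    measurableSet_le hm measurable_const
  have hsub : {z : Cyl Ω | (z.1 : ℝ) ≤ s} ⊆ {z : Cyl Ω | (z.1 : ℝ) ≤ t} :=
    fun z hz => le_trans hz hst
  have hi := h.integrable_flux hG
  have hC0 : 0 ≤ C := (norm_nonneg _).trans (hC 0)
  have hset : {z : Cyl Ω | (z.1 : ℝ) ≤ t} \ {z : Cyl Ω | (z.1 : ℝ) ≤ s} =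
      {z | s < (z.1 : ℝ) ∧ (z.1 : ℝ) ≤ t} := by
    ext z; simp [and_comm]
  rw [flux, flux, ← setIntegral_sdiff (hms s) hi.integrableOn hsub, hset]
  calc |∫ z in {z | s < (z.1 : ℝ) ∧ (z.1 : ℝ) ≤ t}, fderiv ℝ G (z.2 : Euc d) (v z) ∂P|
      ≤ ∫ z in {z | s < (z.1 : ℝ) ∧ (z.1 : ℝ) ≤ t}, C * ‖v z‖ ∂P := by
        rw [← Real.norm_eq_abs]
        refine norm_integral_le_of_norm_le
          (f := fun z : Cyl Ω => fderiv ℝ G (z.2 : Euc d) (v z)) ?_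
          (Eventually.of_forall fun z => ?_)
        · exact ((h.memLp.integrable (by norm_num)).norm.const_mul C).integrableOn
        · exact (ContinuousLinearMap.le_opNorm _ _).trans (by gcongr; exact hC _)
    _ ≤ C * (√(∫ z, ‖v z‖ ^ 2 ∂P) * √(P.real univ * |t - s|)) := by
        rw [integral_const_mul]
        gcongr
        refine (integral_norm_le_sqrt h.memLp _).trans ?_
        gcongr
        rw [abs_of_nonneg (by linarith)]
        exact h.measureReal_time_Ioc_le s t hst

theorem IsFlow.continuous_flux [CompactSpace ↥(closure Ω)] (h : IsFlow P v)
    {G : Euc d → ℝ} (hG : IsSpaceTest G) :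
    Continuous (flux P v G) := by
  obtain ⟨C, hC⟩ := hG.exists_bound_fderiv
  rw [continuous_iff_continuousAt]
  intro s
  rw [ContinuousAt, tendsto_iff_dist_tendsto_zero]
  refine squeeze_zero (fun _ => dist_nonneg) (fun t => h.abs_flux_sub_le hG hC s t) ?_
  have : Continuous fun t => C * (√(∫ z, ‖v z‖ ^ 2 ∂P) * √(P.real univ * |t - s|)) := by fun_prop
  simpa using this.tendsto s

/-- The weak derivative of the flux, by Fubini on `{(z, t) | time z ≤ t}`. -/
theorem IsFlow.integral_mul_flux (h : IsFlow P v) {G : Euc d → ℝ} (hG : IsSpaceTest G) {a : ℝ → ℝ}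
    (ha : IsTimeTest a) :
    ∫ z, a (z.1 : ℝ) * fderiv ℝ G (z.2 : Euc d) (v z) ∂P =
      -∫ t in Ioo (0 : ℝ) 1, deriv a t * flux P v G t := by
  set k : Cyl Ω → ℝ := fun z => fderiv ℝ G (z.2 : Euc d) (v z) with hk
  have hki := h.integrable_flux hG
  have hm : Measurable fun z : Cyl Ω => (z.1 : ℝ) := by fun_prop
  have hms : ∀ s : ℝ, MeasurableSet {z : Cyl Ω | (z.1 : ℝ) ≤ s} := fun s =>
    measurableSet_le hm measurable_const
  set S : Set (Cyl Ω × ℝ) := {q | (q.1.1 : ℝ) ≤ q.2} with hS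
  have hSm : MeasurableSet S := measurableSet_le (by fun_prop) (by fun_prop)
  have hint : Integrable (fun q : Cyl Ω × ℝ => S.indicator (fun q => k q.1 * deriv a q.2) q)
      (P.prod (volume.restrict (Ioo (0 : ℝ) 1))) :=
    (hki.mul_prod (ha.deriv.integrable)).indicator hSm
  have hsw := integral_integral_swap
    (f := fun z t => S.indicator (fun q => k q.1 * deriv a q.2) (z, t)) hint
  have hL : ∀ z : Cyl Ω, ∫ t in Ioo (0 : ℝ) 1, S.indicator (fun q => k q.1 * deriv a q.2) (z, t) =
      -(a (z.1 : ℝ) * k z) := by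
    intro z
    have h01 := z.1.2
    have h1 : ∀ t, S.indicator (fun q => k q.1 * deriv a q.2) (z, t) =
        (Ici (z.1 : ℝ)).indicator (fun t => k z * deriv a t) t := by
      intro t
      by_cases ht : (z.1 : ℝ) ≤ t
      · rw [indicator_of_mem (show (z, t) ∈ S from ht),
          indicator_of_mem (show t ∈ Ici (z.1 : ℝ) from ht)]
      · rw [indicator_of_notMem (show (z, t) ∉ S from ht),
          indicator_of_notMem (show t ∉ Ici (z.1 : ℝ) from ht)]
    simp_rw [h1]
    rw [setIntegral_indicator measurableSet_Ici, integral_const_mul]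
    have h2 : (Ioo (0 : ℝ) 1 ∩ Ici (z.1 : ℝ) : Set ℝ) =ᵐ[volume] (Ioc (z.1 : ℝ) 1 : Set ℝ) := by
      have : Ioo (0 : ℝ) 1 ∩ Ici (z.1 : ℝ) = Ico (z.1 : ℝ) 1 := by
        ext t; constructor
        · rintro ⟨ha, hb⟩; exact ⟨hb, ha.2⟩
        · rintro ⟨ha, hb⟩; exact ⟨⟨h01.1.trans_le ha, hb⟩, ha⟩
      rw [this]
      exact Ico_ae_eq_Ioc
    rw [setIntegral_congr_set h2, ← intervalIntegral.integral_of_le h01.2.le,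
      intervalIntegral.integral_deriv_eq_sub (fun t _ => (ha.smooth.differentiable (by simp)) t)
        (ha.deriv.smooth.continuous.intervalIntegrable _ _)]
    have ha1 : a 1 = 0 := image_eq_zero_of_notMem_tsupport fun h' => by
      have := ha.supp h'; simp at this
    rw [ha1]; ring
  have hR : ∀ t : ℝ, ∫ z, S.indicator (fun q => k q.1 * deriv a q.2) (z, t) ∂P =
      deriv a t * flux P v G t := by
    intro t
    have h1 : ∀ z, S.indicator (fun q => k q.1 * deriv a q.2) (z, t) =
        {z : Cyl Ω | (z.1 : ℝ) ≤ t}.indicator (fun z => k z * deriv a t) z := fun z => rfl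
    simp_rw [h1]
    rw [integral_indicator (hms t), integral_mul_const, mul_comm]
    rfl
  simp_rw [hL, hR] at hsw
  rw [integral_neg] at hsw
  linarith

end Marginal

/-! ### Narrow convergence tested on a dense family -/

/-- Narrowly continuous maps into the finite measures are measurable: the mass of a closed set is a
limit of integrals of continuous functions. -/
theorem measurable_of_continuous_finiteMeasure {Y : Type*} [TopologicalSpace Y]
    [MeasurableSpace Y] [BorelSpace Y] [HasOuterApproxClosed Y] {X : Type*} [TopologicalSpace X]
    [MeasurableSpace X] [OpensMeasurableSpace X] {p : X → FiniteMeasure Y} (hp : Continuous p) :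
    Measurable fun t => (p t : Measure Y) := by
  have hcl : ∀ F : Set Y, IsClosed F → Measurable fun t => (p t : Measure Y) F := by
    intro F hF
    refine measurable_of_tendsto_metrizable
      (f := fun n t => ∫⁻ y, hF.apprSeq n y ∂(p t : Measure Y)) (fun n => ?_)
      (tendsto_pi_nhds.2 fun t =>
        HasOuterApproxClosed.tendsto_lintegral_apprSeq hF (p t : Measure Y))
    have := (FiniteMeasure.continuous_testAgainstNN_eval (hF.apprSeq n)).comp hp
    simpa [Function.comp_def, FiniteMeasure.testAgainstNN_coe_eq] using
      (ENNReal.continuous_coe.comp this).measurable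
  exact Measurable.measure_of_isPiSystem
    ((BorelSpace.measurable_eq (α := Y)).trans borel_eq_generateFrom_isClosed)
    isPiSystem_isClosed hcl (hcl _ isClosed_univ)

section Narrow

variable {Y : Type*} [TopologicalSpace Y] [CompactSpace Y] [MeasurableSpace Y] [BorelSpace Y]

theorem integrable_continuousMap (q : Measure Y) [IsFiniteMeasure q] (g : C(Y, ℝ)) :
    Integrable g q :=
  Integrable.of_bound g.continuous.aestronglyMeasurable ‖g‖
    (Eventually.of_forall fun y => g.norm_coe_le_norm y)

theorem abs_integral_sub_le (q : Measure Y) [IsFiniteMeasure q] {C : ℝ} (hq : q.real univ ≤ C)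
    (g g' : C(Y, ℝ)) : |∫ y, g y ∂q - ∫ y, g' y ∂q| ≤ ‖g - g'‖ * C := by
  rw [← integral_sub (integrable_continuousMap q g) (integrable_continuousMap q g')]
  have := norm_integral_le_of_norm_le_const (μ := q) (f := fun y => g y - g' y) (C := ‖g - g'‖)
    (Eventually.of_forall fun y => (g - g').norm_coe_le_norm y)
  rw [Real.norm_eq_abs] at this
  exact this.trans (by gcongr)

theorem tendsto_integral_of_dense {ι : Type*} {l : Filter ι} {q : ι → Measure Y} {q₀ : Measure Y}
    [∀ i, IsFiniteMeasure (q i)] [IsFiniteMeasure q₀] {C : ℝ} (hq : ∀ i, (q i).real univ ≤ C)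
    (hq₀ : q₀.real univ ≤ C) {D : Set C(Y, ℝ)} (hD : Dense D)
    (h : ∀ g ∈ D, Tendsto (fun i => ∫ y, g y ∂q i) l (𝓝 (∫ y, g y ∂q₀))) (g : C(Y, ℝ)) :
    Tendsto (fun i => ∫ y, g y ∂q i) l (𝓝 (∫ y, g y ∂q₀)) := by
  have hC : 0 ≤ C := measureReal_nonneg.trans hq₀
  rw [Metric.tendsto_nhds]
  intro ε hε
  obtain ⟨g', hg', hgD⟩ := Metric.dense_iff.1 hD g (ε / (3 * (C + 1))) (by positivity)
  rw [Metric.mem_ball, dist_comm, dist_eq_norm] at hg'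
  have hb : ‖g - g'‖ * C ≤ ε / 3 := by
    calc ‖g - g'‖ * C ≤ ε / (3 * (C + 1)) * (C + 1) := by gcongr; linarith
      _ = ε / 3 := by field_simp
  filter_upwards [Metric.tendsto_nhds.1 (h g' hgD) (ε / 3) (by positivity)] with i hi
  rw [Real.dist_eq] at hi ⊢
  have h1 := abs_integral_sub_le (q i) (hq i) g g'
  have h2 := abs_integral_sub_le q₀ hq₀ g g'
  rw [abs_le] at h1 h2
  rw [abs_lt] at hi ⊢
  constructor <;> linarith [h1.1, h1.2, h2.1, h2.2, hi.1, hi.2]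

theorem measure_eq_of_dense [HasOuterApproxClosed Y] {q q' : Measure Y} [IsFiniteMeasure q]
    [IsFiniteMeasure q'] {D : Set C(Y, ℝ)} (hD : Dense D)
    (h : ∀ g ∈ D, ∫ y, g y ∂q = ∫ y, g y ∂q') : q = q' := by
  refine ext_of_forall_integral_eq_of_IsFiniteMeasure fun f => ?_
  have := tendsto_integral_of_dense (l := (pure () : Filter Unit)) (q := fun _ => q) (q₀ := q')
    (C := max (q.real univ) (q'.real univ)) (fun _ => le_max_left _ _) (le_max_right _ _) hD
    (fun g hg => by simp [h g hg]) f.toContinuousMap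
  exact tendsto_nhds_unique tendsto_const_nhds this

end Narrow

section Dense

variable {d : ℕ} {Ω : Set (Euc d)} [CompactSpace ↥(closure Ω)]

theorem IsSpaceTest.mul {F G : Euc d → ℝ} (hF : IsSpaceTest F) (hG : IsSpaceTest G) :
    IsSpaceTest fun x => F x * G x := ⟨hF.smooth.mul hG.smooth, hF.compact.mul_right⟩

/-- The algebra of restrictions to `Ω̄` of test functions on `ℝ^d`. -/
def spaceTests (Ω : Set (Euc d)) [CompactSpace ↥(closure Ω)] : Subalgebra ℝ C(↥(closure Ω), ℝ) where
  carrier := {g | ∃ G : Euc d → ℝ, IsSpaceTest G ∧ ∀ y, g y = G y}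
  mul_mem' := by
    rintro f g ⟨F, hF, hf⟩ ⟨G, hG, hg⟩
    exact ⟨_, hF.mul hG, fun y => by simp [hf, hg]⟩
  add_mem' := by
    rintro f g ⟨F, hF, hf⟩ ⟨G, hG, hg⟩
    exact ⟨fun x => F x + G x, ⟨hF.smooth.add hG.smooth, hF.compact.add hG.compact⟩,
      fun y => by simp [hf, hg]⟩
  algebraMap_mem' := by
    intro r
    obtain ⟨G, hG, hG1⟩ := exists_cutoff (Ω := Ω)
    exact ⟨fun x => r * G x, ⟨contDiff_const.mul hG.smooth, hG.compact.mul_left⟩,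
      fun y => by simp [(hG1 y y.2).1]⟩

theorem dense_spaceTests : Dense (spaceTests Ω : Set C(↥(closure Ω), ℝ)) := by
  have h := ContinuousMap.subalgebra_topologicalClosure_eq_top_of_separatesPoints (spaceTests Ω) ?_
  · have h2 := congrArg (fun A : Subalgebra ℝ C(↥(closure Ω), ℝ) => (A : Set C(↥(closure Ω), ℝ))) h
    rw [dense_iff_closure_eq]
    simpa using h2
  intro x y hxy
  obtain ⟨i, hi⟩ : ∃ i, (x : Euc d) i ≠ (y : Euc d) i := by
    by_contra! hc
    exact hxy (Subtype.ext (PiLp.ext hc))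
  obtain ⟨G, hG, hG1⟩ := exists_cutoff (Ω := Ω)
  have hsm : ContDiff ℝ ∞ fun x : Euc d => x i :=
    (EuclideanSpace.proj i : Euc d →L[ℝ] ℝ).contDiff
  refine ⟨fun z => (z : Euc d) i, ⟨⟨fun z => (z : Euc d) i, by fun_prop⟩, ⟨fun x => x i * G x,
    ⟨hsm.mul hG.smooth, hG.compact.mul_left⟩, fun z => by simp [(hG1 z z.2).1]⟩, rfl⟩, hi⟩

theorem exists_countable_dense_spaceTests : ∃ D : Set C(↥(closure Ω), ℝ), D.Countable ∧ Dense D ∧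
    ∀ g ∈ D, ∃ G : Euc d → ℝ, IsSpaceTest G ∧ ∀ y, g y = G y := by
  obtain ⟨D, hDs, hDc, hDd⟩ := dense_spaceTests (Ω := Ω).exists_countable_dense_subset
  exact ⟨D, hDc, hDd, fun g hg => hDs hg⟩

end Dense

instance isOpenPosMeasure_volume : (volume : Measure I).IsOpenPosMeasure where
  open_pos U hU hne := by
    obtain ⟨a, b, hab, hsub⟩ := hU.exists_Ioo_subset hne
    have h1 : (volume : Measure I) (Ioo a b) ≠ 0 := by
      rw [unitInterval.volume_Ioo]
      simpa using hab
    exact fun h => h1 (measure_mono_null hsub h)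

/-! ### The narrowly continuous curve of a flow -/

section Curve

variable {d : ℕ} {Ω : Set (Euc d)}

/-- `p` is a narrowly continuous curve of positive measures, of constant mass `P(X)`, which
disintegrates `P` in time. The last property is stated for Borel subsets of `[0,1] × Ω̄`. -/
structure IsCurveOf (P : Measure (Cyl Ω)) (p : I → FiniteMeasure ↥(closure Ω)) : Prop where
  cont : Continuous p
  mass : ∀ t, (p t : Measure ↥(closure Ω)) univ = P univ
  disint : ∀ s : Set (I × ↥(closure Ω)), MeasurableSet s →
    P (incl ⁻¹' s) = ∫⁻ t, (p t : Measure ↥(closure Ω)) (Prod.mk t ⁻¹' s)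

variable {P : Measure (Cyl Ω)} [IsFiniteMeasure P] {v : Cyl Ω → Euc d} [CompactSpace ↥(closure Ω)]

instance : IsFiniteMeasure (P.map (incl : Cyl Ω → I × ↥(closure Ω))) :=
  Measure.isFiniteMeasure_map _ _

/-- For almost every time, the disintegration `κ` of `P` satisfies `P(X) ∫ G dκ_t = c + flux t`: by
the continuity equation the difference of the two sides has vanishing weak derivative. -/
theorem IsFlow.exists_integral_condKernel_eq [Nonempty ↥(closure Ω)] (h : IsFlow P v)
    {G : Euc d → ℝ} (hG : IsSpaceTest G) :
    ∃ c : ℝ, ∀ᵐ t : I, P.real univ * ∫ y, G y ∂((P.map incl).condKernel t) = c + flux P v G t := by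
  set κ := (P.map (incl : Cyl Ω → I × ↥(closure Ω))).condKernel
  set M := P.real univ with hM
  have hdis : (P.map incl).fst.compProd κ = P.map incl := Measure.disintegrate _ _
  have hfst := h.fst_map_incl
  set hh : I → ℝ := fun t => ∫ y, G y ∂κ t with hhh
  obtain ⟨B, hB⟩ := hG.compact.exists_bound_of_continuous hG.smooth.continuous
  have hGi : ∀ t, Integrable (fun y : ↥(closure Ω) => G y) (κ t) := fun t =>
    Integrable.of_bound (hG.smooth.continuous.comp continuous_subtype_val).aestronglyMeasurable B
      (Eventually.of_forall fun y => hB y)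
  have hhm : StronglyMeasurable hh := by
    have : StronglyMeasurable (Function.uncurry fun (_ : I) (y : ↥(closure Ω)) => G y) :=
      (hG.smooth.continuous.comp
        (continuous_subtype_val.comp continuous_snd)).stronglyMeasurable
    exact this.integral_kernel_prod_right
  have hhb : ∀ t, ‖hh t‖ ≤ B := fun t => by
    have := norm_integral_le_of_norm_le_const (μ := κ t) (f := fun y : ↥(closure Ω) => G y)
      (Eventually.of_forall fun y => hB y)
    simpa using this
  -- the function whose weak derivative vanishes
  set u : ℝ → ℝ := fun t => M * hh (projIcc 0 1 zero_le_one t) - flux P v G t with hu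
  have hproj : Measurable (projIcc (0 : ℝ) 1 zero_le_one) := continuous_projIcc.measurable
  have hu1 : IntegrableOn (fun t => M * hh (projIcc 0 1 zero_le_one t)) (Ioo 0 1) :=
    ((Integrable.of_bound (hhm.comp_measurable hproj).aestronglyMeasurable B
      (Eventually.of_forall fun t => hhb _)).const_mul M)
  have hu2 : IntegrableOn (flux P v G) (Ioo 0 1) :=
    ((h.continuous_flux hG).integrableOn_Icc).mono_set Ioo_subset_Icc_self
  have hweak : ∀ a, IsTimeTest a → ∫ t in Ioo (0 : ℝ) 1, deriv a t * u t = 0 := by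
    intro a ha
    obtain ⟨A, hA⟩ := ha.deriv.compact.exists_bound_of_continuous ha.deriv.smooth.continuous
    have e1 := h.integral_separated ha hG
    rw [h.integral_mul_flux hG ha] at e1
    have e2 : ∫ z, deriv a (z.1 : ℝ) * G (z.2 : Euc d) ∂P =
        ∫ t in Ioo (0 : ℝ) 1, deriv a t * (M * hh (projIcc 0 1 zero_le_one t)) := by
      have hF : Continuous fun q : I × ↥(closure Ω) => deriv a (q.1 : ℝ) * G (q.2 : Euc d) :=
        (ha.deriv.smooth.continuous.comp (continuous_subtype_val.comp continuous_fst)).mul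
          (hG.smooth.continuous.comp (continuous_subtype_val.comp continuous_snd))
      have s1 : ∫ z, deriv a (z.1 : ℝ) * G (z.2 : Euc d) ∂P =
          ∫ q, deriv a (q.1 : ℝ) * G (q.2 : Euc d) ∂(P.map incl) :=
        (measurableEmbedding_incl.integral_map (μ := P)
          fun q : I × ↥(closure Ω) => deriv a (q.1 : ℝ) * G (q.2 : Euc d)).symm
      have hFi : Integrable (fun q : I × ↥(closure Ω) => deriv a (q.1 : ℝ) * G (q.2 : Euc d))
          (P.map incl) :=
        Integrable.of_bound hF.aestronglyMeasurable (A * B) (Eventually.of_forall fun q => by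
          rw [norm_mul]
          gcongr
          · exact (norm_nonneg _).trans (hA 0)
          · exact hA _
          · exact hB _)
      rw [s1, ← hdis, Measure.integral_compProd (by rw [hdis]; exact hFi), hfst,
        integral_smul_measure]
      simp_rw [integral_const_mul]
      have s2 : ∫ t : I, deriv a (t : ℝ) * ∫ y : ↥(closure Ω), G y ∂κ t =
          ∫ t in Icc (0 : ℝ) 1, deriv a t * hh (projIcc 0 1 zero_le_one t) := by
        rw [← unitInterval.measurePreserving_coe.map_eq,
          unitInterval.measurableEmbedding_coe.integral_map]
        simp [hhh]
      rw [s2, integral_Icc_eq_integral_Ioo, smul_eq_mul, ← integral_const_mul]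
      congr 1
      ext t
      rw [hM, measureReal_def]
      ring
    simp only [hu, mul_sub]
    rw [integral_sub, ← e2]
    · linarith
    · exact hu1.bdd_mul ha.deriv.smooth.continuous.aestronglyMeasurable (Eventually.of_forall hA)
    · exact hu2.bdd_mul ha.deriv.smooth.continuous.aestronglyMeasurable (Eventually.of_forall hA)
  obtain ⟨c, hc⟩ := ae_eq_const_of_integral_deriv_mul_eq_zero (hu1.sub hu2) hweak
  refine ⟨c, ?_⟩
  have hc' : ∀ᵐ t ∂(volume.restrict (Icc (0 : ℝ) 1)), u t = c := by
    rw [← Measure.restrict_congr_set Ioo_ae_eq_Icc, ae_restrict_iff' measurableSet_Ioo]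
    exact hc
  have := unitInterval.measurePreserving_coe.quasiMeasurePreserving.ae hc'
  filter_upwards [this] with t ht
  simp only [hu, projIcc_val] at ht
  linarith

/-- The narrowly continuous representative of the disintegration of a flow, with its modulus of
continuity on smooth functions. It is the extension by continuity from the set of full measure on
which the integrals of countably many test functions agree with their continuous versions. -/
theorem IsFlow.exists_curve (h : IsFlow P v) :
    ∃ p : I → FiniteMeasure ↥(closure Ω), IsCurveOf P p ∧
      ∀ (G : Euc d → ℝ) (C : ℝ), IsSpaceTest G → (∀ x, ‖fderiv ℝ G x‖ ≤ C) → ∀ s t : I,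
        |∫ y, G y ∂(p t : Measure ↥(closure Ω)) - ∫ y, G y ∂(p s : Measure ↥(closure Ω))| ≤
          C * (√(∫ z, ‖v z‖ ^ 2 ∂P) * √(P.real univ * |(t : ℝ) - s|)) := by
  by_cases hP : P = 0
  · refine ⟨fun _ => 0, ⟨continuous_const, by simp [hP], by simp [hP]⟩, ?_⟩
    intro G C hG hC s t
    simp [hP]
  have hM : 0 < P.real univ := by
    rw [measureReal_def, ENNReal.toReal_pos_iff]
    exact ⟨by simpa [pos_iff_ne_zero] using hP, measure_lt_top _ _⟩
  obtain ⟨z0⟩ : Nonempty (Cyl Ω) := by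
    by_contra hne
    rw [not_nonempty_iff] at hne
    exact hP (Measure.eq_zero_of_isEmpty P)
  have hY : Nonempty ↥(closure Ω) := ⟨z0.2⟩
  set M := P.real univ with hMdef
  set κ := (P.map (incl : Cyl Ω → I × ↥(closure Ω))).condKernel with hκ
  obtain ⟨D, hDc, hDd, hDs⟩ := exists_countable_dense_spaceTests (Ω := Ω)
  have hDc' : Countable D := hDc.to_subtype
  choose! G hG hGg using hDs
  have hex : ∀ g : D, ∃ c : ℝ, ∀ᵐ t : I, M * ∫ y, (g : C(↥(closure Ω), ℝ)) y ∂(κ t) =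
      c + flux P v (G g) t := by
    intro g
    obtain ⟨c, hc⟩ := h.exists_integral_condKernel_eq (hG g g.2)
    refine ⟨c, hc.mono fun t ht => ?_⟩
    simp_rw [hGg g g.2]
    exact ht
  choose c hc using hex
  set T₀ : Set I := {t | ∀ g : D, M * ∫ y, (g : C(↥(closure Ω), ℝ)) y ∂(κ t) =
    c g + flux P v (G g) t} with hT₀
  have hae : ∀ᵐ t : I, t ∈ T₀ := ae_all_iff.2 hc
  have hdense : Dense T₀ := Measure.dense_of_ae hae
  have hcf : ∀ g : D, Continuous fun t : I => c g + flux P v (G g) t := fun g =>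
    continuous_const.add ((h.continuous_flux (hG g g.2)).comp continuous_subtype_val)
  let κ' : I → ProbabilityMeasure ↥(closure Ω) := fun t => ⟨κ t, inferInstance⟩
  -- cluster points of the disintegration along times of full measure
  have hcl : ∀ t : I, ∃ q : ProbabilityMeasure ↥(closure Ω), ∀ g : D,
      M * ∫ y, (g : C(↥(closure Ω), ℝ)) y ∂(q : Measure ↥(closure Ω)) =
        c g + flux P v (G g) t := by
    intro t
    have hne : (𝓝[T₀] t).NeBot := mem_closure_iff_nhdsWithin_neBot.1 (hdense t)
    set U := Ultrafilter.of (𝓝[T₀] t)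
    obtain ⟨q, -, hq⟩ := isCompact_univ.ultrafilter_le_nhds (U.map κ') (by simp)
    refine ⟨q, fun g => ?_⟩
    have h1 : Tendsto κ' U (𝓝 q) := hq
    have h2 := (ProbabilityMeasure.tendsto_iff_forall_integral_tendsto.1 h1
      (BoundedContinuousFunction.mkOfCompact (g : C(↥(closure Ω), ℝ)))).const_mul M
    have h3 : Tendsto (fun t : I => c g + flux P v (G g) t) U (𝓝 (c g + flux P v (G g) t)) :=
      ((hcf g).tendsto t).mono_left ((Ultrafilter.of_le _).trans nhdsWithin_le_nhds)
    refine tendsto_nhds_unique (h2.congr' ?_) h3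
    have : T₀ ∈ (U : Filter I) := Ultrafilter.of_le _ self_mem_nhdsWithin
    filter_upwards [this] with s hs
    exact hs g
  choose q hq using hcl
  have hqκ : ∀ t ∈ T₀, (q t : Measure ↥(closure Ω)) = κ t := by
    intro t ht
    refine measure_eq_of_dense hDd fun g hg => ?_
    have h1 := hq t ⟨g, hg⟩
    rw [← ht ⟨g, hg⟩] at h1
    exact mul_left_cancel₀ hM.ne' h1
  have hqc : Continuous q := by
    rw [continuous_iff_continuousAt]
    intro t
    refine ProbabilityMeasure.tendsto_iff_forall_integral_tendsto.2 fun f => ?_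
    refine tendsto_integral_of_dense (C := 1) (by simp) (by simp) hDd (fun g hg => ?_)
      f.toContinuousMap
    have h1 := ((hcf ⟨g, hg⟩).tendsto t).const_mul M⁻¹
    have h2 : ∀ s : I, M⁻¹ * (c ⟨g, hg⟩ + flux P v (G g) s) =
        ∫ y, g y ∂(q s : Measure ↥(closure Ω)) := by
      intro s
      rw [← hq s ⟨g, hg⟩, inv_mul_cancel_left₀ hM.ne']
    simpa only [h2] using h1
  set p : I → FiniteMeasure ↥(closure Ω) := fun t => (P univ).toNNReal • (q t).toFiniteMeasure
    with hp
  have hpm : ∀ t, (p t : Measure ↥(closure Ω)) = P univ • (q t : Measure ↥(closure Ω)) := by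
    intro t
    have : ((P univ).toNNReal : ℝ≥0∞) = P univ := ENNReal.coe_toNNReal (measure_ne_top _ _)
    ext s hs
    simp only [hp, FiniteMeasure.toMeasure_smul, Measure.smul_apply, smul_eq_mul]
    rw [← this]
    rfl
  have hpc : Continuous p :=
    (ProbabilityMeasure.toFiniteMeasure_continuous.comp hqc).const_smul (P univ).toNNReal
  refine ⟨p, ⟨hpc, fun t => ?_, fun s hs => ?_⟩, ?_⟩
  · rw [hpm]; simp
  · have hdis : (P.map incl).fst.compProd κ = P.map incl := Measure.disintegrate _ _
    rw [← Measure.map_apply measurableEmbedding_incl.measurable hs, ← hdis,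
      Measure.compProd_apply hs, h.fst_map_incl, lintegral_smul_measure, smul_eq_mul,
      ← lintegral_const_mul' _ _ (measure_ne_top _ _)]
    refine lintegral_congr_ae ?_
    filter_upwards [hae] with t ht
    rw [hpm, hqκ t ht]
    rfl
  · intro F C hF hC s t
    obtain ⟨c', hc'⟩ := h.exists_integral_condKernel_eq hF
    let g : BoundedContinuousFunction ↥(closure Ω) ℝ := BoundedContinuousFunction.mkOfCompact
      ⟨fun y => F y, hF.smooth.continuous.comp continuous_subtype_val⟩
    have hcont1 : Continuous fun t : I => ∫ y, F y ∂(p t : Measure ↥(closure Ω)) :=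
      (FiniteMeasure.continuous_integral_boundedContinuousFunction g).comp hpc
    have hcont2 : Continuous fun t : I => c' + flux P v F t :=
      continuous_const.add ((h.continuous_flux hF).comp continuous_subtype_val)
    have heq : (fun t : I => ∫ y, F y ∂(p t : Measure ↥(closure Ω))) =
        fun t : I => c' + flux P v F t := by
      refine (Continuous.ae_eq_iff_eq (μ := volume) hcont1 hcont2).1 ?_
      filter_upwards [hc', hae] with t ht1 ht2
      rw [← ht1, hpm, hqκ t ht2, integral_smul_measure]
      rfl
    have h1 := congrFun heq t
    have h2 := congrFun heq s
    rw [h1, h2, add_sub_add_left_eq_sub]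
    exact h.abs_flux_sub_le hF hC s t

end Curve

/-! ### Uniqueness of narrowly continuous curves -/

/-- Countability lets an almost everywhere identity for each set be upgraded to one for the
measures. -/
theorem exists_countable_isPiSystem_generateFrom (Y : Type*) [TopologicalSpace Y]
    [MeasurableSpace Y] [BorelSpace Y] [SecondCountableTopology Y] :
    ∃ S : Set (Set Y), S.Countable ∧ IsPiSystem S ∧ univ ∈ S ∧ (∀ s ∈ S, MeasurableSet s) ∧
      ‹MeasurableSpace Y› = MeasurableSpace.generateFrom S := by
  obtain ⟨b, hbc, -, hb⟩ := TopologicalSpace.exists_countable_basis Y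
  have hm : ∀ s ∈ sInter '' {t : Set (Set Y) | t.Finite ∧ t ⊆ b}, MeasurableSet s := by
    rintro _ ⟨t, ⟨htf, htb⟩, rfl⟩
    exact MeasurableSet.sInter htf.countable fun u hu => (hb.isOpen (htb hu)).measurableSet
  refine ⟨sInter '' {t | t.Finite ∧ t ⊆ b}, (countable_ofPred_finite_subset hbc).image _, ?_,
    ⟨∅, by simp, by simp⟩, hm, ?_⟩
  · rintro _ ⟨t, ⟨ht, htb⟩, rfl⟩ _ ⟨t', ⟨ht', htb'⟩, rfl⟩ -
    exact ⟨t ∪ t', ⟨ht.union ht', union_subset htb htb'⟩, sInter_union _ _⟩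
  · refine le_antisymm ?_ (MeasurableSpace.generateFrom_le hm)
    rw [BorelSpace.measurable_eq (α := Y), hb.borel_eq_generateFrom]
    refine MeasurableSpace.generateFrom_mono fun u hu => ⟨{u}, by simpa using hu, by simp⟩

section Signed

variable {Y : Type*} [TopologicalSpace Y] [CompactSpace Y] [MeasurableSpace Y] [BorelSpace Y]

theorem integral_lsmul_eq_sub (s : SignedMeasure Y) (g : C(Y, ℝ)) :
    ∫ᵛ y, g y ∂•s = ∫ y, g y ∂s.toJordanDecomposition.posPart -
      ∫ y, g y ∂s.toJordanDecomposition.negPart := by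
  conv_lhs => rw [signed_eq_sub s]
  exact integral_lsmul_sub _ _ g.continuous.measurable g.norm_coe_le_norm

theorem integrable_signed (s : SignedMeasure Y) (g : C(Y, ℝ)) : VectorMeasure.Integrable s g :=
  integrable_variation_of_bounded s g.continuous.measurable g.norm_coe_le_norm

variable [HasOuterApproxClosed Y]

theorem signedMeasure_eq_of_integral_eq {s s' : SignedMeasure Y}
    (h : ∀ g : C(Y, ℝ), ∫ᵛ y, g y ∂•s = ∫ᵛ y, g y ∂•s') : s = s' := by
  have key : s.toJordanDecomposition.posPart + s'.toJordanDecomposition.negPart =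
      s'.toJordanDecomposition.posPart + s.toJordanDecomposition.negPart := by
    refine ext_of_forall_integral_eq_of_IsFiniteMeasure fun f => ?_
    have h1 := h f.toContinuousMap
    rw [integral_lsmul_eq_sub, integral_lsmul_eq_sub] at h1
    have hi : ∀ q : Measure Y, IsFiniteMeasure q → Integrable f q := fun q _ =>
      integrable_continuousMap q f.toContinuousMap
    rw [integral_add_measure (hi _ inferInstance) (hi _ inferInstance),
      integral_add_measure (hi _ inferInstance) (hi _ inferInstance)]
    simp only [BoundedContinuousFunction.coe_toContinuousMap] at h1
    linarith
  rw [signed_eq_sub s, signed_eq_sub s', sub_eq_sub_iff_add_eq_add,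
    ← Measure.toSignedMeasure_add, ← Measure.toSignedMeasure_add]
  congr 1

/-- The integrands in `Disintegrates` are measurable in time for product sets. -/
theorem measurable_apply_of_narrowlyContinuous {c : I → SignedMeasure Y}
    (hc : NarrowlyContinuous c) {B : Set Y} (hB : MeasurableSet B) : Measurable fun t => c t B := by
  induction B, hB using MeasurableSpace.induction_on_inter
    ((BorelSpace.measurable_eq (α := Y)).trans borel_eq_generateFrom_isClosed)
    isPiSystem_isClosed with
  | empty => simp
  | basic F hF =>
    change IsClosed F at hF
    let g : ℕ → C(Y, ℝ) := fun n => ⟨fun y => (hF.apprSeq n y : ℝ), by fun_prop⟩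
    refine measurable_of_tendsto_metrizable (f := fun n t => ∫ᵛ y, g n y ∂•(c t))
      (fun n => (hc (g n)).measurable) (tendsto_pi_nhds.2 fun t => ?_)
    have hlim : ∀ q : Measure Y, IsFiniteMeasure q →
        Tendsto (fun n => ∫ y, g n y ∂q) atTop (𝓝 (q.real F)) := by
      intro q hq
      have h1 := (ENNReal.tendsto_toReal (measure_ne_top q F)).comp
        (HasOuterApproxClosed.tendsto_lintegral_apprSeq hF q)
      refine h1.congr fun n => ?_
      exact BoundedContinuousFunction.toReal_lintegral_coe_eq_integral (hF.apprSeq n) q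
    simp_rw [integral_lsmul_eq_sub]
    have h2 := (hlim (c t).toJordanDecomposition.posPart inferInstance).sub
      (hlim (c t).toJordanDecomposition.negPart inferInstance)
    rwa [← SignedMeasure.apply_eq_posPart_real_sub_negPart_real _ hF.measurableSet] at h2
  | compl B hB ih =>
    have : ∀ t, c t Bᶜ = c t univ - c t B := fun t => by
      rw [VectorMeasure.of_compl hB]
    simp_rw [this]
    refine Measurable.sub ?_ ih
    have h1 := (hc 1).measurable
    simpa only [ContinuousMap.one_apply, VectorMeasure.integral_const,
      ContinuousLinearMap.lsmul_apply, one_smul] using h1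
  | iUnion f hd hm ih =>
    have : ∀ t, HasSum (fun n => c t (f n)) (c t (⋃ n, f n)) := fun t =>
      VectorMeasure.m_iUnion _ hm hd
    refine measurable_of_tendsto_metrizable
      (f := fun (k : ℕ) t => ∑ n ∈ Finset.range k, c t (f n)) (fun k => ?_)
      (tendsto_pi_nhds.2 fun t => (this t).tendsto_sum_nat)
    exact Finset.measurable_sum _ fun n _ => ih n

end Signed

section Unique

variable {d : ℕ} {Ω : Set (Euc d)}

theorem slice_eq_preimage (E : Set (Cyl Ω)) (t : I) : slice E t = Prod.mk t ⁻¹' (incl '' E) := by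
  ext x
  constructor
  · rintro ⟨ht, hx⟩; exact ⟨_, hx, rfl⟩
  · rintro ⟨z, hz, hzt⟩
    have h1 : (z.1 : ℝ) = t := congrArg (fun q : I × ↥(closure Ω) => (q.1 : ℝ)) hzt
    have h2 : z.2 = x := congrArg Prod.snd hzt
    refine ⟨h1 ▸ z.1.2, ?_⟩
    convert hz using 1
    exact Prod.ext (Subtype.ext h1.symm) h2.symm

variable [CompactSpace ↥(closure Ω)]

/-- Two curves disintegrating the same measure agree almost everywhere on each Borel set, hence
almost everywhere as measures, hence everywhere by continuity. -/
theorem Disintegrates.unique {r : SignedMeasure (Cyl Ω)} {c c' : I → SignedMeasure ↥(closure Ω)}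
    (hc : NarrowlyContinuous c) (hc' : NarrowlyContinuous c') (h : Disintegrates r c)
    (h' : Disintegrates r c') : c = c' := by
  have hB : ∀ B : Set ↥(closure Ω), MeasurableSet B → ∀ᵐ t : I, c t B = c' t B := by
    intro B hB
    have hm := measurable_apply_of_narrowlyContinuous hc hB
    have hm' := measurable_apply_of_narrowlyContinuous hc' hB
    -- truncation makes both integrands integrable
    let S : ℕ → Set I := fun k => {t | (t : ℝ) ∈ Ioo (0 : ℝ) 1 ∧ |c t B| ≤ k ∧ |c' t B| ≤ k}
    have hS : ∀ k, MeasurableSet (S k) := fun k =>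
      (measurableSet_Ioo.preimage measurable_subtype_coe).inter
        ((measurableSet_le hm.abs measurable_const).inter
          (measurableSet_le hm'.abs measurable_const))
    have hform : ∀ (e : I → SignedMeasure ↥(closure Ω)), Disintegrates r e → ∀ k (A : Set I),
        MeasurableSet A → ∫ t in A, (S k).indicator (fun t => e t B) t =
          r {z | incl z ∈ (A ∩ S k) ×ˢ B} := by
      intro e he k A hA
      rw [he {z | incl z ∈ (A ∩ S k) ×ˢ B}
          (measurableEmbedding_incl.measurable ((hA.inter (hS k)).prod hB)),
        setIntegral_indicator (hS k), ← integral_indicator (hA.inter (hS k))]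
      congr 1
      ext t
      by_cases ht : t ∈ A ∩ S k
      · rw [indicator_of_mem ht]
        congr 1
        ext y
        exact ⟨fun hy => ⟨ht.2.1, ht, hy⟩, fun ⟨_, hy⟩ => hy.2⟩
      · rw [indicator_of_notMem ht]
        have : slice {z : Cyl Ω | incl z ∈ (A ∩ S k) ×ˢ B} t = ∅ := by
          ext y
          simp only [mem_empty_iff_false, iff_false]
          rintro ⟨_, hy⟩
          exact ht hy.1
        rw [this, VectorMeasure.empty]
    have hae : ∀ k, ∀ᵐ t : I, (S k).indicator (fun t => c t B) t =
        (S k).indicator (fun t => c' t B) t := by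
      intro k
      refine Integrable.ae_eq_of_forall_setIntegral_eq _ _ ?_ ?_ fun A hA _ => ?_
      · refine Integrable.of_bound (hm.indicator (hS k)).aestronglyMeasurable (k : ℝ)
          (Eventually.of_forall fun t => ?_)
        by_cases ht : t ∈ S k
        · rw [indicator_of_mem ht]; exact ht.2.1
        · rw [indicator_of_notMem ht]; simp
      · refine Integrable.of_bound (hm'.indicator (hS k)).aestronglyMeasurable (k : ℝ)
          (Eventually.of_forall fun t => ?_)
        by_cases ht : t ∈ S k
        · rw [indicator_of_mem ht]; exact ht.2.2
        · rw [indicator_of_notMem ht]; simp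
      · rw [hform c h k A hA, hform c' h' k A hA]
    have hIoo : ∀ᵐ t : I, (t : ℝ) ∈ Ioo (0 : ℝ) 1 := by
      have h0 : ∀ᵐ t : I, t ≠ 0 := by simp [ae_iff]
      have h1 : ∀ᵐ t : I, t ≠ 1 := by simp [ae_iff]
      filter_upwards [h0, h1] with t ht0 ht1
      exact ⟨lt_of_le_of_ne t.2.1 fun e => ht0 (Subtype.ext e.symm),
        lt_of_le_of_ne t.2.2 fun e => ht1 (Subtype.ext e)⟩
    filter_upwards [ae_all_iff.2 hae, hIoo] with t ht hmem
    obtain ⟨k, hk⟩ := exists_nat_ge (max |c t B| |c' t B|)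
    have hmk : t ∈ S k := ⟨hmem, (le_max_left _ _).trans hk, (le_max_right _ _).trans hk⟩
    have := ht k
    rwa [indicator_of_mem hmk, indicator_of_mem hmk] at this
  obtain ⟨S, hSc, hSpi, hSu, hSm, hSg⟩ := exists_countable_isPiSystem_generateFrom ↥(closure Ω)
  have hae : ∀ᵐ t : I, c t = c' t := by
    have : ∀ᵐ t : I, ∀ B ∈ S, c t B = c' t B := (ae_ball_iff hSc).2 fun B hBS => hB B (hSm B hBS)
    filter_upwards [this] with t ht
    exact VectorMeasure.ext_of_generateFrom S ht hSg hSpi (ht _ hSu)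
  funext t
  refine signedMeasure_eq_of_integral_eq fun g => ?_
  have : (fun t => ∫ᵛ x, g x ∂•(c t)) = fun t => ∫ᵛ x, g x ∂•(c' t) := by
    refine (Continuous.ae_eq_iff_eq (μ := volume) (hc g) (hc' g)).1 ?_
    filter_upwards [hae] with t ht
    rw [ht]
  exact congrFun this t

theorem curve_eq {r : SignedMeasure (Cyl Ω)} {c : I → SignedMeasure ↥(closure Ω)}
    (hc : NarrowlyContinuous c) (h : Disintegrates r c) : HasCurve r ∧ curve r = c := by
  have hr : HasCurve r := ⟨c, hc, h⟩
  refine ⟨hr, ?_⟩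
  rw [curve, dif_pos hr]
  exact Disintegrates.unique hr.choose_spec.1 hc hr.choose_spec.2 h

end Unique

section CurveOf

variable {d : ℕ} {Ω : Set (Euc d)} {P Q : Measure (Cyl Ω)} [IsFiniteMeasure P] [IsFiniteMeasure Q]
  {p q : I → FiniteMeasure ↥(closure Ω)}

/-- A finite positive measure as a signed measure. -/
def toSigned {Y : Type*} [MeasurableSpace Y] (p : FiniteMeasure Y) : SignedMeasure Y :=
  (p : Measure Y).toSignedMeasure

theorem toSigned_apply_slice {E : Set (Cyl Ω)} (hE : MeasurableSet E)
    (p : FiniteMeasure ↥(closure Ω)) (t : I) :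
    toSigned p (slice E t) = (p : Measure ↥(closure Ω)).real (slice E t) := by
  refine Measure.toSignedMeasure_apply_measurable ?_
  rw [slice_eq_preimage]
  exact measurable_prodMk_left (measurableEmbedding_incl.measurableSet_image' hE)

/-- The curve of a flow, as a transition kernel from times to positions. -/
def IsCurveOf.kernel (h : IsCurveOf P p) : ProbabilityTheory.Kernel I ↥(closure Ω) :=
  ⟨fun t => p t, measurable_of_continuous_finiteMeasure h.cont⟩

instance IsCurveOf.isFiniteKernel_kernel (h : IsCurveOf P p) :
    ProbabilityTheory.IsFiniteKernel h.kernel :=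
  ⟨⟨P univ, measure_lt_top _ _, fun t => (h.mass t).le⟩⟩

theorem IsCurveOf.map_incl (h : IsCurveOf P p) :
    P.map incl = (volume : Measure I).compProd h.kernel := by
  ext s hs
  rw [Measure.map_apply measurableEmbedding_incl.measurable hs, h.disint s hs,
    Measure.compProd_apply hs]
  rfl

theorem IsCurveOf.measurable_section (h : IsCurveOf P p) {s : Set (I × ↥(closure Ω))}
    (hs : MeasurableSet s) : Measurable fun t => (p t : Measure ↥(closure Ω)) (Prod.mk t ⁻¹' s) :=
  ProbabilityTheory.Kernel.measurable_kernel_prodMk_left (κ := h.kernel) hs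

theorem IsCurveOf.measurable_slice (h : IsCurveOf P p) {E : Set (Cyl Ω)} (hE : MeasurableSet E) :
    Measurable fun t => (p t : Measure ↥(closure Ω)) (slice E t) := by
  simp_rw [slice_eq_preimage]
  exact h.measurable_section (measurableEmbedding_incl.measurableSet_image' hE)

theorem IsCurveOf.integrable_slice (h : IsCurveOf P p) {E : Set (Cyl Ω)} (hE : MeasurableSet E) :
    Integrable fun t => toSigned (p t) (slice E t) := by
  simp_rw [toSigned_apply_slice hE]
  refine Integrable.of_bound (h.measurable_slice hE).ennreal_toReal.aestronglyMeasurable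
    (P.real univ) (Eventually.of_forall fun t => ?_)
  rw [Real.norm_of_nonneg measureReal_nonneg, measureReal_def, measureReal_def, ← h.mass t]
  exact ENNReal.toReal_mono (measure_ne_top _ _) (measure_mono (subset_univ _))

theorem IsCurveOf.disintegrates (h : IsCurveOf P p) :
    Disintegrates P.toSignedMeasure fun t => toSigned (p t) := by
  intro E hE
  have h1 := h.disint _ (measurableEmbedding_incl.measurableSet_image' hE)
  rw [incl_injective.preimage_image] at h1
  simp_rw [toSigned_apply_slice hE, measureReal_def]
  rw [Measure.toSignedMeasure_apply_measurable hE, measureReal_def, h1,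
    integral_toReal (h.measurable_slice hE).aemeasurable
      (Eventually.of_forall fun t => measure_lt_top _ _)]
  simp_rw [slice_eq_preimage]

variable [CompactSpace ↥(closure Ω)]

theorem narrowlyContinuous_toSigned (hp : Continuous p) :
    NarrowlyContinuous fun t => toSigned (p t) := by
  intro g
  simp_rw [toSigned, integral_lsmul_toSignedMeasure]
  exact (FiniteMeasure.continuous_integral_boundedContinuousFunction
    (BoundedContinuousFunction.mkOfCompact g)).comp hp

theorem NarrowlyContinuous.sub {c c' : I → SignedMeasure ↥(closure Ω)} (hc : NarrowlyContinuous c)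
    (hc' : NarrowlyContinuous c') : NarrowlyContinuous (c - c') := by
  intro g
  have : ∀ t, ∫ᵛ x, g x ∂•((c - c') t) = ∫ᵛ x, g x ∂•(c t) - ∫ᵛ x, g x ∂•(c' t) := fun t =>
    VectorMeasure.integral_sub_vectorMeasure (integrable_signed _ g) (integrable_signed _ g)
  simp_rw [this]
  exact (hc g).sub (hc' g)

theorem IsCurveOf.curve_eq (h : IsCurveOf P p) :
    HasCurve P.toSignedMeasure ∧ curve P.toSignedMeasure = fun t => toSigned (p t) :=
  DynInv.curve_eq (narrowlyContinuous_toSigned h.cont) h.disintegrates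

theorem IsCurveOf.curve_sub_eq (h : IsCurveOf P p) (h' : IsCurveOf Q q) :
    HasCurve (P.toSignedMeasure - Q.toSignedMeasure) ∧
      curve (P.toSignedMeasure - Q.toSignedMeasure) = fun t => toSigned (p t) - toSigned (q t) := by
  refine DynInv.curve_eq ((narrowlyContinuous_toSigned h.cont).sub
    (narrowlyContinuous_toSigned h'.cont)) fun E hE => ?_
  have h1 := h.disintegrates E hE
  have h2 := h'.disintegrates E hE
  rw [_root_.sub_apply, h1, h2, ← integral_sub (h.integrable_slice hE) (h'.integrable_slice hE)]
  rfl

end CurveOf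

/-! ### Velocities from bounded functionals -/

/-- A functional bounded by `K ‖A ·‖` factors through the range of `A` and extends to the whole
space (Hahn–Banach), where it is represented by a vector (Riesz). -/
theorem exists_inner_eq_of_abs_le {V E : Type*} [AddCommGroup V] [Module ℝ V] [NormedAddCommGroup E]
    [InnerProductSpace ℝ E] [CompleteSpace E] (A : V →ₗ[ℝ] E) (L : V →ₗ[ℝ] ℝ) {K : ℝ} (hK : 0 ≤ K)
    (h : ∀ b, |L b| ≤ K * ‖A b‖) : ∃ w : E, ‖w‖ ≤ K ∧ ∀ b, L b = ⟪w, A b⟫ := by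
  obtain ⟨g, hg⟩ := A.rangeRestrict.exists_rightInverse_of_surjective A.range_rangeRestrict
  have hg' : ∀ x : LinearMap.range A, A (g x) = x := fun x =>
    congrArg Subtype.val (LinearMap.congr_fun hg x)
  let f : StrongDual ℝ (LinearMap.range A) := (L.comp g).mkContinuous K fun x => by
    have := h (g x)
    rw [hg'] at this
    exact this
  obtain ⟨F, hF, hFn⟩ := exists_extension_norm_eq (LinearMap.range A) f
  refine ⟨(InnerProductSpace.toDual ℝ E).symm F, ?_, fun b => ?_⟩
  · rw [LinearIsometryEquiv.norm_map, hFn]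
    exact LinearMap.mkContinuous_norm_le _ hK _
  · rw [InnerProductSpace.toDual_symm_apply]
    have h1 : F (A b) = L (g ⟨A b, b, rfl⟩) := hF ⟨A b, b, rfl⟩
    -- `L` does not depend on the chosen preimage: its kernel contains that of `A`
    have h2 := h (b - g ⟨A b, b, rfl⟩)
    rw [map_sub A, hg', sub_self, norm_zero, mul_zero, map_sub] at h2
    rw [h1]
    exact sub_eq_zero.1 (abs_nonpos_iff.1 h2)

section Functional

variable {d : ℕ} {Ω : Set (Euc d)}

/-- The spatial gradient of a function on `ℝ × ℝ^d`, as the Riesz representative of the spatial part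
of its derivative. -/
def spaceGrad (ψ : ℝ × Euc d → ℝ) (z : ℝ × Euc d) : Euc d :=
  (InnerProductSpace.toDual ℝ (Euc d)).symm
    ((fderiv ℝ ψ z).comp (ContinuousLinearMap.inr ℝ ℝ (Euc d)))

theorem inner_spaceGrad (ψ : ℝ × Euc d → ℝ) (z : ℝ × Euc d) (x : Euc d) :
    ⟪spaceGrad ψ z, x⟫ = fderiv ℝ ψ z (0, x) := by
  rw [spaceGrad, InnerProductSpace.toDual_symm_apply]
  simp

/-- The inclusion of `[0,1] × Ω̄` in `ℝ × ℝ^d`. -/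
def coeProd (q : I × ↥(closure Ω)) : ℝ × Euc d := ((q.1 : ℝ), (q.2 : Euc d))

theorem continuous_coeProd : Continuous (coeProd : I × ↥(closure Ω) → ℝ × Euc d) := by
  unfold coeProd; fun_prop

theorem IsTest.continuous_spaceGrad {ψ : ℝ × Euc d → ℝ} (h : IsTest ψ) :
    Continuous (spaceGrad ψ) := by
  have h1 := h.smooth.continuous_fderiv (by simp)
  unfold spaceGrad
  exact (LinearIsometryEquiv.continuous _).comp (h1.clm_comp continuous_const)

/-- The spatial gradient of a test function, as a continuous vector field on `[0,1] × Ω̄`. -/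
def gradMap {ψ : ℝ × Euc d → ℝ} (h : IsTest ψ) : C(I × ↥(closure Ω), Euc d) :=
  ⟨fun q => spaceGrad ψ (coeProd q), h.continuous_spaceGrad.comp continuous_coeProd⟩

/-- The time derivative of a test function, as a continuous function on `[0,1] × Ω̄`. -/
def timeDerivMap {ψ : ℝ × Euc d → ℝ} (h : IsTest ψ) : C(I × ↥(closure Ω), ℝ) :=
  ⟨fun q => fderiv ℝ ψ (coeProd q) (1, 0),
    (h.continuous_fderiv_apply _).comp continuous_coeProd⟩

theorem norm_Lp_two_eq {X : Type*} [MeasurableSpace X] {P : Measure X} (u : Lp (Euc d) 2 P) :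
    ‖u‖ = √(∫ z, ‖u z‖ ^ 2 ∂P) := by
  rw [← Real.sqrt_sq (norm_nonneg u), ← real_inner_self_eq_norm_sq, L2.inner_def]
  simp_rw [real_inner_self_eq_norm_sq]

theorem integrable_norm_sq {X : Type*} [MeasurableSpace X] {P : Measure X} {v : X → Euc d}
    (hv : MemLp v 2 P) : Integrable (fun z => ‖v z‖ ^ 2) P := hv.integrable_norm_pow (by simp)

theorem flowCost_eq_ofReal {α β : ℝ} (hα : 0 < α) (hβ : 0 < β) {P : Measure (Cyl Ω)}
    [IsFiniteMeasure P] {v : Cyl Ω → Euc d} (hv : MemLp v 2 P) :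
    flowCost α β P v = ENNReal.ofReal (β * ((∫ z, ‖v z‖ ^ 2 ∂P) / 2) + α * P.real univ) := by
  have h1 : ∫⁻ z, ‖v z‖ₑ ^ 2 ∂P = ENNReal.ofReal (∫ z, ‖v z‖ ^ 2 ∂P) := by
    rw [ofReal_integral_eq_lintegral_ofReal (integrable_norm_sq hv)
      (Eventually.of_forall fun _ => by positivity)]
    refine lintegral_congr fun z => ?_
    rw [ENNReal.ofReal_pow (norm_nonneg _), ofReal_norm]
  have h0 : 0 ≤ ∫ z, ‖v z‖ ^ 2 ∂P := integral_nonneg fun _ => by positivity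
  rw [flowCost, h1, ENNReal.ofReal_add (by positivity) (by positivity), ENNReal.ofReal_mul hβ.le,
    ENNReal.ofReal_mul hα.le, ofReal_measureReal, ENNReal.ofReal_div_of_pos (by norm_num)]
  simp

theorem abs_integral_inner_le {X : Type*} [MeasurableSpace X] {P : Measure X} {u v : X → Euc d}
    (hu : MemLp u 2 P) (hv : MemLp v 2 P) :
    |∫ z, ⟪u z, v z⟫ ∂P| ≤ √(∫ z, ‖v z‖ ^ 2 ∂P) * √(∫ z, ‖u z‖ ^ 2 ∂P) := by
  have h1 : ∫ z, ⟪u z, v z⟫ ∂P = ⟪hu.toLp u, hv.toLp v⟫ := by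
    rw [L2.inner_def]
    refine integral_congr_ae ?_
    filter_upwards [hu.coeFn_toLp, hv.coeFn_toLp] with z h1 h2
    rw [h1, h2]
  have h2 : ∀ (u : X → Euc d) (hu : MemLp u 2 P), ‖hu.toLp u‖ = √(∫ z, ‖u z‖ ^ 2 ∂P) := by
    intro u hu
    rw [norm_Lp_two_eq]
    congr 1
    refine integral_congr_ae ?_
    filter_upwards [hu.coeFn_toLp] with z h1
    rw [h1]
  rw [h1, ← h2 u hu, ← h2 v hv, mul_comm]
  exact abs_real_inner_le_norm _ _

theorem integrable_inner_of_memLp {X : Type*} [MeasurableSpace X] {P : Measure X} {u v : X → Euc d}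
    (hu : MemLp u 2 P) (hv : MemLp v 2 P) : Integrable (fun z => ⟪u z, v z⟫) P := by
  refine (L2.integrable_inner (𝕜 := ℝ) (hu.toLp u) (hv.toLp v)).congr ?_
  filter_upwards [hu.coeFn_toLp, hv.coeFn_toLp] with z h1 h2
  rw [h1, h2]

variable [CompactSpace ↥(closure Ω)]

/-- The class in `L²(P)` of a continuous vector field on `[0,1] × Ω̄`. -/
def restrictL2 (P : Measure (Cyl Ω)) [IsFiniteMeasure P] :
    C(I × ↥(closure Ω), Euc d) →ₗ[ℝ] Lp (Euc d) 2 P where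
  toFun b := BoundedContinuousFunction.toLp 2 P ℝ
    ((BoundedContinuousFunction.mkOfCompact b).compContinuous ⟨incl, continuous_incl⟩)
  map_add' b b' := by rw [← map_add]; rfl
  map_smul' c b := by rw [RingHom.id_apply, ← map_smul]; rfl

theorem restrictL2_ae (P : Measure (Cyl Ω)) [IsFiniteMeasure P] (b : C(I × ↥(closure Ω), Euc d)) :
    restrictL2 P b =ᵐ[P] fun z => b (incl z) :=
  BoundedContinuousFunction.coeFn_toLp (p := 2) (μ := P) (𝕜 := ℝ) _

/-- A functional on continuous vector fields, bounded for the `L²(P)` norm and satisfying the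
continuity equation together with `P`, comes from a velocity field. Convexity and compactness of
flows reduce to this, since such functionals can be added and passed to the limit. -/
theorem exists_isFlow_of_functional {P : Measure (Cyl Ω)} [IsFiniteMeasure P]
    (L : C(I × ↥(closure Ω), Euc d) →ₗ[ℝ] ℝ) {K : ℝ} (hK : 0 ≤ K)
    (hL : ∀ b, |L b| ≤ K * √(∫ z, ‖b (incl z)‖ ^ 2 ∂P))
    (hce : ∀ ψ : ℝ × Euc d → ℝ, ∀ h : IsTest ψ,
      ∫ z, timeDerivMap h (incl z) ∂P + L (gradMap h) = 0) :
    ∃ v, IsFlow P v ∧ ∫ z, ‖v z‖ ^ 2 ∂P ≤ K ^ 2 := by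
  have hnorm : ∀ b, ‖restrictL2 P b‖ = √(∫ z, ‖b (incl z)‖ ^ 2 ∂P) := by
    intro b
    rw [norm_Lp_two_eq]
    congr 1
    refine integral_congr_ae ?_
    filter_upwards [restrictL2_ae P b] with z hz
    rw [hz]
  obtain ⟨w, hwK, hw⟩ := exists_inner_eq_of_abs_le (restrictL2 P) L hK fun b => by
    rw [hnorm]; exact hL b
  refine ⟨w, ⟨(Lp.stronglyMeasurable w).measurable, Lp.memLp w, fun ψ hψ => ?_⟩, ?_⟩
  · have h1 := hce ψ hψ
    rw [hw, L2.inner_def] at h1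
    refine Eq.trans ?_ h1
    congr 1
    refine integral_congr_ae ?_
    filter_upwards [restrictL2_ae P (gradMap hψ)] with z hz
    rw [hz, real_inner_comm, ← inner_spaceGrad]
    rfl
  · have h1 : 0 ≤ ∫ z, ‖w z‖ ^ 2 ∂P := integral_nonneg fun _ => by positivity
    rw [norm_Lp_two_eq] at hwK
    exact (Real.sqrt_le_left hK).1 hwK

/-! ### Convexity of the regularizer -/

theorem memLp_comp_incl (P : Measure (Cyl Ω)) [IsFiniteMeasure P]
    (b : C(I × ↥(closure Ω), Euc d)) : MemLp (fun z => b (incl z)) 2 P :=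
  MemLp.of_bound (b.continuous.comp continuous_incl).aestronglyMeasurable ‖b‖
    (Eventually.of_forall fun _ => b.norm_coe_le_norm _)

/-- The momentum `v P` of a flow, as a functional `b ↦ ∫ b · v dP` on continuous vector fields. -/
def flowFunctional {P : Measure (Cyl Ω)} [IsFiniteMeasure P] {v : Cyl Ω → Euc d}
    (hv : IsFlow P v) : C(I × ↥(closure Ω), Euc d) →ₗ[ℝ] ℝ where
  toFun b := ∫ z, ⟪b (incl z), v z⟫ ∂P
  map_add' b b' := by
    simp only [ContinuousMap.add_apply, inner_add_left]
    exact integral_add (integrable_inner_of_memLp (memLp_comp_incl P b) hv.memLp)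
      (integrable_inner_of_memLp (memLp_comp_incl P b') hv.memLp)
  map_smul' c b := by
    simp only [ContinuousMap.smul_apply, real_inner_smul_left, integral_const_mul, RingHom.id_apply,
      smul_eq_mul]

theorem abs_flowFunctional_le {P : Measure (Cyl Ω)} [IsFiniteMeasure P] {v : Cyl Ω → Euc d}
    (hv : IsFlow P v) (b : C(I × ↥(closure Ω), Euc d)) :
    |flowFunctional hv b| ≤ √(∫ z, ‖v z‖ ^ 2 ∂P) * √(∫ z, ‖b (incl z)‖ ^ 2 ∂P) :=
  abs_integral_inner_le (memLp_comp_incl P b) hv.memLp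

theorem flowFunctional_gradMap {P : Measure (Cyl Ω)} [IsFiniteMeasure P] {v : Cyl Ω → Euc d}
    (hv : IsFlow P v) {ψ : ℝ × Euc d → ℝ} (h : IsTest ψ) :
    ∫ z, timeDerivMap h (incl z) ∂P + flowFunctional hv (gradMap h) = 0 := by
  refine Eq.trans ?_ (hv.eq ψ h)
  congr 1
  refine integral_congr_ae (Eventually.of_forall fun z => ?_)
  exact inner_spaceGrad _ _ _

/-- The kinetic energy is convex in the pair of measure and momentum: the sum of the momenta is
bounded in `L²(a P + b Q)` by the Cauchy–Schwarz inequality. -/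
theorem exists_isFlow_convexCombination {P Q : Measure (Cyl Ω)} [IsFiniteMeasure P]
    [IsFiniteMeasure Q] {v w : Cyl Ω → Euc d} (hv : IsFlow P v) (hw : IsFlow Q w) {a b : NNReal} :
    ∃ u, IsFlow (a • P + b • Q) u ∧
      ∫ z, ‖u z‖ ^ 2 ∂(a • P + b • Q) ≤ a * ∫ z, ‖v z‖ ^ 2 ∂P + b * ∫ z, ‖w z‖ ^ 2 ∂Q := by
  set A := ∫ z, ‖v z‖ ^ 2 ∂P with hA
  set B := ∫ z, ‖w z‖ ^ 2 ∂Q with hB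
  have hA0 : 0 ≤ A := integral_nonneg fun _ => by positivity
  have hB0 : 0 ≤ B := integral_nonneg fun _ => by positivity
  have hcomb : ∀ (f : Cyl Ω → ℝ), Integrable f P → Integrable f Q →
      ∫ z, f z ∂(a • P + b • Q) = a * ∫ z, f z ∂P + b * ∫ z, f z ∂Q := by
    intro f hf hg
    rw [integral_add_measure hf.smul_measure_nnreal hg.smul_measure_nnreal,
      integral_smul_nnreal_measure, integral_smul_nnreal_measure]
    rfl
  obtain ⟨u, hu, hu2⟩ : ∃ u, IsFlow (a • P + b • Q) u ∧
      ∫ z, ‖u z‖ ^ 2 ∂(a • P + b • Q) ≤ √(a * A + b * B) ^ 2 := by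
    refine exists_isFlow_of_functional
      ((a : ℝ) • flowFunctional hv + (b : ℝ) • flowFunctional hw)
      (Real.sqrt_nonneg _) (fun g => ?_) (fun ψ h => ?_)
    · rw [hcomb _ (integrable_norm_sq (memLp_comp_incl P g))
        (integrable_norm_sq (memLp_comp_incl Q g))]
      have h1 := abs_flowFunctional_le hv g
      have h2 := abs_flowFunctional_le hw g
      set x := ∫ z, ‖g (incl z)‖ ^ 2 ∂P
      set y := ∫ z, ‖g (incl z)‖ ^ 2 ∂Q
      have hx0 : 0 ≤ x := integral_nonneg fun _ => by positivity
      have hy0 : 0 ≤ y := integral_nonneg fun _ => by positivity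
      rw [← hA] at h1
      rw [← hB] at h2
      have h3 : |((a : ℝ) • flowFunctional hv + (b : ℝ) • flowFunctional hw) g| ≤
          a * (√A * √x) + b * (√B * √y) := by
        simp only [LinearMap.add_apply, LinearMap.smul_apply, smul_eq_mul]
        refine (abs_add_le _ _).trans ?_
        rw [abs_mul, abs_mul, NNReal.abs_eq, NNReal.abs_eq]
        gcongr
      refine h3.trans ?_
      rw [← Real.sqrt_mul (show (0 : ℝ) ≤ a * A + b * B by positivity)]
      refine Real.le_sqrt_of_sq_le ?_
      have e1 := Real.sq_sqrt hA0
      have e2 := Real.sq_sqrt hB0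
      have e3 := Real.sq_sqrt hx0
      have e4 := Real.sq_sqrt hy0
      set A' := √A
      set B' := √B
      set x' := √x
      set y' := √y
      rw [← e1, ← e2, ← e3, ← e4]
      -- the difference of the two sides of the Cauchy–Schwarz inequality
      have : 0 ≤ (a : ℝ) * b * (A' * y' - B' * x') ^ 2 := by positivity
      linarith
    · have hti : ∀ (R' : Measure (Cyl Ω)), IsFiniteMeasure R' →
          Integrable (fun z => timeDerivMap h (incl z)) R' := fun R' _ =>
        Integrable.of_bound ((timeDerivMap h).continuous.comp continuous_incl).aestronglyMeasurable
          ‖timeDerivMap (Ω := Ω) h‖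
          (Eventually.of_forall fun _ => (timeDerivMap h).norm_coe_le_norm _)
      rw [hcomb _ (hti P inferInstance) (hti Q inferInstance)]
      have h1 := flowFunctional_gradMap hv h
      have h2 := flowFunctional_gradMap hw h
      simp only [LinearMap.add_apply, LinearMap.smul_apply, smul_eq_mul]
      linear_combination (a : ℝ) * h1 + (b : ℝ) * h2
  exact ⟨u, hu, hu2.trans_eq (Real.sq_sqrt (by positivity))⟩

end Functional

/-! ### Pairs of finite cost -/

section FiniteCost

variable {d : ℕ} {Ω : Set (Euc d)}

theorem exists_pair_of_flow {α β : ℝ} (hα : 0 < α) (hβ : 0 < β) {P : Measure (Cyl Ω)}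
    [IsFiniteMeasure P] {v : Cyl Ω → Euc d} (hv : IsFlow P v) :
    ∃ μ : Pairs Ω, μ.1 = P.toSignedMeasure ∧
        J α β μ = ENNReal.ofReal (β * ((∫ z, ‖v z‖ ^ 2 ∂P) / 2) + α * P.real univ) := by
  obtain ⟨μ, hμ⟩ := exists_isDensity P hv
  exact ⟨μ, hμ.1, by rw [J_eq_of_isDensity hμ hv, flowCost_eq_ofReal hα hβ hv.memLp]⟩

theorem IsCurveOf.combination {P Q : Measure (Cyl Ω)} [IsFiniteMeasure P] [IsFiniteMeasure Q]
    {p q : I → FiniteMeasure ↥(closure Ω)} (h : IsCurveOf P p) (h' : IsCurveOf Q q)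
    (a b : NNReal) : IsCurveOf (a • P + b • Q) (fun t => a • p t + b • q t) := by
  refine ⟨(h.cont.const_smul a).add (h'.cont.const_smul b), fun t => ?_, fun s hs => ?_⟩
  · simp only [FiniteMeasure.toMeasure_add, FiniteMeasure.toMeasure_smul, Measure.add_apply,
      Measure.smul_apply, h.mass, h'.mass]
  · simp only [FiniteMeasure.toMeasure_add, FiniteMeasure.toMeasure_smul, Measure.add_apply,
      Measure.smul_apply]
    simp_rw [ENNReal.smul_def, smul_eq_mul]
    rw [lintegral_add_left ((h.measurable_section hs).const_mul _),
      lintegral_const_mul _ (h.measurable_section hs),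
      lintegral_const_mul _ (h'.measurable_section hs), h.disint s hs, h'.disint s hs]

theorem J_zero (α β : ℝ) : J α β (0 : Pairs Ω) = 0 := by
  have h0 : IsFlow (0 : Measure (Cyl Ω)) 0 := ⟨measurable_zero, MemLp.zero, by simp⟩
  have : IsDensity (0 : Pairs Ω) 0 0 := by
    refine ⟨Measure.toSignedMeasure_zero.symm, fun i => ?_⟩
    ext s hs
    have h1 : comp (0 : VectorMeasure (Cyl Ω) (Euc d)) i s = (0 : Euc d) i :=
      VectorMeasure.mapRange_apply _ _
    have h2 : (0 : Measure (Cyl Ω)).withDensityᵥ (fun z => (0 : Cyl Ω → Euc d) z i) s = 0 := by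
      rw [withDensityᵥ_apply (by simp) hs]
      simp
    exact h1.trans h2.symm
  rw [J_eq_of_isDensity this h0]
  simp [flowCost]

variable [CompactSpace ↥(closure Ω)]

theorem IsCurveOf.integral_eq {P : Measure (Cyl Ω)} [IsFiniteMeasure P]
    {p : I → FiniteMeasure ↥(closure Ω)} (h : IsCurveOf P p) (F : C(I × ↥(closure Ω), ℝ)) :
    ∫ z, F (incl z) ∂P = ∫ t : I, ∫ y, F (t, y) ∂(p t : Measure ↥(closure Ω)) := by
  rw [← measurableEmbedding_incl.integral_map, h.map_incl, Measure.integral_compProd]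
  · rfl
  · exact integrable_continuousMap _ F

/-- What is used of a pair of finite cost: its measure, velocity and curve, the value of its cost,
and the modulus of continuity of the curve. -/
theorem exists_flow_curve {α β : ℝ} (hα : 0 < α) (hβ : 0 < β) {μ : Pairs Ω} (hμ : J α β μ < ⊤) :
    ∃ (P : Measure (Cyl Ω)) (_ : IsFiniteMeasure P) (v : Cyl Ω → Euc d)
      (p : I → FiniteMeasure ↥(closure Ω)), IsFlow P v ∧ IsCurveOf P p ∧
        μ.1 = P.toSignedMeasure ∧
        J α β μ = ENNReal.ofReal (β * ((∫ z, ‖v z‖ ^ 2 ∂P) / 2) + α * P.real univ) ∧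
        ∀ (G : Euc d → ℝ) (C : ℝ), IsSpaceTest G → (∀ x, ‖fderiv ℝ G x‖ ≤ C) → ∀ s t : I,
        |∫ y, G y ∂(p t : Measure ↥(closure Ω)) - ∫ y, G y ∂(p s : Measure ↥(closure Ω))| ≤
          C * (√(∫ z, ‖v z‖ ^ 2 ∂P) * √(P.real univ * |(t : ℝ) - s|)) := by
  obtain ⟨P, hP, v, hv, hμv⟩ := exists_flow_of_J_lt_top hβ hμ
  obtain ⟨p, hp, hG⟩ := hv.exists_curve
  exact ⟨P, hP, v, p, hv, hp, hμv.1, by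
    rw [J_eq_of_isDensity hμv hv, flowCost_eq_ofReal hα hβ hv.memLp], hG⟩

theorem toSigned_combination {Y : Type*} [MeasurableSpace Y] (p q : FiniteMeasure Y)
    (a b : NNReal) : toSigned (a • p + b • q) = (a : ℝ) • toSigned p + (b : ℝ) • toSigned q := by
  ext s hs
  simp only [toSigned]
  rw [Measure.toSignedMeasure_apply_measurable hs, _root_.add_apply, _root_.smul_apply,
    _root_.smul_apply, Measure.toSignedMeasure_apply_measurable hs,
    Measure.toSignedMeasure_apply_measurable hs, FiniteMeasure.toMeasure_add,
    measureReal_add_apply, FiniteMeasure.toMeasure_smul, FiniteMeasure.toMeasure_smul,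
    measureReal_nnreal_smul_apply, measureReal_nnreal_smul_apply]
  rfl

/-- The regularizer is convex, and `μ ↦ (t ↦ ρ_t)` is affine along the combinations. -/
theorem exists_convexCombination {α β : ℝ} (hα : 0 < α) (hβ : 0 < β) {μ η : Pairs Ω}
    (hμ : J α β μ < ⊤) (hη : J α β η < ⊤) {s : ℝ} (hs0 : 0 ≤ s) (hs1 : s ≤ 1) :
    ∃ ν : Pairs Ω, J α β ν < ⊤ ∧
      (J α β ν).toReal ≤ (1 - s) * (J α β μ).toReal + s * (J α β η).toReal ∧
      curve ν.1 = fun t => (1 - s) • curve μ.1 t + s • curve η.1 t := by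
  obtain ⟨P, hP, v, p, hv, hp, hμP, hJμ, -⟩ := exists_flow_curve hα hβ hμ
  obtain ⟨Q, hQ, w, q, hw, hq, hηQ, hJη, -⟩ := exists_flow_curve hα hβ hη
  have ha : ((1 - s).toNNReal : ℝ) = 1 - s := Real.coe_toNNReal _ (by linarith)
  have hb : (s.toNNReal : ℝ) = s := Real.coe_toNNReal _ hs0
  obtain ⟨u, hu, hu2⟩ :=
    exists_isFlow_convexCombination hv hw (a := (1 - s).toNNReal) (b := s.toNNReal)
  obtain ⟨ν, hν, hJν⟩ := exists_pair_of_flow hα hβ hu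
  rw [ha, hb] at hu2
  refine ⟨ν, hJν ▸ ENNReal.ofReal_lt_top, ?_, ?_⟩
  · have h0 : ∀ {N : Measure (Cyl Ω)} {u : Cyl Ω → Euc d}, 0 ≤ ∫ z, ‖u z‖ ^ 2 ∂N :=
      integral_nonneg fun _ => by positivity
    have hE0 := @h0 P v
    have hE1 := @h0 Q w
    have hE2 := @h0 ((1 - s).toNNReal • P + s.toNNReal • Q) u
    rw [hJν, hJμ, hJη, ENNReal.toReal_ofReal (by positivity), ENNReal.toReal_ofReal (by positivity),
      ENNReal.toReal_ofReal (by positivity), measureReal_add_apply, measureReal_nnreal_smul_apply,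
      measureReal_nnreal_smul_apply, ha, hb]
    have := mul_le_mul_of_nonneg_left hu2 (show 0 ≤ β / 2 by positivity)
    linarith
  · rw [hν, hμP, hηQ, (hp.combination hq _ _).curve_eq.2, hp.curve_eq.2, hq.curve_eq.2]
    ext1 t
    rw [toSigned_combination, ha, hb]

theorem exists_curve_of_J_lt_top {α β : ℝ} (hα : 0 < α) (hβ : 0 < β) {μ : Pairs Ω}
    (hμ : J α β μ < ⊤) : HasCurve μ.1 ∧ NarrowlyContinuous (curve μ.1) ∧
      ∀ t, (tv (curve μ.1 t)).toReal ≤ (J α β μ).toReal / α := by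
  obtain ⟨P, hP, v, p, hv, hp, hμP, hJμ, -⟩ := exists_flow_curve hα hβ hμ
  rw [hμP, hp.curve_eq.2]
  refine ⟨hp.curve_eq.1, narrowlyContinuous_toSigned hp.cont, fun t => ?_⟩
  have h0 : 0 ≤ ∫ z, ‖v z‖ ^ 2 ∂P := integral_nonneg fun _ => by positivity
  rw [hJμ, ENNReal.toReal_ofReal (by positivity), tv]
  simp only [toSigned]
  rw [Measure.variation_toSignedMeasure,
    hp.mass, le_div_iff₀ hα, measureReal_def]
  nlinarith

theorem curve_sub_of_J_lt_top {α β : ℝ} (hα : 0 < α) (hβ : 0 < β) {μ η : Pairs Ω}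
    (hμ : J α β μ < ⊤) (hη : J α β η < ⊤) : HasCurve (μ.1 - η.1) ∧
      curve (μ.1 - η.1) = fun t => curve μ.1 t - curve η.1 t := by
  obtain ⟨P, hP, v, p, hv, hp, hμP, hJμ, -⟩ := exists_flow_curve hα hβ hμ
  obtain ⟨Q, hQ, w, q, hw, hq, hηQ, hJη, -⟩ := exists_flow_curve hα hβ hη
  rw [hμP, hηQ, hp.curve_eq.2, hq.curve_eq.2]
  exact hp.curve_sub_eq hq

theorem curve_zero : HasCurve (0 : SignedMeasure (Cyl Ω)) ∧
    curve (0 : SignedMeasure (Cyl Ω)) = fun _ => 0 := by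
  refine curve_eq (fun g => ?_) (fun E _ => by simp)
  simp only [VectorMeasure.integral_zero_vectorMeasure]
  exact continuous_const

end FiniteCost

/-! ### Compactness of the sublevel sets of the regularizer -/

section Compactness

/-- Weak convergence against continuous functions of time improves to pointwise convergence for
functions with a common modulus of continuity. -/
theorem tendsto_of_tendsto_integral_mul {h : ℕ → I → ℝ} {h₀ : I → ℝ} {m : ℝ → ℝ}
    (hm : Tendsto m (𝓝 0) (𝓝 0))
    (hc : ∀ n, Continuous (h n)) (hc₀ : Continuous h₀)
    (hh : ∀ n s t, |h n t - h n s| ≤ m |(t : ℝ) - s|)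
    (hh₀ : ∀ s t, |h₀ t - h₀ s| ≤ m |(t : ℝ) - s|)
    (hw : ∀ a : C(I, ℝ), Tendsto (fun n => ∫ t, a t * h n t) atTop (𝓝 (∫ t, a t * h₀ t))) (t : I) :
    Tendsto (fun n => h n t) atTop (𝓝 (h₀ t)) := by
  rw [Metric.tendsto_nhds]
  intro ε hε
  obtain ⟨δ, hδ, hmδ⟩ := Metric.tendsto_nhds_nhds.1 hm (ε / 4) (by positivity)
  -- a tent function around `t`, on whose support the modulus of continuity is small
  let a : C(I, ℝ) := ⟨fun s => max 0 (δ - |(t : ℝ) - s|), by fun_prop⟩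
  have ha0 : ∀ s, 0 ≤ a s := fun s => le_max_left _ _
  have haδ : ∀ s, a s ≠ 0 → |(t : ℝ) - s| < δ := by
    intro s hs
    by_contra hcon
    exact hs (max_eq_left (by linarith))
  have hint : ∀ {f : I → ℝ}, Continuous f → Integrable f := fun hf =>
    integrable_continuousMap volume ⟨_, hf⟩
  have hA : 0 < ∫ s, a s := by
    rw [integral_pos_iff_support_of_nonneg ha0 (hint a.continuous)]
    refine (a.continuous.isOpen_support).measure_pos _ ⟨t, ?_⟩
    have : a t = δ := by simp [a, hδ.le]
    rw [Function.mem_support, this]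
    exact hδ.ne'
  set A := ∫ s, a s
  have key : ∀ f : I → ℝ, Continuous f → (∀ s t, |f t - f s| ≤ m |(t : ℝ) - s|) →
      |(∫ s, a s * f s) - A * f t| ≤ ε / 4 * A := by
    intro f hf hfm
    rw [← integral_mul_const, ← integral_sub (hint (f := fun s => a s * f s) (by fun_prop))
      (hint (f := fun s => a s * f t) (by fun_prop)), ← integral_const_mul]
    refine abs_integral_le_integral_abs.trans (integral_mono
      (hint (by fun_prop)) (hint (by fun_prop)) fun s => ?_)
    dsimp only
    rw [← mul_sub, abs_mul, abs_of_nonneg (ha0 s), mul_comm]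
    by_cases hs : a s = 0
    · simp [hs]
    · refine mul_le_mul_of_nonneg_right ?_ (ha0 s)
      rw [abs_sub_comm]
      refine (hfm s t).trans ?_
      have := @hmδ (|(t : ℝ) - s|) (by simpa using haδ s hs)
      rw [Real.dist_eq, sub_zero] at this
      exact (le_abs_self _).trans this.le
  filter_upwards [Metric.tendsto_nhds.1 (hw a) (ε / 4 * A) (by positivity)] with n hn
  rw [Real.dist_eq] at hn ⊢
  have h1 := key (h n) (hc n) (hh n)
  have h2 := key h₀ hc₀ hh₀
  have h3 : A * |h n t - h₀ t| < A * ε := by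
    rw [← abs_of_pos hA, ← abs_mul, abs_of_pos hA, mul_sub]
    rw [abs_le] at h1 h2
    rw [abs_lt] at hn ⊢
    have : 0 < ε * A := by positivity
    constructor <;> linarith [h1.1, h1.2, h2.1, h2.2, hn.1, hn.2]
  exact lt_of_mul_lt_mul_left h3 hA.le

variable {d : ℕ} {Ω : Set (Euc d)} [CompactSpace ↥(closure Ω)]

/-- Weak compactness of flows, for the measures on the closed cylinder. -/
theorem exists_subseq_flow [Nonempty ↥(closure Ω)] {P : ℕ → Measure (Cyl Ω)}
    [∀ n, IsFiniteMeasure (P n)] {v : ℕ → Cyl Ω → Euc d} (hv : ∀ n, IsFlow (P n) (v n))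
    {A B : ℝ} (hA : ∀ n, (P n).real univ ≤ A) (hB : ∀ n, ∫ z, ‖v n z‖ ^ 2 ∂(P n) ≤ B) :
    ∃ (f : ℕ → ℕ) (M E : ℝ) (P₀ : Measure (Cyl Ω)) (_ : IsFiniteMeasure P₀) (u : Cyl Ω → Euc d),
      StrictMono f ∧ Tendsto (fun n => (P (f n)).real univ) atTop (𝓝 M) ∧
      Tendsto (fun n => ∫ z, ‖v (f n) z‖ ^ 2 ∂(P (f n))) atTop (𝓝 E) ∧ IsFlow P₀ u ∧
      P₀.real univ = M ∧ ∫ z, ‖u z‖ ^ 2 ∂P₀ ≤ E ∧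
      ∀ g : C(I × ↥(closure Ω), ℝ), Tendsto (fun n => ∫ z, g (incl z) ∂(P (f n))) atTop
        (𝓝 (∫ z, g (incl z) ∂P₀)) := by
  have hE0 : ∀ n, 0 ≤ ∫ z, ‖v n z‖ ^ 2 ∂(P n) := fun n => integral_nonneg fun _ => by positivity
  let R : ℕ → FiniteMeasure (I × ↥(closure Ω)) := fun n => ⟨(P n).map incl, inferInstance⟩
  let x : ℕ → ℝ × ℝ × ProbabilityMeasure (I × ↥(closure Ω)) := fun n =>
    ((P n).real univ, ∫ z, ‖v n z‖ ^ 2 ∂(P n), (R n).normalize)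
  have hK : IsCompact (Icc 0 A ×ˢ Icc 0 B ×ˢ
      (univ : Set (ProbabilityMeasure (I × ↥(closure Ω))))) :=
    isCompact_Icc.prod (isCompact_Icc.prod isCompact_univ)
  obtain ⟨⟨M, E, q⟩, ⟨hM, hE, -⟩, f, hf, hx⟩ := hK.tendsto_subseq (x := x) fun n =>
    ⟨⟨measureReal_nonneg, hA n⟩, ⟨hE0 n, hB n⟩, mem_univ _⟩
  have hxM : Tendsto (fun n => (P (f n)).real univ) atTop (𝓝 M) := hx.fst_nhds
  have hxE : Tendsto (fun n => ∫ z, ‖v (f n) z‖ ^ 2 ∂(P (f n))) atTop (𝓝 E) := hx.snd_nhds.fst_nhds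
  have hxq : Tendsto (fun n => (R (f n)).normalize) atTop (𝓝 q) := hx.snd_nhds.snd_nhds
  have hRmass : ∀ n, ((R n).mass : ℝ) = (P n).real univ := by
    intro n
    have h1 : (((R n).mass : NNReal) : ℝ≥0∞) = (P n).map incl univ := FiniteMeasure.ennreal_mass
    rw [Measure.map_apply measurableEmbedding_incl.measurable MeasurableSet.univ,
      preimage_univ] at h1
    rw [measureReal_def, ← h1]
    rfl
  set S : Measure (I × ↥(closure Ω)) := M.toNNReal • (q : Measure (I × ↥(closure Ω))) with hS
  have hMc : (M.toNNReal : ℝ) = M := Real.coe_toNNReal _ hM.1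
  have hSg : ∀ g : C(I × ↥(closure Ω), ℝ), Tendsto (fun n => ∫ z, g (incl z) ∂(P (f n))) atTop
      (𝓝 (∫ z, g z ∂S)) := by
    intro g
    have h1 := hxM.mul ((ProbabilityMeasure.tendsto_iff_forall_integral_tendsto.1 hxq)
      (BoundedContinuousFunction.mkOfCompact g))
    have h2 : M * ∫ z, g z ∂(q : Measure (I × ↥(closure Ω))) = ∫ z, g z ∂S := by
      rw [hS, integral_smul_nnreal_measure, NNReal.smul_def, hMc, smul_eq_mul]
    have h3 : ∀ n, (P n).real univ * ∫ z, g z ∂((R n).normalize : Measure (I × ↥(closure Ω))) =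
        ∫ z, g (incl z) ∂(P n) := by
      intro n
      rw [← measurableEmbedding_incl.integral_map]
      have h4 : (P n).map incl = ((R n).mass • (R n).normalize.toFiniteMeasure :
        FiniteMeasure (I × ↥(closure Ω))) :=
        congrArg (fun R : FiniteMeasure (I × ↥(closure Ω)) => (R : Measure (I × ↥(closure Ω))))
          (R n).self_eq_mass_smul_normalize
      rw [h4, FiniteMeasure.toMeasure_smul, integral_smul_nnreal_measure, NNReal.smul_def, hRmass]
      rfl
    rw [← h2]
    exact h1.congr fun n => h3 (f n)
  -- the limit `S` inherits a multiple of Lebesgue measure as time marginal, so it does not charge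
  -- the times `0` and `1`, and comes from a measure on the open cylinder
  have hfst : S.fst = M.toNNReal • (volume : Measure I) := by
    refine ext_of_forall_integral_eq_of_IsFiniteMeasure fun a => ?_
    refine tendsto_nhds_unique (f := fun n => ∫ z, a (incl z).1 ∂(P (f n))) (l := atTop) ?_ ?_
    · rw [Measure.fst, integral_map measurable_fst.aemeasurable
        a.continuous.measurable.aestronglyMeasurable]
      exact hSg (a.toContinuousMap.comp ⟨Prod.fst, continuous_fst⟩)
    · rw [integral_smul_nnreal_measure, NNReal.smul_def, hMc, smul_eq_mul]
      refine (hxM.mul_const _).congr fun n => ?_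
      have h1 := (hv (f n)).fst_map_incl
      rw [← measurableEmbedding_incl.integral_map (fun z : I × ↥(closure Ω) => a z.1),
        ← integral_map (μ := (P (f n)).map incl) measurable_fst.aemeasurable
          a.continuous.measurable.aestronglyMeasurable]
      change _ = ∫ t, a t ∂((P (f n)).map incl).fst
      rw [h1, integral_smul_measure]
      rfl
  have hSr : S.restrict (range incl) = S := by
    refine Measure.restrict_eq_self_of_ae_mem ?_
    have h1 : ∀ᵐ t : I ∂S.fst, (t : ℝ) ∈ Ioo (0 : ℝ) 1 := by
      have h2 : ∀ᵐ r ∂(volume.restrict (Icc (0 : ℝ) 1)), r ∈ Ioo (0 : ℝ) 1 := by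
        rw [← Measure.restrict_congr_set Ioo_ae_eq_Icc]
        exact ae_restrict_mem measurableSet_Ioo
      have h3 : ∀ᵐ t : I, (t : ℝ) ∈ Ioo (0 : ℝ) 1 :=
        unitInterval.measurePreserving_coe.quasiMeasurePreserving.ae h2
      rw [hfst]
      exact Measure.ae_smul_measure h3 M.toNNReal
    have h2 := ae_of_ae_map measurable_fst.aemeasurable h1
    filter_upwards [h2] with z hz
    rw [range_incl]
    exact hz
  set P₀ := S.comap (incl : Cyl Ω → I × ↥(closure Ω)) with hP₀
  have hmap : P₀.map incl = S := by rw [hP₀, measurableEmbedding_incl.map_comap, hSr]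
  have hP₀u : P₀ univ = S univ := by
    rw [← hmap, Measure.map_apply measurableEmbedding_incl.measurable MeasurableSet.univ,
      preimage_univ]
  have hfin : IsFiniteMeasure P₀ := ⟨hP₀u ▸ measure_lt_top S univ⟩
  have hP₀g : ∀ g : C(I × ↥(closure Ω), ℝ), ∫ z, g (incl z) ∂P₀ = ∫ z, g z ∂S := by
    intro g
    rw [← measurableEmbedding_incl.integral_map, hmap]
  simp_rw [← hP₀g] at hSg
  have hMP : P₀.real univ = M := by
    rw [measureReal_def, hP₀u, hS]
    simp [hM.1]
  -- the limit of the fluxes along an ultrafilter is represented by a velocity field for `P₀`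
  let U : Ultrafilter ℕ := Ultrafilter.of atTop
  have hU : (U : Filter ℕ) ≤ atTop := Ultrafilter.of_le _
  have hL : ∀ b : C(I × ↥(closure Ω), Euc d), ∃ y : ℝ,
      Tendsto (fun n => flowFunctional (hv (f n)) b) U (𝓝 y) := by
    intro b
    have hb : Tendsto (fun n => √(∫ z, ‖v (f n) z‖ ^ 2 ∂(P (f n))) *
        √(∫ z, ‖b (incl z)‖ ^ 2 ∂(P (f n)))) atTop (𝓝 (√E * √(∫ z, ‖b (incl z)‖ ^ 2 ∂P₀))) :=
      hxE.sqrt.mul (hSg ⟨fun z => ‖b z‖ ^ 2, by fun_prop⟩).sqrt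
    set c := √E * √(∫ z, ‖b (incl z)‖ ^ 2 ∂P₀)
    have h1 : ∀ᶠ n in (U : Filter ℕ), flowFunctional (hv (f n)) b ∈ Icc (-(c + 1)) (c + 1) := by
      refine hU ?_
      filter_upwards [hb.eventually (gt_mem_nhds (lt_add_one c))] with n hn
      exact abs_le.1 ((abs_flowFunctional_le (hv (f n)) b).trans hn.le)
    obtain ⟨y, -, hy⟩ := isCompact_Icc.ultrafilter_le_nhds
      (U.map fun n => flowFunctional (hv (f n)) b) (le_principal_iff.2 h1)
    exact ⟨y, hy⟩
  choose l hl using hL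
  let L : C(I × ↥(closure Ω), Euc d) →ₗ[ℝ] ℝ :=
    { toFun := l
      map_add' := fun b b' => tendsto_nhds_unique (hl (b + b'))
        (((hl b).add (hl b')).congr fun n => (map_add _ b b').symm)
      map_smul' := fun c b => tendsto_nhds_unique (hl (c • b))
        (((hl b).const_mul c).congr fun n => (map_smul (flowFunctional (hv (f n))) c b).symm) }
  obtain ⟨u, hu, hu2⟩ : ∃ u, IsFlow P₀ u ∧ ∫ z, ‖u z‖ ^ 2 ∂P₀ ≤ √E ^ 2 := by
    refine exists_isFlow_of_functional L (Real.sqrt_nonneg _) (fun b => ?_) (fun ψ hψ => ?_)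
    · have hb : Tendsto (fun n => √(∫ z, ‖v (f n) z‖ ^ 2 ∂(P (f n))) *
          √(∫ z, ‖b (incl z)‖ ^ 2 ∂(P (f n)))) atTop (𝓝 (√E * √(∫ z, ‖b (incl z)‖ ^ 2 ∂P₀))) :=
        hxE.sqrt.mul (hSg ⟨fun z => ‖b z‖ ^ 2, by fun_prop⟩).sqrt
      exact le_of_tendsto_of_tendsto (hl b).abs (hb.mono_left hU)
        (Eventually.of_forall fun n => abs_flowFunctional_le (hv (f n)) b)
    · refine tendsto_nhds_unique ((((hSg (timeDerivMap hψ)).mono_left hU).add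
        (hl (gradMap hψ))).congr fun n => ?_) tendsto_const_nhds
      exact flowFunctional_gradMap (hv (f n)) hψ
  rw [Real.sq_sqrt hE.1] at hu2
  exact ⟨f, M, E, P₀, hfin, u, hf, hxM, hxE, hu, hMP, hu2, hSg⟩

/-- Compactness of the sublevel sets of `J`, and lower semicontinuity of `J`, for narrow convergence
of the curves at every time. -/
theorem exists_subseq_of_J_le {α β : ℝ} (hα : 0 < α) (hβ : 0 < β) {μ : ℕ → Pairs Ω} {C : ℝ}
    (hμ : ∀ n, J α β (μ n) ≤ ENNReal.ofReal C) :
    ∃ (f : ℕ → ℕ) (j : ℝ≥0∞) (ν : Pairs Ω), StrictMono f ∧ j < ⊤ ∧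
      Tendsto (fun n => J α β (μ (f n))) atTop (𝓝 j) ∧ J α β ν ≤ j ∧
      ∀ t (g : C(↥(closure Ω), ℝ)), Tendsto (fun n => ∫ᵛ x, g x ∂•(curve (μ (f n)).1 t)) atTop
        (𝓝 (∫ᵛ x, g x ∂•(curve ν.1 t))) := by
  have hlt : ∀ n, J α β (μ n) < ⊤ := fun n => (hμ n).trans_lt ENNReal.ofReal_lt_top
  rcases isEmpty_or_nonempty ↥(closure Ω) with hY | hY
  -- over the empty set all pairs vanish; there are no probability measures to extract a limit from
  · have h0 : ∀ n, J α β (μ n) = 0 := by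
      intro n
      have : μ n = 0 := by
        refine Prod.ext ?_ ?_ <;> ext s <;> simp [Set.eq_empty_of_isEmpty s]
      rw [this, J_zero]
    refine ⟨id, 0, 0, strictMono_id, ENNReal.zero_lt_top, ?_, (J_zero α β).le, fun t g => ?_⟩
    · simp_rw [h0]
      exact tendsto_const_nhds
    · have h1 : ∀ s s' : SignedMeasure ↥(closure Ω), s = s' := fun s s' => by
        ext E; simp [Set.eq_empty_of_isEmpty E]
      refine tendsto_const_nhds.congr fun n => ?_
      rw [h1 (curve (0 : Pairs Ω).1 t)]
  choose P hP v p hv hp hμP hJ hG using fun n => exists_flow_curve hα hβ (hlt n)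
  have hE0 : ∀ n, 0 ≤ ∫ z, ‖v n z‖ ^ 2 ∂(P n) := fun n => integral_nonneg fun _ => by positivity
  have hM0 : ∀ n, 0 ≤ (P n).real univ := fun n => measureReal_nonneg
  set C' := max C 0
  have hC' : ∀ n, β * ((∫ z, ‖v n z‖ ^ 2 ∂(P n)) / 2) + α * (P n).real univ ≤ C' := by
    intro n
    have h1 := hμ n
    rw [hJ, ENNReal.ofReal_le_ofReal_iff'] at h1
    exact h1.elim (fun h => h.trans (le_max_left _ _)) fun h => h.trans (le_max_right _ _)
  have hA : ∀ n, (P n).real univ ≤ C' / α := fun n => by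
    rw [le_div_iff₀ hα]
    have := mul_nonneg hβ.le (hE0 n)
    linarith [hC' n]
  have hB : ∀ n, ∫ z, ‖v n z‖ ^ 2 ∂(P n) ≤ 2 * C' / β := fun n => by
    rw [le_div_iff₀ hβ]
    have := mul_nonneg hα.le (hM0 n)
    linarith [hC' n]
  obtain ⟨f, M, E, P₀, hP₀, u, hf, hM, hE, hu, hMP, huE, hPg⟩ := exists_subseq_flow hv hA hB
  obtain ⟨q, hq, hqG⟩ := hu.exists_curve
  obtain ⟨ν, hν, hJν⟩ := exists_pair_of_flow hα hβ hu
  refine ⟨f, ENNReal.ofReal (β * (E / 2) + α * M), ν, hf, ENNReal.ofReal_lt_top, ?_, ?_,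
    fun t => ?_⟩
  · simp_rw [hJ]
    exact ENNReal.tendsto_ofReal (((hE.div_const 2).const_mul β).add (hM.const_mul α))
  · rw [hJν, hMP]
    gcongr
  have hMA : M ≤ C' / α := le_of_tendsto' hM fun n => hA _
  have hEB : E ≤ 2 * C' / β := le_of_tendsto' hE fun n => hB _
  rw [hν, hq.curve_eq.2]
  simp_rw [hμP, (hp _).curve_eq.2, toSigned, integral_lsmul_toSignedMeasure]
  obtain ⟨D, -, hDd, hDs⟩ := exists_countable_dense_spaceTests (Ω := Ω)
  have hreal : ∀ n, (p n t : Measure ↥(closure Ω)).real univ ≤ C' / α := fun n => by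
    rw [measureReal_def, (hp n).mass t]
    exact hA n
  have hreal₀ : (q t : Measure ↥(closure Ω)).real univ ≤ C' / α := by
    rw [measureReal_def, hq.mass t]
    exact hMP.trans_le hMA
  refine tendsto_integral_of_dense (fun n => hreal (f n)) hreal₀ hDd fun g hg => ?_
  obtain ⟨G, hGs, hGg⟩ := hDs g hg
  obtain ⟨c, hc⟩ := hGs.exists_bound_fderiv
  have hc0 : 0 ≤ c := (norm_nonneg _).trans (hc 0)
  have hcont : ∀ {p : I → FiniteMeasure ↥(closure Ω)}, Continuous p →
      Continuous fun t => ∫ y, g y ∂(p t : Measure ↥(closure Ω)) := fun hp =>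
    (FiniteMeasure.continuous_integral_boundedContinuousFunction
      (BoundedContinuousFunction.mkOfCompact g)).comp hp
  have hmod : ∀ {E M r : ℝ}, E ≤ 2 * C' / β → M ≤ C' / α → 0 ≤ r →
      c * (√E * √(M * r)) ≤ c * (√(2 * C' / β) * √(C' / α * r)) := by
    intro E M r h1 h2 h3
    gcongr
  refine tendsto_of_tendsto_integral_mul (m := fun r => c * (√(2 * C' / β) * √(C' / α * r))) ?_
    (fun n => hcont (hp (f n)).cont) (hcont hq.cont) (fun n s t => ?_) (fun s t => ?_)
    (fun a => ?_) t
  · refine Continuous.tendsto' (by fun_prop) _ _ (by simp)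
  · simp_rw [hGg]
    exact (hG (f n) G c hGs hc s t).trans (hmod (hB _) (hA _) (abs_nonneg _))
  · simp_rw [hGg]
    exact (hqG G c hGs hc s t).trans (hmod (huE.trans hEB) (hMP.trans_le hMA) (abs_nonneg _))
  · have := hPg ⟨fun z => a z.1 * g z.2, by fun_prop⟩
    rw [hq.integral_eq] at this
    simp_rw [(hp _).integral_eq] at this
    simpa [integral_const_mul] using this

end Compactness

/-! ### Forward operators along curves of measures -/

section Forward

variable {Y : Type*} [MeasurableSpace Y] {H : I → Type*} [∀ t, NormedAddCommGroup (H t)]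
  [∀ t, InnerProductSpace ℝ (H t)]

/-- The quadratic misfit `1/2 ∫_0^1 ‖K_t^* c_t - f_t‖² dt` of a curve of measures. -/
def misfit (K : ∀ t, SignedMeasure Y →ₗ[ℝ] H t) (f : ∀ t, H t) (c : I → SignedMeasure Y) : ℝ :=
  (∫ t, ‖K t (c t) - f t‖ ^ 2) / 2

theorem misfit_nonneg {K : ∀ t, SignedMeasure Y →ₗ[ℝ] H t} {f : ∀ t, H t}
    {c : I → SignedMeasure Y} : 0 ≤ misfit K f c :=
  div_nonneg (integral_nonneg fun _ => by positivity) zero_le_two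

theorem ForwardAssumption.exists_norm_le [TopologicalSpace Y] {D : Type*}
    [NormedAddCommGroup D] [NormedSpace ℝ D] {i : ∀ t, D →L[ℝ] H t}
    {K : ∀ t, SignedMeasure Y →ₗ[ℝ] H t} (hK : ForwardAssumption i K) : ∃ C, 0 ≤ C ∧
    ∀ᵐ t : I, ∀ (s : SignedMeasure Y) (B : ℝ), (tv s).toReal ≤ B → ‖K t s‖ ≤ C * B := by
  obtain ⟨C, hC⟩ := hK.bound
  refine ⟨max C 0, le_max_right _ _, hC.mono fun t ht s B hB => (ht s).trans ?_⟩
  have := le_max_left C 0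
  have := le_max_right C 0
  gcongr

end Forward

section ForwardCurve

variable {Y : Type*} [TopologicalSpace Y] [CompactSpace Y] [MeasurableSpace Y] [BorelSpace Y]

section Preadjoint

variable {F : Type*} [NormedAddCommGroup F] [InnerProductSpace ℝ F]

/-- The pre-adjoint exists: `s ↦ ⟪A s, h⟫` is weak* continuous, and the functionals continuous for
the weak* topology are the integrals against continuous functions. -/
theorem WeakStarToWeak.integral_preadjoint {A : SignedMeasure Y →ₗ[ℝ] F} (hA : WeakStarToWeak A)
    (h : F) (s : SignedMeasure Y) : ∫ᵛ x, preadjoint A h x ∂•s = ⟪A s, h⟫ := by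
  suffices hex : ∃ g : C(Y, ℝ), ∀ s : SignedMeasure Y, ∫ᵛ x, g x ∂•s = ⟪A s, h⟫ by
    rw [preadjoint, dif_pos hex]
    exact hex.choose_spec s
  let E : C(Y, ℝ) →ₗ[ℝ] SignedMeasure Y →ₗ[ℝ] ℝ := LinearMap.mk₂ ℝ
    (fun g s => ∫ᵛ x, g x ∂•s)
    (fun g g' s => VectorMeasure.integral_fun_add (integrable_signed s g) (integrable_signed s g'))
    (fun c g s => VectorMeasure.integral_fun_smul _ _ c g)
    (fun g s s' => VectorMeasure.integral_add_vectorMeasure (integrable_signed s g)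
      (integrable_signed s' g))
    (fun c g s => VectorMeasure.integral_smul_vectorMeasure _ c)
  let L : SignedMeasure Y →ₗ[ℝ] ℝ := (innerₗ F h).comp A
  have hL : Continuous[⨅ g, TopologicalSpace.induced (E g) inferInstance, inferInstance] L := by
    have h1 : weakStar Y = ⨅ g, TopologicalSpace.induced (E g) inferInstance := by
      simp only [weakStar, Pi.topologicalSpace, induced_iInf, induced_compose]
      rfl
    rw [← h1]
    let _ : TopologicalSpace (SignedMeasure Y) := weakStar Y
    exact (WeakBilin.eval_continuous (topDualPairing ℝ F).flip (innerSL ℝ h)).comp hA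
  have hspan := (LinearMap.mem_span_iff_continuous L).2 hL
  have hrange : Submodule.span ℝ (range E) = LinearMap.range E := by
    rw [← LinearMap.coe_range, Submodule.span_eq]
  rw [hrange] at hspan
  obtain ⟨g, hg⟩ := hspan
  refine ⟨g, fun s => ?_⟩
  rw [real_inner_comm]
  exact LinearMap.congr_fun hg s

end Preadjoint

variable {D : Type*} [NormedAddCommGroup D] [NormedSpace ℝ D]
  {H : I → Type*} [∀ t, NormedAddCommGroup (H t)] [∀ t, InnerProductSpace ℝ (H t)]
  {i : ∀ t, D →L[ℝ] H t} {K : ∀ t, SignedMeasure Y →ₗ[ℝ] H t} {f : ∀ t, H t}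
  {c c' : I → SignedMeasure Y}

theorem StronglyMeas.aemeasurable_inner (hH : SamplingAssumption i) {u v : ∀ t, H t}
    (hu : StronglyMeas i u) (hv : StronglyMeas i v) : AEMeasurable fun t => ⟪u t, v t⟫ := by
  obtain ⟨a, ha, hau⟩ := hu
  obtain ⟨b, hb, hbv⟩ := hv
  refine aemeasurable_of_tendsto_metrizable_ae atTop (f := fun n t => ⟪a n t, b n t⟫)
    (fun n => ?_) ?_
  · obtain ⟨k, E, x, hE, hx⟩ := ha n
    obtain ⟨l, G, y, hG, hy⟩ := hb n
    have : (fun t => ⟪a n t, b n t⟫) = fun t => ∑ p : Fin k, ∑ q : Fin l,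
        (E p ∩ G q).indicator (fun t => ⟪i t (x p), i t (y q)⟫) t := by
      ext t
      rw [hx, hy, sum_inner]
      refine Finset.sum_congr rfl fun p _ => ?_
      rw [inner_sum]
      refine Finset.sum_congr rfl fun q _ => ?_
      by_cases h1 : t ∈ E p <;> by_cases h2 : t ∈ G q <;> simp [h1, h2]
    rw [this]
    exact Finset.aemeasurable_fun_sum _ fun p _ => Finset.aemeasurable_fun_sum _ fun q _ =>
      (hH.meas _ _).indicator ((hE p).inter (hG q))
  · filter_upwards [hau, hbv] with t h1 h2
    exact (tendsto_iff_norm_sub_tendsto_zero.2 h1).inner (tendsto_iff_norm_sub_tendsto_zero.2 h2)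

/-- A countable family of a.e. measurable functions may be evaluated at a measurable index. -/
theorem aemeasurable_apply_nat {X : Type*} [MeasurableSpace X] {P : Measure X} {F : ℕ → X → ℝ}
    (hF : ∀ k, AEMeasurable (F k) P) {k : X → ℕ} (hk : Measurable k) :
    AEMeasurable (fun t => F (k t) t) P := by
  refine ⟨fun t => (hF (k t)).mk _ t, ?_, ?_⟩
  · exact (measurable_from_prod_countable_left (f := fun p : X × ℕ => (hF p.2).mk _ p.1)
      fun k => (hF k).measurable_mk).comp (measurable_id.prodMk hk)
  · filter_upwards [ae_all_iff.2 fun k => (hF k).ae_eq_mk] with t ht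
    exact ht _

/-- Narrowly continuous curves are pointwise limits of piecewise constant ones. -/
theorem aemeasurable_inner_curve (hK : ∀ᵐ t : I, WeakStarToWeak (K t)) (hc : NarrowlyContinuous c)
    {u : ∀ t, H t} (hu : ∀ s, AEMeasurable fun t => ⟪K t s, u t⟫) :
    AEMeasurable fun t => ⟪K t (c t), u t⟫ := by
  let τ : ℕ → ℕ → I := fun n k => projIcc 0 1 zero_le_one ((k : ℝ) / n)
  refine aemeasurable_of_tendsto_metrizable_ae atTop
    (f := fun n t => ⟪K t (c (τ n ⌊(t : ℝ) * n⌋₊)), u t⟫) (fun n => ?_) ?_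
  · exact aemeasurable_apply_nat (F := fun k t => ⟪K t (c (τ n k)), u t⟫) (fun k => hu _)
      (Nat.measurable_floor.comp (by fun_prop))
  · filter_upwards [hK] with t ht
    simp_rw [← ht.integral_preadjoint]
    have h1 : Tendsto (fun n : ℕ => τ n ⌊(t : ℝ) * n⌋₊) atTop (𝓝 t) := by
      have h2 := (tendsto_nat_floor_mul_div_atTop t.2.1).comp tendsto_natCast_atTop_atTop
      have h3 := ((continuous_projIcc (h := zero_le_one' ℝ)).tendsto (t : ℝ)).comp h2
      rwa [projIcc_val] at h3
    exact ((hc _).tendsto t).comp h1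

/-- Narrowly continuous curves with bounded mass. -/
structure IsBoundedCurve (c : I → SignedMeasure Y) : Prop where
  cont : NarrowlyContinuous c
  bound : ∃ B, ∀ t, (tv (c t)).toReal ≤ B

theorem aemeasurable_inner_curve_curve (hH : SamplingAssumption i) (hK : ForwardAssumption i K)
    (hc : NarrowlyContinuous c) (hc' : NarrowlyContinuous c') :
    AEMeasurable fun t => ⟪K t (c t), K t (c' t)⟫ := by
  refine aemeasurable_inner_curve hK.weak hc fun s => ?_
  refine (aemeasurable_inner_curve hK.weak hc' fun s' =>
    (hK.meas s').aemeasurable_inner hH (hK.meas s)).congr ?_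
  exact Eventually.of_forall fun t => real_inner_comm _ _

theorem aemeasurable_inner_curve_data (hH : SamplingAssumption i) (hK : ForwardAssumption i K)
    (hf : StronglyMeas i f) (hc : NarrowlyContinuous c) :
    AEMeasurable fun t => ⟪K t (c t), f t⟫ :=
  aemeasurable_inner_curve hK.weak hc fun s => (hK.meas s).aemeasurable_inner hH hf

theorem integrable_inner_curve_curve (hH : SamplingAssumption i) (hK : ForwardAssumption i K)
    (hc : IsBoundedCurve c) (hc' : IsBoundedCurve c') :
    Integrable fun t => ⟪K t (c t), K t (c' t)⟫ := by
  obtain ⟨C, hC0, hC⟩ := hK.exists_norm_le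
  obtain ⟨B, hB⟩ := hc.bound
  obtain ⟨B', hB'⟩ := hc'.bound
  refine Integrable.of_bound (aemeasurable_inner_curve_curve hH hK hc.cont
    hc'.cont).aestronglyMeasurable (C * B * (C * B')) ?_
  filter_upwards [hC] with t ht
  have h1 := ht _ _ (hB t)
  exact (norm_inner_le_norm _ _).trans (mul_le_mul h1 (ht _ _ (hB' t)) (norm_nonneg _)
    ((norm_nonneg _).trans h1))

theorem MemL2H.integrable_norm_sq (hH : SamplingAssumption i) (hf : MemL2H i f) :
    Integrable fun t => ‖f t‖ ^ 2 := by
  have h1 : AEMeasurable fun t => ‖f t‖ ^ 2 := by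
    simp_rw [← real_inner_self_eq_norm_sq]
    exact hf.1.aemeasurable_inner hH hf.1
  refine ⟨h1.aestronglyMeasurable, ?_⟩
  rw [hasFiniteIntegral_iff_enorm]
  simpa [enorm_pow] using hf.2

theorem integrable_inner_curve_data (hH : SamplingAssumption i) (hK : ForwardAssumption i K)
    (hf : MemL2H i f) (hc : IsBoundedCurve c) : Integrable fun t => ⟪K t (c t), f t⟫ := by
  have h1 := integrable_inner_curve_curve hH hK hc hc
  simp_rw [real_inner_self_eq_norm_sq] at h1
  refine (h1.add (hf.integrable_norm_sq hH)).mono'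
    (aemeasurable_inner_curve_data hH hK hf.1 hc.cont).aestronglyMeasurable
    (Eventually.of_forall fun t => ?_)
  refine (norm_inner_le_norm _ _).trans ?_
  simp only [Pi.add_apply]
  nlinarith [sq_nonneg (‖K t (c t)‖ - ‖f t‖), sq_nonneg (‖K t (c t)‖), sq_nonneg ‖f t‖]

theorem integrable_inner_curve_sub (hH : SamplingAssumption i) (hK : ForwardAssumption i K)
    (hf : MemL2H i f) (hc : IsBoundedCurve c) (hc' : IsBoundedCurve c') :
    Integrable fun t => ⟪K t (c' t), K t (c t) - f t⟫ := by
  simp_rw [inner_sub_right]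
  exact (integrable_inner_curve_curve hH hK hc' hc).sub (integrable_inner_curve_data hH hK hf hc')

theorem integrable_norm_sub_sq (hH : SamplingAssumption i) (hK : ForwardAssumption i K)
    (hf : MemL2H i f) (hc : IsBoundedCurve c) : Integrable fun t => ‖K t (c t) - f t‖ ^ 2 := by
  have : (fun t => ‖K t (c t) - f t‖ ^ 2) =
      fun t => ⟪K t (c t), K t (c t) - f t⟫ - ⟪K t (c t), f t⟫ + ‖f t‖ ^ 2 := by
    ext t
    rw [norm_sub_sq_real, inner_sub_right, real_inner_self_eq_norm_sq]
    ring
  rw [this]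
  exact ((integrable_inner_curve_sub hH hK hf hc hc).sub
    (integrable_inner_curve_data hH hK hf hc)).add (hf.integrable_norm_sq hH)

theorem integrable_norm_curve_sub_sq (hH : SamplingAssumption i) (hK : ForwardAssumption i K)
    (hc : IsBoundedCurve c) (hc' : IsBoundedCurve c') :
    Integrable fun t => ‖K t (c' t) - K t (c t)‖ ^ 2 := by
  have : (fun t => ‖K t (c' t) - K t (c t)‖ ^ 2) =
      fun t => ⟪K t (c' t), K t (c' t)⟫ - 2 * ⟪K t (c' t), K t (c t)⟫ +
        ⟪K t (c t), K t (c t)⟫ := by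
    ext t
    rw [norm_sub_sq_real, real_inner_self_eq_norm_sq, real_inner_self_eq_norm_sq]
  rw [this]
  exact ((integrable_inner_curve_curve hH hK hc' hc').sub
    ((integrable_inner_curve_curve hH hK hc' hc).const_mul 2)).add
    (integrable_inner_curve_curve hH hK hc hc)

theorem lintegral_misfit (hH : SamplingAssumption i) (hK : ForwardAssumption i K)
    (hf : MemL2H i f) (hc : IsBoundedCurve c) :
    (∫⁻ t, ‖K t (c t) - f t‖ₑ ^ 2) / 2 = ENNReal.ofReal (misfit K f c) := by
  rw [misfit, ENNReal.ofReal_div_of_pos zero_lt_two,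
    ofReal_integral_eq_lintegral_ofReal (integrable_norm_sub_sq hH hK hf hc)
      (Eventually.of_forall fun _ => by positivity), ENNReal.ofReal_ofNat]
  congr 1
  refine lintegral_congr fun t => ?_
  rw [ENNReal.ofReal_pow (norm_nonneg _), ofReal_norm]

end ForwardCurve

/-! ### The dual variable of a curve -/

section DualVar

variable {d : ℕ} {Ω : Set (Euc d)} [CompactSpace ↥(closure Ω)]
  {D : Type*} [NormedAddCommGroup D] [NormedSpace ℝ D]
  {H : I → Type*} [∀ t, NormedAddCommGroup (H t)] [∀ t, InnerProductSpace ℝ (H t)]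
  {i : ∀ t, D →L[ℝ] H t} {K : ∀ t, SignedMeasure ↥(closure Ω) →ₗ[ℝ] H t} {f : ∀ t, H t}
  {c c' c'' : I → SignedMeasure ↥(closure Ω)}

/-- The pairing `∫_0^1 ∫ w_t dc'_t dt` of a curve `c'` with the dual variable `w` of a
curve `c`. -/
def dualPairing (K : ∀ t, SignedMeasure ↥(closure Ω) →ₗ[ℝ] H t) (f : ∀ t, H t)
    (c c' : I → SignedMeasure ↥(closure Ω)) : ℝ :=
  ∫ t : I, ∫ᵛ x, dualVar K f c t x ∂•(c' t)

theorem integral_dualVar_ae (hK : ForwardAssumption i K) :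
    ∀ᵐ t : I, ∀ s, ∫ᵛ x, dualVar K f c t x ∂•s = -⟪K t s, K t (c t) - f t⟫ := by
  filter_upwards [hK.weak] with t ht s
  rw [← ht.integral_preadjoint, dualVar]
  exact VectorMeasure.integral_fun_neg _ _ _

theorem dualPairing_eq (hK : ForwardAssumption i K) :
    dualPairing K f c c' = -∫ t, ⟪K t (c' t), K t (c t) - f t⟫ := by
  rw [dualPairing, ← integral_neg]
  refine integral_congr_ae ?_
  filter_upwards [integral_dualVar_ae hK (c := c) (f := f)] with t ht
  exact ht _

theorem dualPairing_sub (hH : SamplingAssumption i) (hK : ForwardAssumption i K)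
    (hf : MemL2H i f) (hc : IsBoundedCurve c) (hc' : IsBoundedCurve c')
    (hc'' : IsBoundedCurve c'') :
    dualPairing K f c (fun t => c' t - c'' t) = dualPairing K f c c' - dualPairing K f c c'' := by
  rw [dualPairing_eq hK, dualPairing_eq hK, dualPairing_eq hK]
  simp_rw [map_sub, inner_sub_left]
  rw [integral_sub (integrable_inner_curve_sub hH hK hf hc hc')
    (integrable_inner_curve_sub hH hK hf hc hc'')]
  ring

/-- Second order expansion of the misfit; its gradient is minus the dual variable. -/
theorem misfit_convexCombination (hH : SamplingAssumption i) (hK : ForwardAssumption i K)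
    (hf : MemL2H i f) (hc : IsBoundedCurve c) (hc' : IsBoundedCurve c') (s : ℝ) :
    misfit K f (fun t => (1 - s) • c t + s • c' t) =
      misfit K f c - s * (dualPairing K f c c' - dualPairing K f c c) +
        s ^ 2 * ((∫ t, ‖K t (c' t) - K t (c t)‖ ^ 2) / 2) := by
  have h1 : ∀ t, ‖K t ((1 - s) • c t + s • c' t) - f t‖ ^ 2 = ‖K t (c t) - f t‖ ^ 2 +
      2 * s * (⟪K t (c' t), K t (c t) - f t⟫ - ⟪K t (c t), K t (c t) - f t⟫) +
      s ^ 2 * ‖K t (c' t) - K t (c t)‖ ^ 2 := by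
    intro t
    have : K t ((1 - s) • c t + s • c' t) - f t =
        (K t (c t) - f t) + s • (K t (c' t) - K t (c t)) := by
      rw [map_add, map_smul, map_smul]
      module
    rw [this, norm_add_sq_real, norm_smul, mul_pow, Real.norm_eq_abs, sq_abs, inner_smul_right,
      real_inner_comm, inner_sub_left]
    ring
  have i1 := integrable_norm_sub_sq hH hK hf hc
  have i2 := integrable_inner_curve_sub hH hK hf hc hc'
  have i3 := integrable_inner_curve_sub hH hK hf hc hc
  have i4 := (integrable_norm_curve_sub_sq hH hK hc hc').const_mul (s ^ 2)
  have i5 : Integrable fun t => 2 * s *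
      (⟪K t (c' t), K t (c t) - f t⟫ - ⟪K t (c t), K t (c t) - f t⟫) :=
    (i2.sub i3).const_mul (2 * s)
  have i6 : Integrable fun t => ‖K t (c t) - f t‖ ^ 2 + 2 * s *
      (⟪K t (c' t), K t (c t) - f t⟫ - ⟪K t (c t), K t (c t) - f t⟫) := i1.add i5
  rw [misfit, misfit, dualPairing_eq hK, dualPairing_eq hK]
  simp_rw [h1]
  rw [integral_add i6 i4, integral_add i1 i5, integral_const_mul, integral_const_mul,
    integral_sub i2 i3]
  ring

/-- The misfit lies above its tangent. -/
theorem misfit_ge (hH : SamplingAssumption i) (hK : ForwardAssumption i K)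
    (hf : MemL2H i f) (hc : IsBoundedCurve c) (hc' : IsBoundedCurve c') :
    misfit K f c - (dualPairing K f c c' - dualPairing K f c c) ≤ misfit K f c' := by
  have h := misfit_convexCombination hH hK hf hc hc' 1
  have h1 : 0 ≤ ∫ t, ‖K t (c' t) - K t (c t)‖ ^ 2 := integral_nonneg fun _ => by positivity
  simp only [sub_self, zero_smul, one_smul, zero_add] at h
  change misfit K f c' = _ at h
  linarith

/-- A bound, linear in the mass and integrable in time, which dominates the pairing. -/
theorem exists_abs_inner_le (hH : SamplingAssumption i) (hK : ForwardAssumption i K)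
    (hf : MemL2H i f) (hc : IsBoundedCurve c) : ∃ b : I → ℝ, Integrable b ∧
      ∀ᵐ t : I, ∀ (s : SignedMeasure ↥(closure Ω)) (B : ℝ), (tv s).toReal ≤ B →
        |⟪K t s, K t (c t) - f t⟫| ≤ B * b t := by
  obtain ⟨C, hC0, hC⟩ := hK.exists_norm_le
  refine ⟨fun t => C * (1 + ‖K t (c t) - f t‖ ^ 2),
    ((integrable_const _).add (integrable_norm_sub_sq hH hK hf hc)).const_mul _, ?_⟩
  filter_upwards [hC] with t ht s B hB
  have h1 := ht s B hB
  have hB0 : 0 ≤ B := ENNReal.toReal_nonneg.trans hB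
  calc |⟪K t s, K t (c t) - f t⟫| ≤ ‖K t s‖ * ‖K t (c t) - f t‖ := abs_real_inner_le_norm _ _
    _ ≤ (C * B) * (1 + ‖K t (c t) - f t‖ ^ 2) := by
      gcongr
      nlinarith [sq_nonneg (‖K t (c t) - f t‖ - 1)]
    _ = _ := by ring

theorem exists_abs_dualPairing_le (hH : SamplingAssumption i) (hK : ForwardAssumption i K)
    (hf : MemL2H i f) (hc : IsBoundedCurve c) : ∃ A : ℝ, 0 ≤ A ∧
      ∀ (c' : I → SignedMeasure ↥(closure Ω)) (B : ℝ), (∀ t, (tv (c' t)).toReal ≤ B) →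
        |dualPairing K f c c'| ≤ A * B := by
  obtain ⟨b, hb, hbt⟩ := exists_abs_inner_le hH hK hf hc
  refine ⟨|∫ t, b t|, abs_nonneg _, fun c' B hB => ?_⟩
  have hB0 : 0 ≤ B := ENNReal.toReal_nonneg.trans (hB 0)
  rw [dualPairing_eq hK, abs_neg, ← Real.norm_eq_abs]
  refine (norm_integral_le_of_norm_le (hb.const_mul B) ?_).trans ?_
  · filter_upwards [hbt] with t ht
    exact ht _ _ (hB t)
  · rw [integral_const_mul, mul_comm]
    gcongr
    exact le_abs_self _

/-- The pairing with a fixed dual variable is continuous under narrow convergence at every time with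
bounded masses, by dominated convergence. -/
theorem tendsto_dualPairing (hH : SamplingAssumption i) (hK : ForwardAssumption i K)
    (hf : MemL2H i f) (hc : IsBoundedCurve c) {q : ℕ → I → SignedMeasure ↥(closure Ω)}
    (hq : ∀ n, NarrowlyContinuous (q n)) {B : ℝ} (hB : ∀ n t, (tv (q n t)).toReal ≤ B)
    (h : ∀ t (g : C(↥(closure Ω), ℝ)),
      Tendsto (fun n => ∫ᵛ x, g x ∂•(q n t)) atTop (𝓝 (∫ᵛ x, g x ∂•(c' t)))) :
    Tendsto (fun n => dualPairing K f c (q n)) atTop (𝓝 (dualPairing K f c c')) := by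
  obtain ⟨b, hb, hbt⟩ := exists_abs_inner_le hH hK hf hc
  simp_rw [dualPairing_eq hK]
  refine (tendsto_integral_of_dominated_convergence (fun t => B * b t)
    (fun n => (integrable_inner_curve_sub hH hK hf hc ⟨hq n, B, hB n⟩).1) (hb.const_mul B)
    (fun n => ?_) ?_).neg
  · filter_upwards [hbt] with t ht
    exact ht _ _ (hB n t)
  · filter_upwards [hK.weak] with t ht
    simp_rw [← ht.integral_preadjoint]
    exact h t _

end DualVar

/-! ### The penalty function `φ` -/

section Phi

/-- `φ` on finite arguments, for `M₀ = m > 0`. -/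
def phiReal (m x : ℝ) : ℝ := if x ≤ m then x else (x ^ 2 + m ^ 2) / (2 * m)

theorem continuous_phiReal {m : ℝ} (hm : 0 < m) : Continuous (phiReal m) := by
  refine Continuous.if_le (by fun_prop) (by fun_prop) continuous_id continuous_const fun x hx => ?_
  rw [hx]
  field_simp
  ring

theorem monotone_phiReal {m : ℝ} (hm : 0 < m) : MonotoneOn (phiReal m) (Ici 0) := by
  intro x hx y hy hxy
  rw [mem_Ici] at hx hy
  simp only [phiReal]
  split_ifs with h1 h2 h2
  · exact hxy
  · rw [le_div_iff₀ (by positivity)]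
    nlinarith [sq_nonneg (y - m)]
  · linarith
  · gcongr

theorem le_phiReal {m : ℝ} (hm : 0 < m) (x : ℝ) : x ≤ phiReal m x := by
  simp only [phiReal]
  split_ifs with h
  · exact le_rfl
  · rw [le_div_iff₀ (by positivity)]
    nlinarith [sq_nonneg (x - m)]

theorem sq_le_phiReal {m : ℝ} (hm : 0 < m) {x : ℝ} (hx : 0 ≤ x) :
    x ^ 2 ≤ 2 * m * phiReal m x := by
  simp only [phiReal]
  split_ifs with h
  · nlinarith
  · rw [mul_div_cancel₀ _ (by positivity)]
    nlinarith [sq_nonneg m]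

theorem phi_ofReal {m x : ℝ} (hm : 0 < m) (hx : 0 ≤ x) :
    phi (ENNReal.ofReal m) (ENNReal.ofReal x) = ENNReal.ofReal (phiReal m x) := by
  simp only [phi, phiReal, ENNReal.ofReal_le_ofReal_iff hm.le]
  split_ifs with h
  · rfl
  · rw [ENNReal.ofReal_div_of_pos (by positivity),
      ENNReal.ofReal_add (by positivity) (by positivity), ENNReal.ofReal_mul zero_le_two,
      ENNReal.ofReal_pow hx, ENNReal.ofReal_pow hm.le,
      ENNReal.ofReal_ofNat]

theorem phi_eq_self {M t : ℝ≥0∞} (h : t ≤ M) : phi M t = t := if_pos h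

theorem phi_top {M : ℝ≥0∞} (hM : M < ⊤) : phi M ⊤ = ⊤ := by
  rw [phi, if_neg (by simpa using hM.ne), ENNReal.div_eq_top]
  right
  refine ⟨by simp, by finiteness⟩

theorem phi_zero_left {t : ℝ≥0∞} (ht : t ≠ 0) : phi 0 t = ⊤ := by
  rw [phi, if_neg (by simpa using ht), ENNReal.div_eq_top]
  left
  simp [ht]

theorem le_phi {M t : ℝ≥0∞} (hM : M < ⊤) : t ≤ phi M t := by
  rcases eq_or_ne t ⊤ with rfl | ht
  · rw [phi_top hM]
  rcases eq_or_ne M 0 with rfl | hM0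
  · rcases eq_or_ne t 0 with rfl | h
    · exact zero_le
    · rw [phi_zero_left h]; exact le_top
  rw [← ENNReal.ofReal_toReal ht, ← ENNReal.ofReal_toReal hM.ne,
    phi_ofReal (ENNReal.toReal_pos hM0 hM.ne) ENNReal.toReal_nonneg]
  exact ENNReal.ofReal_le_ofReal (le_phiReal (ENNReal.toReal_pos hM0 hM.ne) _)

end Phi

/-! ### Existence of minimizers -/

section Problem

variable {d : ℕ} {Ω : Set (Euc d)}
  {D : Type*} [NormedAddCommGroup D] [NormedSpace ℝ D]
  {H : I → Type*} [∀ t, NormedAddCommGroup (H t)] [∀ t, InnerProductSpace ℝ (H t)]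
  {i : ∀ t, D →L[ℝ] H t} {K : ∀ t, SignedMeasure ↥(closure Ω) →ₗ[ℝ] H t} {f : ∀ t, H t}
  {α β : ℝ} {μ η ν : Pairs Ω}

theorem J_lt_top_of_T_lt_top (h : T K f α β μ < ⊤) : J α β μ < ⊤ :=
  (ENNReal.add_lt_top.1 h).2

theorem linObjective_of_phi_eq_top {w : I → C(↥(closure Ω), ℝ)}
    (hφ : phi (T K f α β (0 : Pairs Ω)) (J α β η) = ⊤) :
    linObjective K f α β w η = ⊤ := by
  rw [linObjective, hφ, EReal.coe_ennreal_top]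
  refine EReal.add_top_of_ne_bot ?_
  rw [pairing]
  split_ifs
  · rw [← EReal.coe_neg]
    exact EReal.coe_ne_bot _
  · simp

variable [CompactSpace ↥(closure Ω)]

theorem isBoundedCurve_of_J_lt_top (hα : 0 < α) (hβ : 0 < β) (hμ : J α β μ < ⊤) :
    IsBoundedCurve (curve μ.1) :=
  have h := exists_curve_of_J_lt_top hα hβ hμ
  ⟨h.2.1, _, h.2.2⟩

/-- The direct method for functionals on the pairs of finite cost. -/
theorem exists_forall_le_of_coercive (hα : 0 < α) (hβ : 0 < β) (Φ : Pairs Ω → ℝ)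
    (hb : ∃ b, ∀ η, J α β η < ⊤ → b ≤ Φ η)
    (hcoer : ∀ L, ∃ C, ∀ η, J α β η < ⊤ → Φ η ≤ L → (J α β η).toReal ≤ C)
    (hlsc : ∀ (η : ℕ → Pairs Ω) (ν : Pairs Ω) (j m B : ℝ), (∀ n, J α β (η n) < ⊤) →
      J α β ν < ⊤ → Tendsto (fun n => (J α β (η n)).toReal) atTop (𝓝 j) →
      (J α β ν).toReal ≤ j → (∀ n t, (tv (curve (η n).1 t)).toReal ≤ B) →
      (∀ t (g : C(↥(closure Ω), ℝ)), Tendsto (fun n => ∫ᵛ x, g x ∂•(curve (η n).1 t)) atTop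
        (𝓝 (∫ᵛ x, g x ∂•(curve ν.1 t)))) →
      Tendsto (fun n => Φ (η n)) atTop (𝓝 m) → Φ ν ≤ m) :
    ∃ ν, J α β ν < ⊤ ∧ ∀ η, J α β η < ⊤ → Φ ν ≤ Φ η := by
  set S : Set ℝ := Φ '' {η | J α β η < ⊤} with hS
  have hSne : S.Nonempty := ⟨_, 0, by simp [J_zero], rfl⟩
  have hSb : BddBelow S := by
    obtain ⟨b, hb⟩ := hb
    refine ⟨b, ?_⟩
    rintro _ ⟨η, hη, rfl⟩
    exact hb η hη
  obtain ⟨u, -, hu, huS⟩ := exists_seq_tendsto_sInf hSne hSb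
  choose η hη hηu using huS
  obtain ⟨L, hL⟩ := hu.bddAbove_range
  obtain ⟨C, hC⟩ := hcoer L
  have hJC : ∀ n, (J α β (η n)).toReal ≤ C := fun n =>
    hC _ (hη n) ((hηu n).trans_le (hL (mem_range_self n)))
  obtain ⟨s, j, ν, hs, hj, hJj, hνj, hconv⟩ := exists_subseq_of_J_le hα hβ (μ := η) (C := C)
    fun n => (ENNReal.le_ofReal_iff_toReal_le (hη n).ne
      (ENNReal.toReal_nonneg.trans (hJC n))).2 (hJC n)
  refine ⟨ν, hνj.trans_lt hj, fun η' hη' => ?_⟩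
  refine (hlsc (fun n => η (s n)) ν j.toReal (sInf S) (C / α) (fun n => hη _) (hνj.trans_lt hj)
    ((ENNReal.tendsto_toReal hj.ne).comp hJj) (ENNReal.toReal_mono hj.ne hνj) (fun n t => ?_)
    hconv ?_).trans (csInf_le hSb ⟨η', hη', rfl⟩)
  · refine ((exists_curve_of_J_lt_top hα hβ (hη _)).2.2 t).trans ?_
    have := hJC (s n)
    gcongr
  · simp_rw [hηu]
    exact hu.comp hs.tendsto_atTop

theorem T_of_J_lt_top (hα : 0 < α) (hβ : 0 < β) (hH : SamplingAssumption i)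
    (hK : ForwardAssumption i K) (hf : MemL2H i f) (hμ : J α β μ < ⊤) :
    T K f α β μ = ENNReal.ofReal (misfit K f (curve μ.1) + (J α β μ).toReal) := by
  rw [T, fidelity, if_pos (exists_curve_of_J_lt_top hα hβ hμ).1,
    lintegral_misfit hH hK hf (isBoundedCurve_of_J_lt_top hα hβ hμ),
    ENNReal.ofReal_add misfit_nonneg ENNReal.toReal_nonneg, ENNReal.ofReal_toReal hμ.ne]

/-- The misfit is lower semicontinuous along the sequences of the direct method, because it lies
above its tangent at the limit and the pairing is continuous. -/
theorem exists_minimizer (hα : 0 < α) (hβ : 0 < β) (hH : SamplingAssumption i)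
    (hK : ForwardAssumption i K) (hf : MemL2H i f) :
    ∃ μ : Pairs Ω, J α β μ < ⊤ ∧ SolvesP K f α β μ := by
  obtain ⟨ν, hν, hmin⟩ : ∃ ν : Pairs Ω, J α β ν < ⊤ ∧ ∀ η : Pairs Ω, J α β η < ⊤ →
      misfit K f (curve ν.1) + (J α β ν).toReal ≤ misfit K f (curve η.1) + (J α β η).toReal := by
    refine exists_forall_le_of_coercive hα hβ
      (fun η => misfit K f (curve η.1) + (J α β η).toReal)
      ⟨0, fun η _ => add_nonneg misfit_nonneg ENNReal.toReal_nonneg⟩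
      (fun L => ⟨L, fun η _ h => (le_add_of_nonneg_left misfit_nonneg).trans h⟩) ?_
    intro η ν j m B hη hν hj hνj hB hconv hm
    have hcν := isBoundedCurve_of_J_lt_top hα hβ hν
    have h1 := tendsto_dualPairing hH hK hf hcν
      (fun n => (isBoundedCurve_of_J_lt_top hα hβ (hη n)).cont) hB hconv
    -- the misfit lies above its tangent at the limit curve
    have h2 : ∀ n, misfit K f (curve ν.1) + (J α β ν).toReal ≤
        (misfit K f (curve (η n).1) + (J α β (η n)).toReal) - (J α β (η n)).toReal +
          (dualPairing K f (curve ν.1) (curve (η n).1) -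
            dualPairing K f (curve ν.1) (curve ν.1)) + j := by
      intro n
      have := misfit_ge hH hK hf hcν (isBoundedCurve_of_J_lt_top hα hβ (hη n))
      linarith
    have h3 := ((hm.sub hj).add
      (h1.sub_const (dualPairing K f (curve ν.1) (curve ν.1)))).add_const j
    have h4 := ge_of_tendsto' h3 h2
    linarith
  refine ⟨ν, hν, fun η => ?_⟩
  rcases lt_or_ge (J α β η) ⊤ with hη | hη
  · rw [T_of_J_lt_top hα hβ hH hK hf hν, T_of_J_lt_top hα hβ hH hK hf hη]
    exact ENNReal.ofReal_le_ofReal (hmin η hη)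
  · rw [top_le_iff] at hη
    simp [T, hη]

theorem T_zero (hα : 0 < α) (hβ : 0 < β) (hH : SamplingAssumption i)
    (hK : ForwardAssumption i K) (hf : MemL2H i f) :
    T K f α β (0 : Pairs Ω) = ENNReal.ofReal (misfit K f 0) := by
  have h0 : J α β (0 : Pairs Ω) < ⊤ := by simp [J_zero]
  rw [T_of_J_lt_top hα hβ hH hK hf h0, J_zero, ENNReal.toReal_zero, add_zero]
  congr 2
  exact curve_zero.2

/-! ### The linearized problem -/

theorem linObjective_of_J_lt_top (hα : 0 < α) (hβ : 0 < β) {c : I → SignedMeasure ↥(closure Ω)}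
    (hη : J α β η < ⊤) : linObjective K f α β (dualVar K f c) η =
      ((-dualPairing K f c (curve η.1) : ℝ) : EReal) +
        (phi (T K f α β (0 : Pairs Ω)) (J α β η) : EReal) := by
  rw [linObjective, pairing, if_pos (exists_curve_of_J_lt_top hα hβ hη).1, EReal.coe_neg]
  rfl

theorem linObjective_of_phi_lt_top (hα : 0 < α) (hβ : 0 < β) {c : I → SignedMeasure ↥(closure Ω)}
    (hη : J α β η < ⊤) (hφ : phi (T K f α β (0 : Pairs Ω)) (J α β η) < ⊤) :
    linObjective K f α β (dualVar K f c) η =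
      (((phi (T K f α β (0 : Pairs Ω)) (J α β η)).toReal -
        dualPairing K f c (curve η.1) : ℝ) : EReal) := by
  rw [linObjective_of_J_lt_top hα hβ hη, ← EReal.coe_ennreal_toReal hφ.ne, ← EReal.coe_add]
  congr 1
  ring

theorem abs_dualPairing_le_J (hα : 0 < α) (hβ : 0 < β) (hH : SamplingAssumption i)
    (hK : ForwardAssumption i K) (hf : MemL2H i f) (hμ : J α β μ < ⊤) : ∃ A : ℝ, 0 ≤ A ∧
      ∀ η : Pairs Ω, J α β η < ⊤ →
        |dualPairing K f (curve μ.1) (curve η.1)| ≤ A * (J α β η).toReal := by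
  obtain ⟨A, hA0, hA⟩ := exists_abs_dualPairing_le hH hK hf (isBoundedCurve_of_J_lt_top hα hβ hμ)
  refine ⟨A / α, by positivity, fun η hη => ?_⟩
  rw [div_mul_eq_mul_div, ← mul_div_assoc']
  exact hA _ _ (exists_curve_of_J_lt_top hα hβ hη).2.2

theorem linObjective_zero (hα : 0 < α) (hβ : 0 < β) (hH : SamplingAssumption i)
    (hK : ForwardAssumption i K) (hf : MemL2H i f) (hμ : J α β μ < ⊤) :
    linObjective K f α β (dualVar K f (curve μ.1)) (0 : Pairs Ω) = 0 := by
  obtain ⟨A, -, hA⟩ := abs_dualPairing_le_J hα hβ hH hK hf hμ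
  have h0 : J α β (0 : Pairs Ω) < ⊤ := by simp [J_zero]
  have h1 := hA 0 h0
  rw [J_zero, ENNReal.toReal_zero, mul_zero, abs_nonpos_iff] at h1
  rw [linObjective_of_J_lt_top hα hβ h0, h1, J_zero, phi_eq_self zero_le]
  simp

/-- For `M₀ > 0` the direct method applies; for `M₀ = 0` the zero pair is a solution. -/
theorem exists_solvesLin (hα : 0 < α) (hβ : 0 < β) (hH : SamplingAssumption i)
    (hK : ForwardAssumption i K) (hf : MemL2H i f) (hμ : J α β μ < ⊤) :
    ∃ ν : Pairs Ω, SolvesLin K f α β μ ν := by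
  obtain ⟨A, hA0, hA⟩ := abs_dualPairing_le_J hα hβ hH hK hf hμ
  have hT := T_zero hα hβ hH hK hf
  rcases (misfit_nonneg (K := K) (f := f) (c := 0)).eq_or_lt with hm | hm
  -- if `M₀ = 0` then `φ` is infinite away from `0`, and the pairing vanishes on pairs of zero cost
  · rw [← hm, ENNReal.ofReal_zero] at hT
    refine ⟨0, fun η => ?_⟩
    rw [linObjective_zero hα hβ hH hK hf hμ]
    rcases eq_or_ne (J α β η) 0 with hη | hη
    · have h1 := hA η (by simp [hη])
      rw [hη, ENNReal.toReal_zero, mul_zero, abs_nonpos_iff] at h1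
      rw [linObjective_of_J_lt_top hα hβ (by simp [hη]), h1, hη, phi_eq_self zero_le]
      simp
    · rw [linObjective_of_phi_eq_top (by rw [hT, phi_zero_left hη])]
      exact le_top
  set m := misfit K f 0
  have hlin : ∀ η : Pairs Ω, J α β η < ⊤ →
      linObjective K f α β (dualVar K f (curve μ.1)) η =
        ((phiReal m (J α β η).toReal - dualPairing K f (curve μ.1) (curve η.1) : ℝ) : EReal) := by
    intro η hη
    have h1 : phi (T K f α β (0 : Pairs Ω)) (J α β η) =
        ENNReal.ofReal (phiReal m (J α β η).toReal) := by
      rw [hT, ← phi_ofReal hm ENNReal.toReal_nonneg, ENNReal.ofReal_toReal hη.ne]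
    rw [linObjective_of_phi_lt_top hα hβ hη (h1 ▸ ENNReal.ofReal_lt_top), h1,
      ENNReal.toReal_ofReal (ENNReal.toReal_nonneg.trans (le_phiReal hm _))]
  obtain ⟨ν, hν, hmin⟩ : ∃ ν : Pairs Ω, J α β ν < ⊤ ∧ ∀ η : Pairs Ω, J α β η < ⊤ →
      phiReal m (J α β ν).toReal - dualPairing K f (curve μ.1) (curve ν.1) ≤
        phiReal m (J α β η).toReal - dualPairing K f (curve μ.1) (curve η.1) := by
    -- `φ` grows quadratically and the pairing at most linearly in the cost
    have hlow : ∀ η : Pairs Ω, J α β η < ⊤ → (J α β η).toReal ^ 2 ≤ 2 * m *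
        (phiReal m (J α β η).toReal - dualPairing K f (curve μ.1) (curve η.1) +
          A * (J α β η).toReal) := by
      intro η hη
      refine (sq_le_phiReal hm ENNReal.toReal_nonneg).trans ?_
      have := (abs_le.1 (hA η hη)).2
      gcongr
      linarith
    refine exists_forall_le_of_coercive hα hβ
      (fun η => phiReal m (J α β η).toReal - dualPairing K f (curve μ.1) (curve η.1))
      ⟨-(m * A ^ 2 / 2), fun η hη => ?_⟩ (fun L => ⟨2 * m * (A + |L|) + 1, fun η hη hL => ?_⟩) ?_
    · have h1 := hlow η hη
      have h2 := sq_nonneg ((J α β η).toReal - m * A)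
      have h3 : 0 ≤ 2 * m * (phiReal m (J α β η).toReal -
          dualPairing K f (curve μ.1) (curve η.1) + m * A ^ 2 / 2) := by nlinarith
      have := nonneg_of_mul_nonneg_right h3 (by positivity)
      linarith
    · have h1 := hlow η hη
      have hL' : |L| ≥ L := le_abs_self L
      have hL0 := abs_nonneg L
      set x := (J α β η).toReal
      by_contra! hx
      have hx1 : 1 ≤ x := by
        have : 0 ≤ 2 * m * (A + |L|) := by positivity
        linarith
      have h2 : x ^ 2 ≤ 2 * m * (|L| * x + A * x) := by
        refine h1.trans ?_
        gcongr
        refine (hL.trans hL').trans ?_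
        nlinarith
      nlinarith
    · intro η ν j y B hη hν hj hνj hB hconv hy
      have h1 := tendsto_dualPairing hH hK hf (isBoundedCurve_of_J_lt_top hα hβ hμ)
        (fun n => (isBoundedCurve_of_J_lt_top hα hβ (hη n)).cont) hB hconv
      have h2 := (((continuous_phiReal hm).tendsto j).comp hj).sub h1
      rw [tendsto_nhds_unique hy h2]
      have h3 := monotone_phiReal hm (mem_Ici.2 ENNReal.toReal_nonneg)
        (mem_Ici.2 (ENNReal.toReal_nonneg.trans hνj)) hνj
      linarith
  refine ⟨ν, fun η => ?_⟩
  rcases lt_or_ge (J α β η) ⊤ with hη | hη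
  · rw [hlin ν hν, hlin η hη]
    exact EReal.coe_le_coe_iff.2 (hmin η hη)
  · rw [top_le_iff] at hη
    rw [linObjective_of_phi_eq_top (η := η)]
    · exact le_top
    · rw [hη, phi_top (by rw [hT]; exact ENNReal.ofReal_lt_top)]

theorem SolvesLin.phi_lt_top (hα : 0 < α) (hβ : 0 < β) (hH : SamplingAssumption i)
    (hK : ForwardAssumption i K) (hf : MemL2H i f) (hμ : J α β μ < ⊤)
    (h : SolvesLin K f α β μ ν) : phi (T K f α β (0 : Pairs Ω)) (J α β ν) < ⊤ := by
  by_contra hcon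
  have h1 := h 0
  rw [linObjective_zero hα hβ hH hK hf hμ,
    linObjective_of_phi_eq_top (top_le_iff.1 (not_lt.1 hcon)), top_le_iff] at h1
  exact absurd h1 (by simp)

theorem T_zero_lt_top (hα : 0 < α) (hβ : 0 < β) (hH : SamplingAssumption i)
    (hK : ForwardAssumption i K) (hf : MemL2H i f) : T K f α β (0 : Pairs Ω) < ⊤ := by
  rw [T_zero hα hβ hH hK hf]
  exact ENNReal.ofReal_lt_top

theorem SolvesLin.J_lt_top (hα : 0 < α) (hβ : 0 < β) (hH : SamplingAssumption i)
    (hK : ForwardAssumption i K) (hf : MemL2H i f) (hμ : J α β μ < ⊤)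
    (h : SolvesLin K f α β μ ν) : J α β ν < ⊤ :=
  (le_phi (T_zero_lt_top hα hβ hH hK hf)).trans_lt (h.phi_lt_top hα hβ hH hK hf hμ)

/-! ### The primal-dual gap -/

/-- All quantities in the gap are finite, and the curve of `ρ - ρ̂` is the difference of the curves,
so the gap is the excess of `J - ⟨·, w⟩` at `μ` over the minimum of the linearized problem. -/
theorem gap_eq (hα : 0 < α) (hβ : 0 < β) (hH : SamplingAssumption i)
    (hK : ForwardAssumption i K) (hf : MemL2H i f) (hμ : J α β μ < ⊤) {hat : Pairs Ω → Pairs Ω}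
    (h : SolvesLin K f α β μ (hat μ)) : gap K f α β hat μ =
      (((J α β μ).toReal - dualPairing K f (curve μ.1) (curve μ.1) -
        ((phi (T K f α β (0 : Pairs Ω)) (J α β (hat μ))).toReal -
          dualPairing K f (curve μ.1) (curve (hat μ).1)) : ℝ) : EReal) := by
  have hφ := h.phi_lt_top hα hβ hH hK hf hμ
  have hJ := h.J_lt_top hα hβ hH hK hf hμ
  have hsub := curve_sub_of_J_lt_top hα hβ hμ hJ
  have hp : pairing (μ.1 - (hat μ).1) (dualVar K f (curve μ.1)) =
      ((dualPairing K f (curve μ.1) (curve μ.1) -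
        dualPairing K f (curve μ.1) (curve (hat μ).1) : ℝ) : EReal) := by
    have hc := isBoundedCurve_of_J_lt_top hα hβ hμ
    rw [← dualPairing_sub hH hK hf hc hc (isBoundedCurve_of_J_lt_top hα hβ hJ), pairing,
      if_pos hsub.1, hsub.2]
    rfl
  rw [gap, if_pos hμ, hp, ← EReal.coe_ennreal_toReal hμ.ne, ← EReal.coe_ennreal_toReal hφ.ne,
    ← EReal.coe_sub, ← EReal.coe_sub]
  congr 1
  ring

theorem residual_eq (hα : 0 < α) (hβ : 0 < β) (hH : SamplingAssumption i)
    (hK : ForwardAssumption i K) (hf : MemL2H i f) (hμ : J α β μ < ⊤) (hν : J α β ν < ⊤)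
    (hmin : SolvesP K f α β ν) : residual K f α β μ =
      (((misfit K f (curve μ.1) + (J α β μ).toReal) -
        (misfit K f (curve ν.1) + (J α β ν).toReal) : ℝ) : EReal) := by
  have hinf : ⨅ η : Pairs Ω, T K f α β η = T K f α β ν :=
    le_antisymm (iInf_le _ _) (le_iInf hmin)
  have h0 : ∀ {μ : Pairs Ω}, 0 ≤ misfit K f (curve μ.1) + (J α β μ).toReal :=
    add_nonneg misfit_nonneg ENNReal.toReal_nonneg
  rw [residual, hinf, T_of_J_lt_top hα hβ hH hK hf hμ, T_of_J_lt_top hα hβ hH hK hf hν,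
    EReal.coe_ennreal_ofReal, EReal.coe_ennreal_ofReal, max_eq_left h0, max_eq_left h0,
    EReal.coe_sub]

/-- The misfit lies above its tangent at `μ`, and `φ` does not change the cost of a minimizer
`ν`, so that `ν` competes in the linearized problem. -/
theorem residual_le_gap (hα : 0 < α) (hβ : 0 < β) (hH : SamplingAssumption i)
    (hK : ForwardAssumption i K) (hf : MemL2H i f) (hμ : J α β μ < ⊤) {hat : Pairs Ω → Pairs Ω}
    (h : SolvesLin K f α β μ (hat μ)) : residual K f α β μ ≤ gap K f α β hat μ := by
  obtain ⟨ν, hν, hmin⟩ := exists_minimizer (α := α) (β := β) hα hβ hH hK hf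
  have hφ : phi (T K f α β (0 : Pairs Ω)) (J α β ν) = J α β ν :=
    phi_eq_self (le_add_self.trans (hmin 0))
  have h1 := h ν
  rw [linObjective_of_phi_lt_top hα hβ (h.J_lt_top hα hβ hH hK hf hμ)
    (h.phi_lt_top hα hβ hH hK hf hμ), linObjective_of_phi_lt_top hα hβ hν (hφ.trans_lt hν), hφ,
    EReal.coe_le_coe_iff] at h1
  have h2 := misfit_ge hH hK hf (isBoundedCurve_of_J_lt_top hα hβ hμ)
    (isBoundedCurve_of_J_lt_top hα hβ hν)
  rw [residual_eq hα hβ hH hK hf hμ hν hmin, gap_eq hα hβ hH hK hf hμ h, EReal.coe_le_coe_iff]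
  linarith

/-- First order optimality of a minimizer, from the comparison with the convex combinations
`(1 - s) μ + s η` as `s → 0`. -/
theorem SolvesP.sub_dualPairing_le (hα : 0 < α) (hβ : 0 < β) (hH : SamplingAssumption i)
    (hK : ForwardAssumption i K) (hf : MemL2H i f) (hμ : J α β μ < ⊤) (hη : J α β η < ⊤)
    (h : SolvesP K f α β μ) : (J α β μ).toReal - dualPairing K f (curve μ.1) (curve μ.1) ≤
      (J α β η).toReal - dualPairing K f (curve μ.1) (curve η.1) := by
  have hcμ := isBoundedCurve_of_J_lt_top hα hβ hμ
  have hcη := isBoundedCurve_of_J_lt_top hα hβ hη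
  set R := (∫ t, ‖K t (curve η.1 t) - K t (curve μ.1 t)‖ ^ 2) / 2
  have key : ∀ s : ℝ, 0 < s → s ≤ 1 →
      (J α β μ).toReal - dualPairing K f (curve μ.1) (curve μ.1) ≤
        (J α β η).toReal - dualPairing K f (curve μ.1) (curve η.1) + s * R := by
    intro s hs hs1
    obtain ⟨ν, hν, hJν, hcν⟩ := exists_convexCombination hα hβ hμ hη hs.le hs1
    have h1 := h ν
    rw [T_of_J_lt_top hα hβ hH hK hf hμ, T_of_J_lt_top hα hβ hH hK hf hν,
      ENNReal.ofReal_le_ofReal_iff (add_nonneg misfit_nonneg ENNReal.toReal_nonneg), hcν,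
      misfit_convexCombination hH hK hf hcμ hcη] at h1
    change _ ≤ _ - _ + s ^ 2 * R + _ at h1
    refine le_of_mul_le_mul_left ?_ hs
    linarith
  refine ge_of_tendsto (x := 𝓝[>] (0 : ℝ)) (f := fun s =>
    (J α β η).toReal - dualPairing K f (curve μ.1) (curve η.1) + s * R) ?_ ?_
  · exact ((Continuous.tendsto' (by fun_prop) 0 _ (by simp))).mono_left nhdsWithin_le_nhds
  · filter_upwards [Ioc_mem_nhdsGT (zero_lt_one' ℝ)] with s hs
    exact key s hs.1 hs.2

/-- A minimizer of `T` has gap at most zero by first order optimality and `t ≤ φ t`; conversely a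
vanishing gap bounds the residual by zero. -/
theorem solvesP_iff_gap_eq_zero (hα : 0 < α) (hβ : 0 < β) (hH : SamplingAssumption i)
    (hK : ForwardAssumption i K) (hf : MemL2H i f) {hat : Pairs Ω → Pairs Ω}
    (h : ∀ μ, J α β μ < ⊤ → SolvesLin K f α β μ (hat μ)) (μ : Pairs Ω) :
    SolvesP K f α β μ ↔ gap K f α β hat μ = 0 := by
  obtain ⟨ν, hν, hmin⟩ := exists_minimizer (α := α) (β := β) hα hβ hH hK hf
  constructor
  · intro hμ
    have hJ : J α β μ < ⊤ :=
      J_lt_top_of_T_lt_top ((hμ 0).trans_lt (T_zero_lt_top hα hβ hH hK hf))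
    have hr := residual_le_gap hα hβ hH hK hf hJ (h μ hJ)
    rw [residual_eq hα hβ hH hK hf hJ hJ hμ, sub_self, EReal.coe_zero] at hr
    refine le_antisymm ?_ hr
    have hhat := (h μ hJ).J_lt_top hα hβ hH hK hf hJ
    have h1 := hμ.sub_dualPairing_le hα hβ hH hK hf hJ hhat
    have h2 := ENNReal.toReal_mono ((h μ hJ).phi_lt_top hα hβ hH hK hf hJ).ne
      (le_phi (t := J α β (hat μ)) (T_zero_lt_top hα hβ hH hK hf))
    rw [gap_eq hα hβ hH hK hf hJ (h μ hJ), ← EReal.coe_zero, EReal.coe_le_coe_iff]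
    linarith
  · intro hgap
    have hJ : J α β μ < ⊤ := by
      by_contra hcon
      rw [gap, if_neg hcon] at hgap
      exact absurd hgap (by simp)
    have hr := residual_le_gap hα hβ hH hK hf hJ (h μ hJ)
    rw [hgap, residual_eq hα hβ hH hK hf hJ hν hmin, ← EReal.coe_zero, EReal.coe_le_coe_iff] at hr
    intro η
    refine le_trans ?_ (hmin η)
    rw [T_of_J_lt_top hα hβ hH hK hf hJ, T_of_J_lt_top hα hβ hH hK hf hν]
    exact ENNReal.ofReal_le_ofReal (by linarith)

end Problem

end DynInv

end

theorem mainTheorem4 {d : ℕ} (hd : 1 ≤ d) (Ω : Set (DynInv.Euc d)) (hΩ : IsOpen Ω)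
    (hΩb : Bornology.IsBounded Ω)
    {D : Type*} [NormedAddCommGroup D] [NormedSpace ℝ D] [CompleteSpace D]
    {H : I → Type*} [∀ t, NormedAddCommGroup (H t)] [∀ t, InnerProductSpace ℝ (H t)]
    [∀ t, CompleteSpace (H t)]
    (i : ∀ t, D →L[ℝ] H t) (hH : DynInv.SamplingAssumption i)
    (Kstar : ∀ t, SignedMeasure ↥(closure Ω) →ₗ[ℝ] H t) (hK : DynInv.ForwardAssumption i Kstar)
    (f : ∀ t, H t) (hf : DynInv.MemL2H i f)
    (α β : ℝ) (hα : 0 < α) (hβ : 0 < β) :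
    -- the minimum of `T` is attained
    (∃ μ : DynInv.Pairs Ω, DynInv.SolvesP Kstar f α β μ) ∧
    -- the linearized problems have solutions
    (∀ μ : DynInv.Pairs Ω, DynInv.J α β μ < ⊤ →
      ∃ ν : DynInv.Pairs Ω, DynInv.SolvesLin Kstar f α β μ ν) ∧
    -- and, whichever solutions are chosen to form the primal-dual gap:
    ∀ hat : DynInv.Pairs Ω → DynInv.Pairs Ω,
      (∀ μ : DynInv.Pairs Ω, DynInv.J α β μ < ⊤ → DynInv.SolvesLin Kstar f α β μ (hat μ)) →
      (∀ μ : DynInv.Pairs Ω, DynInv.J α β μ < ⊤ →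
        DynInv.residual Kstar f α β μ ≤ DynInv.gap Kstar f α β hat μ) ∧
      ∀ μ : DynInv.Pairs Ω,
        DynInv.SolvesP Kstar f α β μ ↔ DynInv.gap Kstar f α β hat μ = 0 := by
  have : CompactSpace ↥(closure Ω) := isCompact_iff_compactSpace.1 hΩb.isCompact_closure
  refine ⟨?_, fun μ hμ => DynInv.exists_solvesLin hα hβ hH hK hf hμ, fun hat hhat =>
    ⟨fun μ hμ => DynInv.residual_le_gap hα hβ hH hK hf hμ (hhat μ hμ),
      DynInv.solvesP_iff_gap_eq_zero hα hβ hH hK hf hhat⟩⟩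
  obtain ⟨μ, -, hμ⟩ := DynInv.exists_minimizer (Ω := Ω) hα hβ hH hK hf
  exact ⟨μ, hμ⟩
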